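/- Let $(M,g)$ be a complete smooth Riemannian manifold of dimension $n\ge 1$, with distance $d$, and let $x_0,y_0\in M$ be such that $d(x_0,y_0)$ is smaller than the injectivity radius at $y_0$. Let $c:[0,1]\to M$ be the minimal geodesic from $x_0$ to $y_0$, let $u(t):\mathbb R^n\to T_{c(t)}M$ be a parallel orthonormal frame along $c$, and set $R(t)v=u(t)^{-1}\,\mathrm{R}\bigl(u(t)v,c'(t)\bigr)c'(t)$, where $\mathrm R(X,Y)Z=\nabla_X\nabla_YZ-\nabla_Y\nabla_XZ-\nabla_{[X,Y]}Z$ is the curvature tensor. Let $f$ be the $n\times n$-matrix valued solution of the Jacobi equation $$f''(t)+R(t)f(t)=0\quad(0\le t\le 1),\qquad f(1)=0,\quad f'(1)=-I .$$ Then $f(t)$ is invertible for $0\le t<1$. Let $L^2=L^2([0,1]\to\mathbb R^n)$, $L^2_0=\{\varphi\in L^2:\int_0^1\varphi(t)\,dt=0\}$, let $H_0$ be the space of the $h\in H^1([0,1]\to\mathbb R^n)$ with $h(0)=h(1)=0$ and inner product $(h,k)=\int_0^1(h'(t),k'(t))\,dt$, and let $U:L^2_0\to H_0$, $(U\varphi)(t)=\int_0^t\varphi(s)\,ds$,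 which is an isometric isomorphism. The formula $$(T\varphi)(t)=-\int_t^1R(s)\Bigl(\int_0^s\varphi(r)\,dr\Bigr)ds+\int_0^1\Bigl(\int_r^1R(s)\Bigl(\int_0^s\varphi(q)\,dq\Bigr)ds\Bigr)dr$$ defines a bounded symmetric operator $T$ on $L^2_0$, and the formula $$(S\varphi)(t)=\varphi(t)-f'(t)f(t)^{-1}\int_0^t\varphi(s)\,ds$$ defines a bounded operator $S:L^2_0\to L^2$ that is bijective with bounded inverse. They satisfy $$\|S\varphi\|^2=\bigl((I+T)\varphi,\varphi\bigr)\qquad(\varphi\in L^2_0),$$ and $U(I+T)U^{-1}$ is the Hessian at $c$ of the energy $E(\gamma)=\frac12\int_0^1|\gamma'(t)|^2\,dt$ on the Hilbert manifold of $H^1$ paths from $x_0$ to $y_0$; here $c$ is a critical point of $E$, and $h\in H_0$ is identified with the vector field $t\mapsto u(t)h(t)$ along $c$. Moreover: (1) $I+T=S^*S$, $(S^{-1})^*(I+T)=S$, and $I+T$ is invertible with $(I+T)^{-1}=S^{-1}(S^{-1})^*$. (2) $(S^{-1})^*\neq 0$ and $$\inf\sigma(I+T)=\inf\bigl\{\|S\varphi\|^2:\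 \varphi\in L^2_0,\ \|\varphi\|_{L^2}=1\bigr\}=\frac1{\|(S^{-1})^*\|_{op}^2}.$$ -/

import Mathlib

open MeasureTheory Set Topology Bundle
open scoped Manifold ContDiff Bundle ENNReal

noncomputable section

namespace PathHessian

/-! ## The function spaces `L²`, `L²₀` and `H₀` over the time interval `[0,1]` -/

/-- The model space `ℝⁿ` with its Euclidean norm. -/
abbrev Vec (n : ℕ) : Type := EuclideanSpace ℝ (Fin n)

/-- `L²([0,1] → ℝⁿ)`. -/
abbrev L2 (n : ℕ) : Type := Lp (Vec n) 2 (volume.restrict (Icc (0 : ℝ) 1))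

theorem L2.integrableOn {n : ℕ} (φ : L2 n) : IntegrableOn φ (Icc (0 : ℝ) 1) :=
  (Lp.memLp φ).integrable (by norm_num)

theorem L2.intervalIntegrable {n : ℕ} (φ : L2 n) {a b : ℝ} (ha : a ∈ Icc (0 : ℝ) 1)
    (hb : b ∈ Icc (0 : ℝ) 1) : IntervalIntegrable φ volume a b := by
  rw [intervalIntegrable_iff]
  refine (L2.integrableOn φ).mono_set fun t ht => ?_
  rw [uIoc, mem_Ioc] at ht
  exact ⟨(le_min ha.1 hb.1).trans ht.1.le, ht.2.trans (max_le ha.2 hb.2)⟩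

/-- The primitive `t ↦ ∫₀ᵗ φ(s) ds`. -/
def prim {n : ℕ} (φ : ℝ → Vec n) (t : ℝ) : Vec n := ∫ s in (0 : ℝ)..t, φ s

theorem prim_add {n : ℕ} (φ ψ : L2 n) {t : ℝ} (ht : t ∈ Icc (0 : ℝ) 1) :
    prim (φ + ψ : L2 n) t = prim φ t + prim ψ t := by
  have h0 : (0 : ℝ) ∈ Icc (0 : ℝ) 1 := ⟨le_rfl, zero_le_one⟩
  unfold prim
  rw [← intervalIntegral.integral_add (L2.intervalIntegrable φ h0 ht)
    (L2.intervalIntegrable ψ h0 ht)]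
  refine intervalIntegral.integral_congr_ae ?_
  have h := (ae_restrict_iff' measurableSet_Icc).1 (Lp.coeFn_add φ ψ)
  filter_upwards [h] with s hs hst
  rw [uIoc_of_le ht.1] at hst
  exact hs ⟨hst.1.le, hst.2.trans ht.2⟩

theorem prim_smul {n : ℕ} (a : ℝ) (φ : L2 n) {t : ℝ} (ht : t ∈ Icc (0 : ℝ) 1) :
    prim (a • φ : L2 n) t = a • prim φ t := by
  unfold prim
  rw [← intervalIntegral.integral_smul]
  refine intervalIntegral.integral_congr_ae ?_
  have h := (ae_restrict_iff' measurableSet_Icc).1 (Lp.coeFn_smul a φ)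
  filter_upwards [h] with s hs hst
  rw [uIoc_of_le ht.1] at hst
  exact hs ⟨hst.1.le, hst.2.trans ht.2⟩

/-- `L²₀`, the space of the `φ ∈ L²` with `∫₀¹ φ(t) dt = 0`. -/
def L20 (n : ℕ) : Submodule ℝ (L2 n) where
  carrier := {φ | ∫ t in (0 : ℝ)..1, φ t = 0}
  zero_mem' := by
    have h := prim_smul (0 : ℝ) (0 : L2 n) (t := 1) ⟨zero_le_one, le_rfl⟩
    rw [zero_smul, zero_smul] at h
    exact h
  add_mem' {φ ψ} hφ hψ := by
    have h := prim_add φ ψ (t := 1) ⟨zero_le_one, le_rfl⟩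
    have h1 : prim φ 1 = 0 := hφ
    have h2 : prim ψ 1 = 0 := hψ
    rw [h1, h2, add_zero] at h
    exact h
  smul_mem' a φ hφ := by
    have h := prim_smul a φ (t := 1) ⟨zero_le_one, le_rfl⟩
    have h1 : prim φ 1 = 0 := hφ
    rw [h1, smul_zero] at h
    exact h

theorem L20.isClosed (n : ℕ) : IsClosed (L20 n : Set (L2 n)) := by
  have key : (L20 n : Set (L2 n)) = ⋂ c : Vec n, {φ : L2 n | inner ℝ (indicatorConstLp 2
      (μ := volume.restrict (Icc (0 : ℝ) 1)) MeasurableSet.univ (by finiteness) c) φ = 0} := by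
    ext φ
    simp only [mem_iInter, mem_ofPred_eq, L2.inner_indicatorConstLp_eq_inner_setIntegral,
      Measure.restrict_univ]
    change (∫ t in (0 : ℝ)..1, φ t) = 0 ↔ _
    rw [intervalIntegral.integral_of_le zero_le_one, ← integral_Icc_eq_integral_Ioc]
    exact ⟨fun h c => by rw [h, inner_zero_right], fun h => inner_self_eq_zero.1 (h _)⟩
  rw [key]
  exact isClosed_iInter fun c => isClosed_eq (by fun_prop) continuous_const

instance (n : ℕ) : CompleteSpace (L20 n) := (L20.isClosed n).completeSpace_coe

/-- The functions on `[0,1]` that are primitives, vanishing at `0`, of an `L²` function, and that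
vanish at `1`. -/
def H0Sub (n : ℕ) : Submodule ℝ (Icc (0 : ℝ) 1 → Vec n) where
  carrier := {h | h 1 = 0 ∧ ∃ φ : L2 n, ∀ t, h t = prim φ t}
  zero_mem' := ⟨rfl, 0, fun t => by
    have h := prim_smul (0 : ℝ) (0 : L2 n) t.2
    rw [zero_smul, zero_smul] at h
    exact h.symm⟩
  add_mem' := by
    rintro h k ⟨h1, φ, hφ⟩ ⟨k1, ψ, hψ⟩
    exact ⟨by simp [h1, k1], φ + ψ, fun t => by
      rw [prim_add φ ψ t.2, Pi.add_apply, hφ t, hψ t]⟩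
  smul_mem' := by
    rintro a h ⟨h1, φ, hφ⟩
    exact ⟨by simp [h1], a • φ, fun t => by
      rw [prim_smul a φ t.2, Pi.smul_apply, hφ t]⟩

/-- `H₀`, the space of the `H¹` functions `h : [0,1] → ℝⁿ` with `h(0) = h(1) = 0`. -/
def H0 (n : ℕ) : Type := H0Sub n

instance (n : ℕ) : AddCommGroup (H0 n) := inferInstanceAs (AddCommGroup (H0Sub n))
instance (n : ℕ) : Module ℝ (H0 n) := inferInstanceAs (Module ℝ (H0Sub n))

/-- The value of `h ∈ H₀` at time `t` (only `t ∈ [0,1]` matters; `h` is extended by `0`). -/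
def H0.eval {n : ℕ} (h : H0 n) (t : ℝ) : Vec n := IccExtend zero_le_one h.1 t

/-- The linear map `φ ↦ ∫₀^· φ(s) ds` from `L²₀` to `H₀`. -/
def primLin (n : ℕ) : L20 n →ₗ[ℝ] H0 n where
  toFun φ := ⟨fun t => prim (φ : L2 n) t, φ.2, φ, fun _ => rfl⟩
  map_add' φ ψ := Subtype.ext (funext fun t => prim_add (φ : L2 n) (ψ : L2 n) t.2)
  map_smul' a φ := Subtype.ext (funext fun t => prim_smul a (φ : L2 n) t.2)

theorem primLin_bijective (n : ℕ) : Function.Bijective (primLin n) := by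
  constructor
  · rw [← LinearMap.ker_eq_bot, LinearMap.ker_eq_bot']
    intro φ hφ
    have h0 : ∀ t : Icc (0 : ℝ) 1, prim (φ : L2 n) t = 0 :=
      fun t => congrFun (congrArg Subtype.val hφ) t
    have hI : IntervalIntegrable (φ : L2 n) volume 0 1 :=
      L2.intervalIntegrable _ ⟨le_rfl, zero_le_one⟩ ⟨zero_le_one, le_rfl⟩
    have hd := hI.ae_hasDerivAt_integral
    apply Subtype.ext
    apply Lp.ext
    refine Filter.EventuallyEq.trans ?_ (Lp.coeFn_zero _ _ _).symm
    have hIoo : ∀ᵐ t ∂(volume.restrict (Icc (0 : ℝ) 1)), t ∈ Ioo (0 : ℝ) 1 := by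
      rw [← restrict_Ioo_eq_restrict_Icc]
      exact ae_restrict_mem measurableSet_Ioo
    filter_upwards [ae_restrict_of_ae hd, hIoo] with t ht htm
    have hmem : t ∈ uIcc (0 : ℝ) 1 := by
      rw [uIcc_of_le zero_le_one]; exact Ioo_subset_Icc_self htm
    have h1 := ht hmem 0 (by simp)
    have h2 : HasDerivAt (fun u => ∫ s in (0 : ℝ)..u, (φ : L2 n) s) 0 t := by
      refine (hasDerivAt_const t (0 : Vec n)).congr_of_eventuallyEq ?_
      filter_upwards [Ioo_mem_nhds htm.1 htm.2] with u hu
      exact h0 ⟨u, Ioo_subset_Icc_self hu⟩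
    exact h1.unique h2
  · rintro ⟨h, h1, φ, hφ⟩
    refine ⟨⟨φ, ?_⟩, Subtype.ext (funext fun t => (hφ t).symm)⟩
    exact (hφ 1).symm.trans h1

/-- `φ ↦ ∫₀^· φ(s) ds` as a linear bijection from `L²₀` to `H₀`; its inverse is `h ↦ h'`. -/
def primEquiv (n : ℕ) : L20 n ≃ₗ[ℝ] H0 n := LinearEquiv.ofBijective (primLin n) (primLin_bijective n)

/-- The norm `‖h‖² = ∫₀¹ |h'(t)|² dt` on `H₀`. -/
instance (n : ℕ) : NormedAddCommGroup (H0 n) :=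
  NormedAddCommGroup.induced (H0 n) (L20 n) (primEquiv n).symm (primEquiv n).symm.injective

/-- The inner product `(h, k) = ∫₀¹ (h'(t), k'(t)) dt` on `H₀`. -/
instance (n : ℕ) : InnerProductSpace ℝ (H0 n) where
  norm_smul_le a h := by
    change ‖(primEquiv n).symm (a • h)‖ ≤ ‖a‖ * ‖(primEquiv n).symm h‖
    rw [map_smul]
    exact norm_smul_le _ _
  inner h k := inner ℝ ((primEquiv n).symm h) ((primEquiv n).symm k)
  norm_sq_eq_re_inner h := norm_sq_eq_re_inner (𝕜 := ℝ) ((primEquiv n).symm h)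
  conj_inner_symm h k := inner_conj_symm (𝕜 := ℝ) _ _
  add_left h k l := by rw [map_add, inner_add_left]
  smul_left h k a := by rw [map_smul]; exact inner_smul_left (𝕜 := ℝ) ((primEquiv n).symm h) _ a

/-- The isometry `U : L²₀ → H₀`, `(U φ)(t) = ∫₀ᵗ φ(s) ds`. -/
def U (n : ℕ) : L20 n ≃ₗᵢ[ℝ] H0 n where
  toLinearEquiv := primEquiv n
  norm_map' φ := by
    change ‖(primEquiv n).symm (primEquiv n φ)‖ = ‖φ‖
    rw [LinearEquiv.symm_apply_apply]

theorem U_eval {n : ℕ} (φ : L20 n) {t : ℝ} (ht : t ∈ Icc (0 : ℝ) 1) :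
    (U n φ).eval t = ∫ s in (0 : ℝ)..t, (φ : L2 n) s :=
  IccExtend_of_mem zero_le_one _ ht

instance (n : ℕ) : CompleteSpace (H0 n) :=
  (U n).toIsometryEquiv.completeSpace_iff.1 inferInstance

/-! ## Riemannian geometry -/

section Geometry

variable {n : ℕ} {M : Type*} [MetricSpace M] [ChartedSpace (Vec n) M] [IsManifold (𝓡 n) ∞ M]
  [RiemannianBundle (fun x : M => TangentSpace (𝓡 n) x)]

/-- The coefficients `g_{ij}` of the metric in the chart `e`, at the point with coordinates `y`. -/
def metricCoeff (e : OpenPartialHomeomorph M (Vec n)) (y : Vec n) : Matrix (Fin n) (Fin n) ℝ :=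
  Matrix.of fun i j =>
    inner ℝ
      (mfderiv (𝓡 n) (𝓡 n) e.symm y (EuclideanSpace.single i (1 : ℝ)) :
        TangentSpace (𝓡 n) (e.symm y))
      (mfderiv (𝓡 n) (𝓡 n) e.symm y (EuclideanSpace.single j (1 : ℝ)))

/-- The partial derivative `∂_k g_{ij}` in the chart `e`. -/
def dMetricCoeff (e : OpenPartialHomeomorph M (Vec n)) (k i j : Fin n) (y : Vec n) : ℝ :=
  fderiv ℝ (fun z => metricCoeff e z i j) y (EuclideanSpace.single k (1 : ℝ))

/-- The Christoffel symbols of the Levi-Civita connection in the chart `e`,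
`Γ^k_{ij} = ½ ∑_l g^{kl} (∂_i g_{jl} + ∂_j g_{il} - ∂_l g_{ij})`. -/
def christoffel (e : OpenPartialHomeomorph M (Vec n)) (y : Vec n) (k i j : Fin n) : ℝ :=
  (1 / 2) * ∑ l, (metricCoeff e y)⁻¹ k l *
    (dMetricCoeff e i j l y + dMetricCoeff e j i l y - dMetricCoeff e l i j y)

/-- The bilinear form `Γ_y(v, w) = ∑_{i,j} Γ^·_{ij}(y) v^i w^j`: in the chart `e`, the Levi-Civita
derivative of a vector field `w` in the direction `v` is `∂_v w + Γ(v, w)`. -/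
def christoffelForm (e : OpenPartialHomeomorph M (Vec n)) (y v w : Vec n) : Vec n :=
  WithLp.toLp 2 fun k => ∑ i, ∑ j, christoffel e y k i j * v i * w j

/-- The curvature `R(a, b) w = ∇_a ∇_b w - ∇_b ∇_a w` in the chart `e`, where `a`, `b`, `w` are the
vector fields with constant coordinates in `e` (so that `[a, b] = 0`). -/
def chartCurvature (e : OpenPartialHomeomorph M (Vec n)) (y a b w : Vec n) : Vec n :=
  fderiv ℝ (fun z => christoffelForm e z b w) y a - fderiv ℝ (fun z => christoffelForm e z a w) y b
    + christoffelForm e y a (christoffelForm e y b w)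
    - christoffelForm e y b (christoffelForm e y a w)

/-- The coordinates `de_x(v)` of the tangent vector `v ∈ T_x M` in the chart `e`. -/
def chartDiff (e : OpenPartialHomeomorph M (Vec n)) (x : M) (v : TangentSpace (𝓡 n) x) : Vec n :=
  mfderiv (𝓡 n) (𝓡 n) e x v

/-- The Riemann curvature tensor `R(a, b) w` at the point `x`, computed in the preferred chart
at `x`. -/
def curvature (x : M) (a b w : TangentSpace (𝓡 n) x) : TangentSpace (𝓡 n) x :=
  (mfderiv (𝓡 n) (𝓡 n) (chartAt (Vec n) x) x).inverse
    (chartCurvature (chartAt (Vec n) x) (chartAt (Vec n) x x)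
      (chartDiff (chartAt (Vec n) x) x a) (chartDiff (chartAt (Vec n) x) x b)
      (chartDiff (chartAt (Vec n) x) x w))

/-- The velocity `γ'(t)` of a curve parametrized by `[0,1]` (one-sided at the end points). -/
def velocity (γ : ℝ → M) (t : ℝ) : TangentSpace (𝓡 n) (γ t) :=
  mfderivWithin 𝓘(ℝ, ℝ) (𝓡 n) γ (Icc 0 1) t (1 : ℝ)

/-- `γ : [0,1] → M` is a geodesic: in every smooth chart, `x = e ∘ γ` is twice differentiable and
`x'' + Γ_x(x', x') = 0`. -/
def IsGeodesic (γ : ℝ → M) : Prop :=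
  ContinuousOn γ (Icc 0 1) ∧
  ∀ e ∈ IsManifold.maximalAtlas (𝓡 n) ∞ M, ∀ t ∈ Icc (0 : ℝ) 1, γ t ∈ e.source →
    DifferentiableWithinAt ℝ (e ∘ γ) (Icc 0 1) t ∧
    HasDerivWithinAt (derivWithin (e ∘ γ) (Icc 0 1))
      (-christoffelForm e (e (γ t)) (derivWithin (e ∘ γ) (Icc 0 1) t)
        (derivWithin (e ∘ γ) (Icc 0 1) t)) (Icc 0 1) t

/-- `c : [0,1] → M` is a minimal geodesic from `x₀` to `y₀`: its length is `d(x₀, y₀)`. -/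
def IsMinimalGeodesic (c : ℝ → M) (x₀ y₀ : M) : Prop :=
  IsGeodesic (n := n) c ∧ c 0 = x₀ ∧ c 1 = y₀ ∧ Manifold.pathELength (𝓡 n) c 0 1 = edist x₀ y₀

open Classical in
/-- The exponential map: `exp_x(v) = γ(1)` for the geodesic `γ` with `γ(0) = x`, `γ'(0) = v`. -/
def expMap (x : M) (v : TangentSpace (𝓡 n) x) : M :=
  if h : ∃ γ : ℝ → M, IsGeodesic (n := n) γ ∧
      (⟨γ 0, velocity γ 0⟩ : TangentBundle (𝓡 n) M) = ⟨x, v⟩ then h.choose 1 else x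

/-- The injectivity radius at `x`: the supremum of the `ρ` such that `exp_x` is a smooth
diffeomorphism from the ball of radius `ρ` in `T_x M` onto an open subset of `M`. -/
def injectivityRadius (x : M) : ℝ≥0∞ :=
  ⨆ (ρ : ℝ) (_ : ∃ Φ : PartialDiffeomorph 𝓘(ℝ, TangentSpace (𝓡 n) x) (𝓡 n)
      (TangentSpace (𝓡 n) x) M ∞,
    Φ.source = Metric.ball 0 ρ ∧ EqOn Φ (expMap x) (Metric.ball 0 ρ)), ENNReal.ofReal ρ

/-- `u` is a parallel orthonormal frame along `c`: each `u t : ℝⁿ → T_{c(t)} M` is a linear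
isometry, and in every smooth chart `e` the coordinate expression `y` of `t ↦ u(t) v` satisfies
`y' + Γ_{e ∘ c}((e ∘ c)', y) = 0`. -/
def IsParallelFrame (c : ℝ → M) (u : ∀ t, Vec n ≃ₗᵢ[ℝ] TangentSpace (𝓡 n) (c t)) : Prop :=
  ∀ e ∈ IsManifold.maximalAtlas (𝓡 n) ∞ M, ∀ t ∈ Icc (0 : ℝ) 1, c t ∈ e.source → ∀ v : Vec n,
    HasDerivWithinAt (fun s => chartDiff e (c s) (u s v))
      (-christoffelForm e (e (c t)) (derivWithin (e ∘ c) (Icc 0 1) t)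
        (chartDiff e (c t) (u t v))) (Icc 0 1) t

/-- `R(t) v = u(t)⁻¹ R(u(t) v, c'(t)) c'(t)`. -/
def curvatureAlong (c : ℝ → M) (u : ∀ t, Vec n ≃ₗᵢ[ℝ] TangentSpace (𝓡 n) (c t)) (t : ℝ)
    (v : Vec n) : Vec n :=
  (u t).symm (curvature (c t) (u t v) (velocity c t) (velocity c t))

/-- The energy `E(γ) = ½ ∫₀¹ |γ'(t)|² dt`. -/
def energy (γ : ℝ → M) : ℝ := (1 / 2) * ∫ t in (0 : ℝ)..1, ‖velocity (n := n) γ t‖ ^ 2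

/-- A chart at `c` of the Hilbert manifold of the `H¹` paths with the end points of `c`, obtained
from a chart `e` of `M` that contains `c`: near `0 ∈ H₀`, `h` is sent to the path which in the
coordinates `e` is `e(c(t)) + de_{c(t)}(u(t) h(t))`. The path of `h = 0` is `c`, and the derivative
at `0` sends `h` to the vector field `t ↦ u(t) h(t)` along `c`. -/
def pathChart (c : ℝ → M) (u : ∀ t, Vec n ≃ₗᵢ[ℝ] TangentSpace (𝓡 n) (c t))
    (e : OpenPartialHomeomorph M (Vec n)) (h : H0 n) (t : ℝ) : M :=
  e.symm (e (c t) + chartDiff e (c t) (u t (h.eval t)))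

/-- The bounded operator `A` on `H₀` is the Hessian of the energy at the critical point `c` of `E`
on the Hilbert manifold of the `H¹` paths with the end points of `c`, where the tangent space at
`c` is identified with `H₀` by means of the parallel frame `u`. As the Hessian at a critical point,
it is the second derivative (the derivative of the gradient) of `E` at `c` in any chart whose
derivative at `c` is this identification. Charts `e` of `M` containing `c` are required to exist,
and `A` is required to be the second derivative for all of them. -/
def IsEnergyHessian (c : ℝ → M) (u : ∀ t, Vec n ≃ₗᵢ[ℝ] TangentSpace (𝓡 n) (c t))
    (A : H0 n →L[ℝ] H0 n) : Prop :=
  (∃ e ∈ IsManifold.maximalAtlas (𝓡 n) ∞ M, MapsTo c (Icc 0 1) e.source) ∧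
  ∀ e ∈ IsManifold.maximalAtlas (𝓡 n) ∞ M, MapsTo c (Icc 0 1) e.source →
    (∀ᶠ h in 𝓝 (0 : H0 n), DifferentiableAt ℝ (fun k => energy (n := n) (pathChart c u e k)) h) ∧
    gradient (fun k => energy (n := n) (pathChart c u e k)) 0 = 0 ∧
    HasFDerivAt (gradient fun k => energy (n := n) (pathChart c u e k)) A 0

end Geometry

/-- `f` with derivative `f'` is the `n × n`-matrix valued solution of the Jacobi equation
`f'' + R f = 0` on `[0,1]` with `f(1) = 0`, `f'(1) = -I`. -/
structure IsJacobiSolution {n : ℕ} (R : ℝ → Vec n → Vec n) (f f' : ℝ → Vec n →L[ℝ] Vec n) :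
    Prop where
  deriv_eq : ∀ t ∈ Icc (0 : ℝ) 1, HasDerivWithinAt f (f' t) (Icc 0 1) t
  jacobi : ∀ t ∈ Icc (0 : ℝ) 1, ∀ v,
    HasDerivWithinAt (fun s => f' s v) (-R t (f t v)) (Icc 0 1) t
  terminal : f 1 = 0
  terminal_deriv : f' 1 = -1

/-- `(T φ)(t) = -∫ₜ¹ R(s) (∫₀ˢ φ) ds + ∫₀¹ (∫ᵣ¹ R(s) (∫₀ˢ φ) ds) dr` for a.e. `t`. -/
def IsOperatorT {n : ℕ} (R : ℝ → Vec n → Vec n) (T : L20 n →L[ℝ] L20 n) : Prop :=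
  ∀ φ : L20 n, (T φ : L2 n) =ᵐ[volume.restrict (Icc (0 : ℝ) 1)] fun t =>
    -(∫ s in t..1, R s (∫ r in (0 : ℝ)..s, (φ : L2 n) r))
      + ∫ r in (0 : ℝ)..1, ∫ s in r..1, R s (∫ q in (0 : ℝ)..s, (φ : L2 n) q)

/-- `(S φ)(t) = φ(t) - f'(t) f(t)⁻¹ ∫₀ᵗ φ(s) ds` for a.e. `t`. -/
def IsOperatorS {n : ℕ} (f f' : ℝ → Vec n →L[ℝ] Vec n) (S : L20 n →L[ℝ] L2 n) : Prop :=
  ∀ φ : L20 n, (S φ : L2 n) =ᵐ[volume.restrict (Icc (0 : ℝ) 1)] fun t =>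
    (φ : L2 n) t - f' t (Ring.inverse (f t) (∫ s in (0 : ℝ)..t, (φ : L2 n) s))

end PathHessian

end

open PathHessian

/-!
The proof has a geometric part, which produces the matrix solution `f` in an explicit form, an
operator-theoretic part on `L²([0,1])`, and an analytic part which computes the Hessian of the
energy.

**The Jacobi field.** Since `d(x₀, y₀)` is below the injectivity radius at `y₀`, the exponential map
at `y₀` is a chart on a ball that contains `c`, and in this chart `c` is the ray `t ↦ (1 - t) w₀`
(`exists_chart_of_lt_injectivityRadius`). All rays from the origin are geodesics there, so the
variations `(1 - t) w` of `c` solve the linearized geodesic equation, hence the Jacobi equation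
(`linearized_geodesic`). Read in the parallel frame they have the end conditions of `f`, and
uniqueness for linear equations gives `f(t) = (1 - t) A(t)` with `A` invertible on all of `[0,1]`
(`IsFrameAlong.isJacobiFactorization`, `exists_isJacobiFactorization`). This is the only place where
the injectivity radius enters; the operators depend on the geometry only through this
factorization, and the continuity and the symmetry of the curvature operator `R`.

**The operators `T` and `S`.** With `V φ = ∫₀^· φ`, the operator `T` is the compression of
`-V* R V` to `L²₀`, which makes it bounded and symmetric (`isOperatorT_operatorT`,
`isSelfAdjoint_operatorT`). Put `h = V φ` and `q = f' f⁻¹`. The Wronskian of `f` with itself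
vanishes, so `q` is symmetric, and `q' = -R - q²` gives
`|φ|² - ⟨R h, h⟩ - |φ - q h|² = d/dt ⟨q h, h⟩` (`integral_defect`). Although `q` has a pole of order
one at `1`, the boundary term tends to zero, because `h(1) = 0` and so `|h(t)|² = o(1 - t)` by the
Cauchy–Schwarz inequality (`tendsto_boundary`). Integration gives `‖S φ‖² = ⟨(1 + T) φ, φ⟩`
(`norm_sq_linS`). The equation `S φ = ψ` amounts to `(f⁻¹ h)' = f⁻¹ ψ`, so `S` is injective, and
`h = f ∫₀^· f⁻¹ ψ` gives a preimage; that its derivative is square integrable despite the pole is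
a Hardy inequality (`hardy`, `linS_surjective`). The open mapping theorem bounds `S⁻¹`.

The assertions (1) and (2) then hold for every self-adjoint operator `B` on a nontrivial Hilbert
space with `‖S φ‖² = ⟨B φ, φ⟩` for an invertible `S`: polarization gives `B = S* S`
(`eq_adjoint_comp`, `isUnit_and_inverse_eq`), the infimum of `‖S φ‖²` over the unit sphere is
`‖S⁻¹‖⁻²` (`isGLB_norm_sq`), and the infimum of the spectrum of a self-adjoint operator is that of
its quadratic form (`isGLB_spectrum`).

**The Hessian.** In a chart around `c` a path near `c` is `x + B h`, where `x` is `c` and `B` the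
parallel frame in coordinates, and its energy is `½ ∫ ⟨G(x + B h) (x + B h)', (x + B h)'⟩`. As
`h ↦ B h` maps `H₀` continuously into the continuous functions, and superposition with a smooth
function is smooth there (`contDiff_comp`), the energy agrees near `0` with a `C²` function of
`φ = h' ∈ L²` (`exists_coordinate_energy`). Its gradient and Hessian are determined by the first two
derivatives along rays, by polarization (`hasFDerivAt_gradient_of_rays`), and those are the
classical variations of the energy: the first is `∫ ⟨c', h'⟩ = 0` (`first_variation`), and the second
is `∫ |h'|² - ⟨R h, h⟩`, up to the integral of the derivative of a function that vanishes at both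
ends (`second_variation_density`, `second_variation`). This is `⟨(1 + T) φ, φ⟩`
(`isEnergyHessian`).
-/

noncomputable section

namespace PathHessian

/-! ### Riemannian calculus in a coordinate domain -/

set_option synthInstance.maxHeartbeats 200000

section Coordinates

theorem minSmoothness_two_le : minSmoothness ℝ 2 ≤ (∞ : WithTop ℕ∞) := by
  rw [minSmoothness_of_isRCLikeNormedField]
  exact WithTop.coe_le_coe.2 (le_top : (2 : ℕ∞) ≤ ⊤)

variable {E : Type*} [NormedAddCommGroup E] [InnerProductSpace ℝ E]

/-- On the open set `Ω` of the Euclidean space `E`, `Γ` is the Christoffel form of the Levi-Civita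
connection of the Riemannian metric `(v, w) ↦ ⟪G y v, w⟫`. Instead of the Koszul formula the
structure records its characterization: `Γ` is symmetric and compatible with the metric. -/
structure IsLeviCivitaOn (Ω : Set E) (G : E → E →L[ℝ] E) (Γ : E → E →L[ℝ] E →L[ℝ] E) : Prop where
  isOpen : IsOpen Ω
  contDiffOn_metric : ContDiffOn ℝ ∞ G Ω
  contDiffOn_conn : ContDiffOn ℝ ∞ Γ Ω
  symm : ∀ y ∈ Ω, ∀ v w, inner ℝ (G y v) w = inner ℝ (G y w) v
  posDef : ∀ y ∈ Ω, ∀ v, v ≠ 0 → 0 < inner ℝ (G y v) v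
  torsionFree : ∀ y ∈ Ω, ∀ v w, Γ y v w = Γ y w v
  compat : ∀ y ∈ Ω, ∀ a v w, inner ℝ (fderiv ℝ G y a v) w =
    inner ℝ (G y (Γ y a v)) w + inner ℝ (G y (Γ y a w)) v

/-- The curvature `R(a, b) w` of the connection with Christoffel form `Γ`, for constant
vector fields `a`, `b`, `w`. -/
def curv (Γ : E → E →L[ℝ] E →L[ℝ] E) (y a b w : E) : E :=
  fderiv ℝ Γ y a b w - fderiv ℝ Γ y b a w + Γ y a (Γ y b w) - Γ y b (Γ y a w)

namespace IsLeviCivitaOn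

variable {Ω : Set E} {G : E → E →L[ℝ] E} {Γ : E → E →L[ℝ] E →L[ℝ] E}

theorem differentiableAt_metric (h : IsLeviCivitaOn Ω G Γ) {y : E} (hy : y ∈ Ω) :
    DifferentiableAt ℝ G y :=
  (h.contDiffOn_metric.contDiffAt (h.isOpen.mem_nhds hy)).differentiableAt (by simp)

theorem differentiableAt_conn (h : IsLeviCivitaOn Ω G Γ) {y : E} (hy : y ∈ Ω) :
    DifferentiableAt ℝ Γ y :=
  (h.contDiffOn_conn.contDiffAt (h.isOpen.mem_nhds hy)).differentiableAt (by simp)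

theorem differentiableAt_fderiv_metric (h : IsLeviCivitaOn Ω G Γ) {y : E} (hy : y ∈ Ω) :
    DifferentiableAt ℝ (fderiv ℝ G) y :=
  ((h.contDiffOn_metric.contDiffAt (h.isOpen.mem_nhds hy)).fderiv_right
    (m := 1) (by norm_cast)).differentiableAt (by simp)

theorem eq_of_inner (h : IsLeviCivitaOn Ω G Γ) {y : E} (hy : y ∈ Ω) {v w : E}
    (hvw : ∀ z, inner ℝ (G y v) z = inner ℝ (G y w) z) : v = w := by
  by_contra hne
  have := h.posDef y hy (v - w) (sub_ne_zero.2 hne)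
  rw [map_sub, inner_sub_left, hvw, sub_self] at this
  exact this.false

theorem fderiv_conn_symm (h : IsLeviCivitaOn Ω G Γ) {y : E} (hy : y ∈ Ω) (a v w : E) :
    fderiv ℝ Γ y a v w = fderiv ℝ Γ y a w v := by
  have hd := (h.differentiableAt_conn hy).hasFDerivAt
  have h1 := (hd.clm_apply (hasFDerivAt_const v y)).clm_apply (hasFDerivAt_const w y)
  have h2 := (hd.clm_apply (hasFDerivAt_const w y)).clm_apply (hasFDerivAt_const v y)
  have h3 := h1.unique (h2.congr_of_eventuallyEq <| by
    filter_upwards [h.isOpen.mem_nhds hy] with z hz using h.torsionFree z hz v w)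
  simpa using congrArg (fun L => L a) h3

/-- The derivative of the compatibility identity: the second derivative of the metric. -/
theorem inner_fderiv_fderiv (h : IsLeviCivitaOn Ω G Γ) {y : E} (hy : y ∈ Ω) (a b v w : E) :
    inner ℝ (fderiv ℝ (fderiv ℝ G) y a b v) w =
      inner ℝ (fderiv ℝ G y a (Γ y b v)) w + inner ℝ (G y (fderiv ℝ Γ y a b v)) w
      + inner ℝ (fderiv ℝ G y a (Γ y b w)) v + inner ℝ (G y (fderiv ℝ Γ y a b w)) v := by
  have hG := (h.differentiableAt_metric hy).hasFDerivAt
  have hΓ := (h.differentiableAt_conn hy).hasFDerivAt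
  have hD := (h.differentiableAt_fderiv_metric hy).hasFDerivAt
  have h1 := ((hD.clm_apply (hasFDerivAt_const b y)).clm_apply (hasFDerivAt_const v y)).inner ℝ
    (hasFDerivAt_const w y)
  have h2 := (hG.clm_apply ((hΓ.clm_apply (hasFDerivAt_const b y)).clm_apply
    (hasFDerivAt_const v y))).inner ℝ (hasFDerivAt_const w y)
  have h3 := (hG.clm_apply ((hΓ.clm_apply (hasFDerivAt_const b y)).clm_apply
    (hasFDerivAt_const w y))).inner ℝ (hasFDerivAt_const v y)
  have h4 := h1.unique ((h2.add h3).congr_of_eventuallyEq <| by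
    filter_upwards [h.isOpen.mem_nhds hy] with z hz using h.compat z hz b v w)
  have h5 := congrArg (fun L => L a) h4
  simp [fderivInnerCLM_apply, inner_add_left] at h5
  linarith

theorem inner_curv_self (h : IsLeviCivitaOn Ω G Γ) {y : E} (hy : y ∈ Ω) (a b w : E) :
    inner ℝ (G y (curv Γ y a b w)) w = 0 := by
  have hs : fderiv ℝ (fderiv ℝ G) y a b = fderiv ℝ (fderiv ℝ G) y b a :=
    (h.contDiffOn_metric.contDiffAt (h.isOpen.mem_nhds hy)).isSymmSndFDerivAt
      minSmoothness_two_le a b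
  have h1 := h.inner_fderiv_fderiv hy a b w w
  have h2 := h.inner_fderiv_fderiv hy b a w w
  rw [hs, h2] at h1
  simp only [h.compat y hy] at h1
  simp only [curv, map_add, map_sub, inner_add_left, inner_sub_left]
  have h3 := h.symm y hy (Γ y a w) (Γ y b w)
  linarith

theorem inner_curv_antisymm (h : IsLeviCivitaOn Ω G Γ) {y : E} (hy : y ∈ Ω) (a b v w : E) :
    inner ℝ (G y (curv Γ y a b v)) w = -inner ℝ (G y (curv Γ y a b w)) v := by
  have h1 := h.inner_curv_self hy a b (v + w)
  have h2 := h.inner_curv_self hy a b v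
  have h3 := h.inner_curv_self hy a b w
  have h4 : curv Γ y a b (v + w) = curv Γ y a b v + curv Γ y a b w := by
    simp only [curv, map_add]; abel
  rw [h4, map_add, inner_add_left, inner_add_right, inner_add_right] at h1
  linarith

theorem curv_swap (Γ : E → E →L[ℝ] E →L[ℝ] E) (y a b w : E) :
    curv Γ y a b w = -curv Γ y b a w := by
  simp only [curv]; abel

theorem bianchi (h : IsLeviCivitaOn Ω G Γ) {y : E} (hy : y ∈ Ω) (a b w : E) :
    curv Γ y a b w + curv Γ y b w a + curv Γ y w a b = 0 := by
  simp only [curv]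
  rw [h.fderiv_conn_symm hy a b w, h.fderiv_conn_symm hy b w a, h.fderiv_conn_symm hy w a b,
    h.torsionFree y hy b w, h.torsionFree y hy a w, h.torsionFree y hy b a]
  abel

/-- The Jacobi operator `v ↦ R(v, x) x` is symmetric with respect to the metric. -/
theorem inner_curv_symm (h : IsLeviCivitaOn Ω G Γ) {y : E} (hy : y ∈ Ω) (x v w : E) :
    inner ℝ (G y (curv Γ y v x x)) w = inner ℝ (G y (curv Γ y w x x)) v := by
  have B : ∀ a b c d, inner ℝ (G y (curv Γ y a b c)) d + inner ℝ (G y (curv Γ y b c a)) d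
      + inner ℝ (G y (curv Γ y c a b)) d = 0 := fun a b c d => by
    rw [← inner_add_left, ← inner_add_left, ← map_add, ← map_add, h.bianchi hy, map_zero,
      inner_zero_left]
  have A : ∀ a b c d, inner ℝ (G y (curv Γ y a b c)) d = -inner ℝ (G y (curv Γ y a b d)) c :=
    fun a b c d => h.inner_curv_antisymm hy a b c d
  have S : ∀ a b c d, inner ℝ (G y (curv Γ y a b c)) d = -inner ℝ (G y (curv Γ y b a c)) d :=
    fun a b c d => by rw [curv_swap, map_neg, inner_neg_left]
  linarith [B v x x w, B w x x v, B v x w x, A v x x w, A w x x v, A v w x x, S v w x x,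
    A x x v w, S x x v w, S x x w v, S x v x w, S x w x v, A x v w x, A x w v x, S x v w x,
    A w v x x, S w v x x]

/-- The conservation law of the metric pairing along a curve, infinitesimally. -/
theorem hasDerivWithinAt_inner (h : IsLeviCivitaOn Ω G Γ) {x v w : ℝ → E} {x' v' w' : E}
    {s : Set ℝ} {t : ℝ} (ht : x t ∈ Ω) (hx : HasDerivWithinAt x x' s t)
    (hv : HasDerivWithinAt v v' s t) (hw : HasDerivWithinAt w w' s t) :
    HasDerivWithinAt (fun r => inner ℝ (G (x r) (v r)) (w r))
      (inner ℝ (G (x t) (v' + Γ (x t) x' (v t))) (w t)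
        + inner ℝ (G (x t) (v t)) (w' + Γ (x t) x' (w t))) s t := by
  have hG : HasDerivWithinAt (fun r => G (x r)) (fderiv ℝ G (x t) x') s t :=
    (h.differentiableAt_metric ht).hasFDerivAt.comp_hasDerivWithinAt t hx
  refine ((hG.clm_apply hv).inner ℝ hw).congr_deriv ?_
  have h1 := h.compat _ ht x' (v t) (w t)
  have h2 := h.symm _ ht (Γ (x t) x' (w t)) (v t)
  simp only [map_add, inner_add_left, inner_add_right]
  linarith

/-- The second variation of the energy density, expressed by the covariant derivative
`H' + Γ(x', H)` and the curvature, up to the derivative of `⟪G Γ(H, H), x'⟫`. -/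
theorem second_variation_density (h : IsLeviCivitaOn Ω G Γ) {y : E} (hy : y ∈ Ω) (p H H' : E) :
    (1 / 2) * inner ℝ (fderiv ℝ (fderiv ℝ G) y H H p) p
      + 2 * inner ℝ (fderiv ℝ G y H p) H' + inner ℝ (G y H') H' =
    inner ℝ (G y (H' + Γ y p H)) (H' + Γ y p H) - inner ℝ (G y (curv Γ y H p p)) H
      + (inner ℝ (G y ((fderiv ℝ Γ y p H H + (Γ y H' H + Γ y H H')) + Γ y p (Γ y H H))) p
        + inner ℝ (G y (Γ y H H)) (-Γ y p p + Γ y p p)) := by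
  rw [h.inner_curv_antisymm hy H p p H]
  have h1 := h.inner_fderiv_fderiv hy H H p p
  have c1 := h.compat y hy H (Γ y H p) p
  have c2 := h.compat y hy H p H'
  have s1 := h.symm y hy H' (Γ y p H)
  have s2 := h.symm y hy (Γ y H H') p
  have t1 := h.torsionFree y hy p H
  have t2 := h.torsionFree y hy H' H
  have t3 := h.fderiv_conn_symm hy H p H
  simp only [curv, map_add, map_sub, inner_add_left, inner_sub_left, inner_add_right, t1, t2, t3,
    neg_add_cancel, inner_zero_right] at *
  linarith

end IsLeviCivitaOn

/-- The Jacobi equation in coordinates: if `J` solves the geodesic equation linearized along the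
geodesic `x`, then the second covariant derivative of `J` is `-R(J, x') x'`. -/
theorem linearized_geodesic {Γ : E → E →L[ℝ] E →L[ℝ] E} {x p J J' : ℝ → E} {J'' : E} {s : Set ℝ}
    {t : ℝ} (hΓ : DifferentiableAt ℝ Γ (x t)) (hsymm : ∀ v w, Γ (x t) v w = Γ (x t) w v)
    (hsymm' : ∀ a v w, fderiv ℝ Γ (x t) a v w = fderiv ℝ Γ (x t) a w v)
    (hx : HasDerivWithinAt x (p t) s t) (hp : HasDerivWithinAt p (-Γ (x t) (p t) (p t)) s t)
    (hJ : HasDerivWithinAt J (J' t) s t) (hJ' : HasDerivWithinAt J' J'' s t)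
    (hlin : J'' + fderiv ℝ Γ (x t) (J t) (p t) (p t) + 2 • Γ (x t) (p t) (J' t) = 0) :
    HasDerivWithinAt (fun r => J' r + Γ (x r) (p r) (J r))
      (-curv Γ (x t) (J t) (p t) (p t) - Γ (x t) (p t) (J' t + Γ (x t) (p t) (J t))) s t := by
  have hG : HasDerivWithinAt (fun r => Γ (x r)) (fderiv ℝ Γ (x t) (p t)) s t := by
    have h0 := hΓ.hasFDerivAt
    exact HasFDerivAt.comp_hasDerivWithinAt (l := Γ) t h0 hx
  refine (hJ'.add ((hG.clm_apply hp).clm_apply hJ)).congr_deriv ?_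
  have e1 : J'' = -(fderiv ℝ Γ (x t) (J t) (p t) (p t) + 2 • Γ (x t) (p t) (J' t)) := by
    rw [eq_neg_iff_add_eq_zero, ← add_assoc]; exact hlin
  simp only [curv, add_apply, map_add, map_neg, neg_apply]
  rw [e1, hsymm' (p t) (J t) (p t), hsymm (Γ (x t) (p t) (p t)) (J t), hsymm (J t) (p t)]
  abel

/-! ### Change of coordinates -/

section Change

variable {F : Type*} [NormedAddCommGroup F] [InnerProductSpace ℝ F]
  {Ω₁ : Set E} {G₁ : E → E →L[ℝ] E} {Γ₁ : E → E →L[ℝ] E →L[ℝ] E}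
  {Ω₂ : Set F} {G₂ : F → F →L[ℝ] F} {Γ₂ : F → F →L[ℝ] F →L[ℝ] F}
  {θ : E → F} {W : Set E}

/-- The transformation law of the Christoffel form under an isometric change of coordinates `θ`.
It expresses the uniqueness of the Levi-Civita connection: the difference of the two sides,
paired with the metric, is symmetric in the first two and antisymmetric in the last two slots. -/
theorem IsLeviCivitaOn.conn_change (h₁ : IsLeviCivitaOn Ω₁ G₁ Γ₁) (h₂ : IsLeviCivitaOn Ω₂ G₂ Γ₂)
    (hW : IsOpen W) (hW₁ : W ⊆ Ω₁) (hW₂ : MapsTo θ W Ω₂) (hθ : ContDiffOn ℝ ∞ θ W)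
    (hiso : ∀ y ∈ W, ∀ v w, inner ℝ (G₁ y v) w =
      inner ℝ (G₂ (θ y) (fderiv ℝ θ y v)) (fderiv ℝ θ y w))
    (hsurj : ∀ y ∈ W, Function.Surjective (fderiv ℝ θ y)) {y : E} (hy : y ∈ W) (v w : E) :
    fderiv ℝ θ y (Γ₁ y v w) =
      Γ₂ (θ y) (fderiv ℝ θ y v) (fderiv ℝ θ y w) + fderiv ℝ (fderiv ℝ θ) y v w := by
  have hc := hθ.contDiffAt (hW.mem_nhds hy)
  have hd := (hc.differentiableAt (by simp)).hasFDerivAt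
  have hdd := ((hc.fderiv_right (m := 1) (by norm_cast)).differentiableAt (by simp)).hasFDerivAt
  have hss : ∀ a b, fderiv ℝ (fderiv ℝ θ) y a b = fderiv ℝ (fderiv ℝ θ) y b a :=
    hc.isSymmSndFDerivAt minSmoothness_two_le
  -- the derivative of the isometry relation
  have key : ∀ a v w, inner ℝ (fderiv ℝ G₁ y a v) w =
      inner ℝ (fderiv ℝ G₂ (θ y) (fderiv ℝ θ y a) (fderiv ℝ θ y v)) (fderiv ℝ θ y w)
      + inner ℝ (G₂ (θ y) (fderiv ℝ (fderiv ℝ θ) y a v)) (fderiv ℝ θ y w)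
      + inner ℝ (G₂ (θ y) (fderiv ℝ θ y v)) (fderiv ℝ (fderiv ℝ θ) y a w) := by
    intro a v w
    have e1 := ((h₁.differentiableAt_metric (hW₁ hy)).hasFDerivAt.clm_apply
      (hasFDerivAt_const v y)).inner ℝ (hasFDerivAt_const w y)
    have e2 := ((((h₂.differentiableAt_metric (hW₂ hy)).hasFDerivAt.comp y hd).clm_apply
      (hdd.clm_apply (hasFDerivAt_const v y)))).inner ℝ (hdd.clm_apply (hasFDerivAt_const w y))
    have e3 := e1.unique (e2.congr_of_eventuallyEq <| by
      filter_upwards [hW.mem_nhds hy] with z hz using hiso z hz v w)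
    have e4 := congrArg (fun L => L a) e3
    simp [fderivInnerCLM_apply, inner_add_left] at e4
    linarith
  set D : E → E → F := fun v w => fderiv ℝ θ y (Γ₁ y v w) -
    (Γ₂ (θ y) (fderiv ℝ θ y v) (fderiv ℝ θ y w) + fderiv ℝ (fderiv ℝ θ) y v w) with hD
  have Dsymm : ∀ v w, D v w = D w v := fun v w => by
    simp only [hD]
    rw [h₁.torsionFree y (hW₁ hy) v w, h₂.torsionFree _ (hW₂ hy) (fderiv ℝ θ y v), hss v w]
  set q : E → E → E → ℝ := fun a v w => inner ℝ (G₂ (θ y) (D a v)) (fderiv ℝ θ y w) with hq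
  have qanti : ∀ a v w, q a v w = -q a w v := by
    intro a v w
    have k := key a v w
    rw [h₁.compat y (hW₁ hy), h₂.compat _ (hW₂ hy), hiso y hy, hiso y hy,
      h₂.symm _ (hW₂ hy) (fderiv ℝ θ y v) (fderiv ℝ (fderiv ℝ θ) y a w)] at k
    simp only [hq, hD, map_sub, map_add, inner_sub_left, inner_add_left]
    linarith
  have qsymm : ∀ a v w, q a v w = q v a w := fun a v w => by simp only [hq]; rw [Dsymm]
  have q0 : ∀ a v w, q a v w = 0 := fun a v w => by
    linarith [qsymm a v w, qanti v a w, qsymm v w a, qanti w v a, qsymm w a v, qanti a w v]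
  refine sub_eq_zero.1 (h₂.eq_of_inner (hW₂ hy) (v := D v w) (w := 0) fun z => ?_)
  obtain ⟨z, rfl⟩ := hsurj y hy z
  rw [map_zero, inner_zero_left]
  exact q0 v w z

/-- The curvature is a tensor. -/
theorem IsLeviCivitaOn.curv_change (h₁ : IsLeviCivitaOn Ω₁ G₁ Γ₁) (h₂ : IsLeviCivitaOn Ω₂ G₂ Γ₂)
    (hW : IsOpen W) (hW₁ : W ⊆ Ω₁) (hW₂ : MapsTo θ W Ω₂) (hθ : ContDiffOn ℝ ∞ θ W)
    (hiso : ∀ y ∈ W, ∀ v w, inner ℝ (G₁ y v) w =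
      inner ℝ (G₂ (θ y) (fderiv ℝ θ y v)) (fderiv ℝ θ y w))
    (hsurj : ∀ y ∈ W, Function.Surjective (fderiv ℝ θ y)) {y : E} (hy : y ∈ W) (a b w : E) :
    fderiv ℝ θ y (curv Γ₁ y a b w) =
      curv Γ₂ (θ y) (fderiv ℝ θ y a) (fderiv ℝ θ y b) (fderiv ℝ θ y w) := by
  have hc := hθ.contDiffAt (hW.mem_nhds hy)
  have hd := (hc.differentiableAt (by simp)).hasFDerivAt
  have hc1 : ContDiffAt ℝ ∞ (fderiv ℝ θ) y := hc.fderiv_right (by norm_cast)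
  have hc2 : ContDiffAt ℝ ∞ (fderiv ℝ (fderiv ℝ θ)) y := hc1.fderiv_right (by norm_cast)
  have hdd := (hc1.differentiableAt (by simp)).hasFDerivAt
  have hddd := (hc2.differentiableAt (by simp)).hasFDerivAt
  have hss : ∀ a b, fderiv ℝ (fderiv ℝ θ) y a b = fderiv ℝ (fderiv ℝ θ) y b a :=
    hc.isSymmSndFDerivAt minSmoothness_two_le
  have hsss : fderiv ℝ (fderiv ℝ (fderiv ℝ θ)) y a b = fderiv ℝ (fderiv ℝ (fderiv ℝ θ)) y b a :=
    hc1.isSymmSndFDerivAt minSmoothness_two_le a b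
  have law : ∀ z ∈ W, ∀ v w, fderiv ℝ θ z (Γ₁ z v w) =
      Γ₂ (θ z) (fderiv ℝ θ z v) (fderiv ℝ θ z w) + fderiv ℝ (fderiv ℝ θ) z v w :=
    fun z hz v w => h₁.conn_change h₂ hW hW₁ hW₂ hθ hiso hsurj hz v w
  have key : ∀ a b w, fderiv ℝ (fderiv ℝ θ) y a (Γ₁ y b w)
      + fderiv ℝ θ y (fderiv ℝ Γ₁ y a b w) =
      fderiv ℝ Γ₂ (θ y) (fderiv ℝ θ y a) (fderiv ℝ θ y b) (fderiv ℝ θ y w)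
      + Γ₂ (θ y) (fderiv ℝ (fderiv ℝ θ) y a b) (fderiv ℝ θ y w)
      + Γ₂ (θ y) (fderiv ℝ θ y b) (fderiv ℝ (fderiv ℝ θ) y a w)
      + fderiv ℝ (fderiv ℝ (fderiv ℝ θ)) y a b w := by
    intro a b w
    have e1 := hdd.clm_apply (((h₁.differentiableAt_conn (hW₁ hy)).hasFDerivAt.clm_apply
      (hasFDerivAt_const b y)).clm_apply (hasFDerivAt_const w y))
    have e0 : HasFDerivAt (fun z => Γ₂ (θ z)) ((fderiv ℝ Γ₂ (θ y)).comp (fderiv ℝ θ y)) y :=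
      HasFDerivAt.comp (g := Γ₂) y (h₂.differentiableAt_conn (hW₂ hy)).hasFDerivAt hd
    have e2 := ((e0.clm_apply
      (hdd.clm_apply (hasFDerivAt_const b y)))).clm_apply (hdd.clm_apply (hasFDerivAt_const w y))
    have e2' := (hddd.clm_apply (hasFDerivAt_const b y)).clm_apply (hasFDerivAt_const w y)
    have e3 := e1.unique ((e2.add e2').congr_of_eventuallyEq <| by
      filter_upwards [hW.mem_nhds hy] with z hz using law z hz b w)
    have e4 := congrArg (fun L => L a) e3
    simp at e4
    rw [add_comm, e4]
    abel
  have k1 := key a b w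
  have k2 := key b a w
  rw [← eq_sub_iff_add_eq'] at k1 k2
  simp only [curv, map_add, map_sub, law y hy, k1, k2, hsss, hss b a]
  abel

end Change

end Coordinates

/-! ### The metric and its connection in a chart -/

section Charts

set_option synthInstance.maxHeartbeats 200000
set_option linter.unusedSectionVars false

variable {n : ℕ} {M : Type*} [MetricSpace M] [ChartedSpace (Vec n) M] [IsManifold (𝓡 n) ∞ M]
  [RiemannianBundle (fun x : M => TangentSpace (𝓡 n) x)]

/-- The operator of the metric in the chart `e`, with matrix `(g_{ij})`. -/
def metricOp (e : OpenPartialHomeomorph M (Vec n)) (y : Vec n) : Vec n →L[ℝ] Vec n :=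
  Matrix.toEuclideanCLM (𝕜 := ℝ) (metricCoeff e y)

theorem metricOp_apply (e : OpenPartialHomeomorph M (Vec n)) (y v : Vec n) (i : Fin n) :
    metricOp e y v i = ∑ j, metricCoeff e y i j * v j := by
  simp [metricOp, Matrix.mulVec, dotProduct]

theorem vec_eq_sum (v : Vec n) : v = ∑ i, v i • EuclideanSpace.single i (1 : ℝ) := by
  ext j
  simp [Finset.sum_apply, Pi.single_apply]

theorem metricCoeff_symm (e : OpenPartialHomeomorph M (Vec n)) (y : Vec n) (i j : Fin n) :
    metricCoeff e y i j = metricCoeff e y j i := by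
  simp only [metricCoeff, Matrix.of_apply]
  exact real_inner_comm _ _

theorem inner_metricOp (e : OpenPartialHomeomorph M (Vec n)) (y v w : Vec n) :
    inner ℝ (metricOp e y v) w =
      inner ℝ (mfderiv (𝓡 n) (𝓡 n) e.symm y v : TangentSpace (𝓡 n) (e.symm y))
        (mfderiv (𝓡 n) (𝓡 n) e.symm y w) := by
  have h : ∀ v : Vec n, (mfderiv (𝓡 n) (𝓡 n) e.symm y v : TangentSpace (𝓡 n) (e.symm y)) =
      ∑ i, v i • (mfderiv (𝓡 n) (𝓡 n) e.symm y (EuclideanSpace.single i (1 : ℝ)) :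
        TangentSpace (𝓡 n) (e.symm y)) := fun v => by
    conv_lhs => rw [vec_eq_sum v]
    erw [map_sum]
    exact Finset.sum_congr rfl fun i _ => by erw [map_smul]
  rw [h v, h w, sum_inner, PiLp.inner_apply]
  refine (Finset.sum_congr rfl fun i _ => ?_ : _ = ∑ i, ∑ j, metricCoeff e y i j * v j * w i).trans
    (Finset.sum_comm.trans (Finset.sum_congr rfl fun j _ => ?_))
  · rw [metricOp_apply]
    simp [Finset.mul_sum, mul_comm]
  · rw [inner_smul_left, inner_sum, Finset.mul_sum]
    refine Finset.sum_congr rfl fun i _ => ?_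
    rw [inner_smul_right, metricCoeff_symm]
    simp only [metricCoeff, Matrix.of_apply, conj_trivial]
    ring

section Smooth

variable {e : OpenPartialHomeomorph M (Vec n)}

theorem mdifferentiableAt_symm (he : e ∈ IsManifold.maximalAtlas (𝓡 n) ∞ M) {y : Vec n}
    (hy : y ∈ e.target) : MDifferentiableAt (𝓡 n) (𝓡 n) e.symm y :=
  (contMDiffAt_symm_of_mem_maximalAtlas he hy).mdifferentiableAt (by simp)

theorem mdifferentiableAt_chart (he : e ∈ IsManifold.maximalAtlas (𝓡 n) ∞ M) {x : M}
    (hx : x ∈ e.source) : MDifferentiableAt (𝓡 n) (𝓡 n) e x :=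
  (contMDiffAt_of_mem_maximalAtlas he hx).mdifferentiableAt (by simp)

theorem chartDiff_mfderiv_symm (he : e ∈ IsManifold.maximalAtlas (𝓡 n) ∞ M) {y : Vec n}
    (hy : y ∈ e.target) (v : Vec n) :
    chartDiff e (e.symm y) (mfderiv (𝓡 n) (𝓡 n) e.symm y v) = v := by
  have h1 : mfderiv (𝓡 n) (𝓡 n) (e ∘ e.symm) y = ContinuousLinearMap.id ℝ _ := by
    rw [← mfderiv_id]
    refine Filter.EventuallyEq.mfderiv_eq ?_
    filter_upwards [e.open_target.mem_nhds hy] with z hz using e.right_inv hz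
  rw [mfderiv_comp y (mdifferentiableAt_chart he (e.map_target hy))
    (mdifferentiableAt_symm he hy)] at h1
  exact congrArg (fun L => L v) h1

theorem mfderiv_symm_chartDiff (he : e ∈ IsManifold.maximalAtlas (𝓡 n) ∞ M) {x : M}
    (hx : x ∈ e.source) (v : TangentSpace (𝓡 n) x) :
    (mfderiv (𝓡 n) (𝓡 n) e.symm (e x) (chartDiff e x v) : Vec n) = v := by
  have h1 : mfderiv (𝓡 n) (𝓡 n) (e.symm ∘ e) x = ContinuousLinearMap.id ℝ _ := by
    rw [← mfderiv_id]
    refine Filter.EventuallyEq.mfderiv_eq ?_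
    filter_upwards [e.open_source.mem_nhds hx] with z hz using e.left_inv hz
  rw [mfderiv_comp x (mdifferentiableAt_symm he (e.map_source hx))
    (mdifferentiableAt_chart he hx)] at h1
  exact congrArg (fun L => L v) h1

theorem inner_metricOp_chartDiff (he : e ∈ IsManifold.maximalAtlas (𝓡 n) ∞ M) {x : M}
    (hx : x ∈ e.source) (v w : TangentSpace (𝓡 n) x) :
    inner ℝ (metricOp e (e x) (chartDiff e x v)) (chartDiff e x w) = inner ℝ v w := by
  rw [inner_metricOp]
  have key : ∀ (x' : M) (hx' : x' = x) (a b : TangentSpace (𝓡 n) x'),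
      (a : Vec n) = v → (b : Vec n) = w → inner ℝ a b = inner ℝ v w := by
    rintro _ rfl a b rfl rfl; rfl
  exact key _ (e.left_inv hx) _ _ (mfderiv_symm_chartDiff he hx v) (mfderiv_symm_chartDiff he hx w)

theorem contDiffOn_inner_mfderiv_symm
    [IsContMDiffRiemannianBundle (𝓡 n) ∞ (Vec n) (fun x : M => TangentSpace (𝓡 n) x)]
    (he : e ∈ IsManifold.maximalAtlas (𝓡 n) ∞ M) (v w : Vec n) :
    ContDiffOn ℝ ∞ (fun y => inner ℝ
      (mfderiv (𝓡 n) (𝓡 n) e.symm y v : TangentSpace (𝓡 n) (e.symm y))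
        (mfderiv (𝓡 n) (𝓡 n) e.symm y w)) e.target := by
  have h0 : ContMDiffOn (𝓡 n) (𝓡 n) ∞ e.symm e.target := contMDiffOn_symm_of_mem_maximalAtlas he
  have h1 := h0.contMDiffOn_tangentMapWithin (m := ∞) (by simp) e.open_target.uniqueMDiffOn
  have h2 : ∀ v : Vec n, ContMDiffOn (𝓡 n) (𝓡 n).tangent ∞
      (fun y => (⟨e.symm y, mfderiv (𝓡 n) (𝓡 n) e.symm y v⟩ : TangentBundle (𝓡 n) M))
      e.target := by
    intro v
    have h3 : ContMDiffOn (𝓡 n) (𝓡 n).tangent ∞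
        (fun y => (⟨y, v⟩ : TangentBundle (𝓡 n) (Vec n))) e.target := by
      intro y hy
      refine ContMDiffAt.contMDiffWithinAt ?_
      rw [contMDiffAt_totalSpace]
      refine ⟨contMDiffAt_id, ?_⟩
      simp
      exact contMDiffAt_const
    refine (h1.comp h3 (fun y hy => hy)).congr fun y hy => ?_
    simp only [tangentMapWithin, Function.comp]
    rw [mfderivWithin_of_isOpen e.open_target hy]
  have h4 := ContMDiffOn.inner_bundle (IB := 𝓡 n) (F := Vec n) (n := ∞)
    (E := fun x : M => TangentSpace (𝓡 n) x) (b := e.symm) (h2 v) (h2 w)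
  exact contMDiffOn_iff_contDiffOn.1 h4

theorem contDiffOn_metricCoeff
    [IsContMDiffRiemannianBundle (𝓡 n) ∞ (Vec n) (fun x : M => TangentSpace (𝓡 n) x)]
    (he : e ∈ IsManifold.maximalAtlas (𝓡 n) ∞ M) (i j : Fin n) :
    ContDiffOn ℝ ∞ (fun y => metricCoeff e y i j) e.target :=
  contDiffOn_inner_mfderiv_symm he _ _

theorem metricOp_posDef (he : e ∈ IsManifold.maximalAtlas (𝓡 n) ∞ M) {y : Vec n}
    (hy : y ∈ e.target) {v : Vec n} (hv : v ≠ 0) : 0 < inner ℝ (metricOp e y v) v := by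
  rw [inner_metricOp]
  refine real_inner_self_pos.2 fun h => hv ?_
  rw [← chartDiff_mfderiv_symm he hy v, h]
  exact map_zero (mfderiv (𝓡 n) (𝓡 n) e (e.symm y))

theorem metricOp_symm (e : OpenPartialHomeomorph M (Vec n)) (y v w : Vec n) :
    inner ℝ (metricOp e y v) w = inner ℝ (metricOp e y w) v := by
  rw [inner_metricOp, inner_metricOp, real_inner_comm]

theorem isUnit_det_metricCoeff (he : e ∈ IsManifold.maximalAtlas (𝓡 n) ∞ M) {y : Vec n}
    (hy : y ∈ e.target) : IsUnit (metricCoeff e y).det := by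
  rw [isUnit_iff_ne_zero]
  intro h
  obtain ⟨v, hv, h0⟩ := Matrix.exists_mulVec_eq_zero_iff.2 h
  have h1 := metricOp_posDef he hy (v := WithLp.toLp 2 v) (by simpa using hv)
  rw [metricOp, Matrix.toEuclideanCLM_toLp, h0] at h1
  simp at h1

theorem contDiffOn_det {ι E : Type*} [Fintype ι] [DecidableEq ι] [NormedAddCommGroup E]
    [NormedSpace ℝ E] {s : Set E} {A : E → Matrix ι ι ℝ}
    (hA : ∀ i j, ContDiffOn ℝ ∞ (fun y => A y i j) s) :
    ContDiffOn ℝ ∞ (fun y => (A y).det) s := by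
  simp only [Matrix.det_apply]
  exact ContDiffOn.sum fun σ _ => (contDiffOn_prod fun i _ => hA _ _).const_smul _

theorem contDiffOn_metricCoeff_inv
    [IsContMDiffRiemannianBundle (𝓡 n) ∞ (Vec n) (fun x : M => TangentSpace (𝓡 n) x)]
    (he : e ∈ IsManifold.maximalAtlas (𝓡 n) ∞ M) (i j : Fin n) :
    ContDiffOn ℝ ∞ (fun y => (metricCoeff e y)⁻¹ i j) e.target := by
  have h1 := contDiffOn_det (contDiffOn_metricCoeff he)
  have h2 : ContDiffOn ℝ ∞ (fun y => (metricCoeff e y).adjugate i j) e.target := by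
    simp only [Matrix.adjugate_apply]
    refine contDiffOn_det fun k l => ?_
    by_cases hk : k = j
    · subst hk; simpa using contDiffOn_const
    · simpa [Matrix.updateRow_ne hk] using contDiffOn_metricCoeff he k l
  refine ((h1.inv fun y hy => (isUnit_det_metricCoeff he hy).ne_zero).mul h2).congr fun y hy => ?_
  simp [Matrix.inv_def, Ring.inverse_eq_inv']

theorem contDiffOn_dMetricCoeff
    [IsContMDiffRiemannianBundle (𝓡 n) ∞ (Vec n) (fun x : M => TangentSpace (𝓡 n) x)]
    (he : e ∈ IsManifold.maximalAtlas (𝓡 n) ∞ M) (k i j : Fin n) :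
    ContDiffOn ℝ ∞ (dMetricCoeff e k i j) e.target :=
  ((contDiffOn_metricCoeff he i j).fderiv_of_isOpen e.open_target (by simp)).clm_apply
    contDiffOn_const

theorem dMetricCoeff_symm (e : OpenPartialHomeomorph M (Vec n)) (k i j : Fin n) (y : Vec n) :
    dMetricCoeff e k i j y = dMetricCoeff e k j i y := by
  simp only [dMetricCoeff, metricCoeff_symm e _ i j]

theorem contDiffOn_christoffel
    [IsContMDiffRiemannianBundle (𝓡 n) ∞ (Vec n) (fun x : M => TangentSpace (𝓡 n) x)]
    (he : e ∈ IsManifold.maximalAtlas (𝓡 n) ∞ M) (k i j : Fin n) :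
    ContDiffOn ℝ ∞ (fun y => christoffel e y k i j) e.target :=
  contDiffOn_const.mul (ContDiffOn.sum fun l _ => (contDiffOn_metricCoeff_inv he k l).mul
    (((contDiffOn_dMetricCoeff he i j l).add (contDiffOn_dMetricCoeff he j i l)).sub
      (contDiffOn_dMetricCoeff he l i j)))

/-- The form `christoffelForm e y` as a bilinear map. -/
def christoffelCLM (e : OpenPartialHomeomorph M (Vec n)) (y : Vec n) :
    Vec n →L[ℝ] Vec n →L[ℝ] Vec n :=
  ∑ i, ∑ j, (EuclideanSpace.proj i : Vec n →L[ℝ] ℝ).smulRight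
    ((EuclideanSpace.proj j : Vec n →L[ℝ] ℝ).smulRight
      (WithLp.toLp 2 fun k => christoffel e y k i j))

theorem christoffelCLM_apply (e : OpenPartialHomeomorph M (Vec n)) (y v w : Vec n) :
    christoffelCLM e y v w = christoffelForm e y v w := by
  ext k
  simp only [christoffelCLM, christoffelForm, sum_apply, ContinuousLinearMap.smulRight_apply,
    smul_apply, WithLp.ofLp_sum, Finset.sum_apply, WithLp.ofLp_smul,
    Pi.smul_apply, smul_eq_mul, PiLp.proj_apply]
  exact Finset.sum_congr rfl fun i _ => Finset.sum_congr rfl fun j _ => by ring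

theorem inner_metricOp_christoffel (he : e ∈ IsManifold.maximalAtlas (𝓡 n) ∞ M) {y : Vec n}
    (hy : y ∈ e.target) (v w z : Vec n) :
    inner ℝ (metricOp e y (christoffelCLM e y v w)) z =
      ∑ i, ∑ j, ∑ m, (1 / 2) * (dMetricCoeff e i j m y + dMetricCoeff e j i m y
        - dMetricCoeff e m i j y) * v i * w j * z m := by
  have h1 : ∀ i j m, ∑ k, metricCoeff e y m k * christoffel e y k i j =
      (1 / 2) * (dMetricCoeff e i j m y + dMetricCoeff e j i m y - dMetricCoeff e m i j y) := by
    intro i j m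
    have h2 : metricCoeff e y * (metricCoeff e y)⁻¹ = 1 :=
      Matrix.mul_nonsing_inv _ (isUnit_det_metricCoeff he hy)
    have h3 := congrFun (congrArg (fun A => Matrix.mulVec A fun l =>
      dMetricCoeff e i j l y + dMetricCoeff e j i l y - dMetricCoeff e l i j y) h2) m
    rw [← Matrix.mulVec_mulVec, Matrix.one_mulVec] at h3
    rw [← h3]
    simp only [christoffel, Matrix.mulVec, dotProduct, Finset.mul_sum]
    exact Finset.sum_congr rfl fun k _ => Finset.sum_congr rfl fun l _ => by ring
  have h4 : ∀ m, metricOp e y (christoffelCLM e y v w) m = ∑ i, ∑ j,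
      (1 / 2) * (dMetricCoeff e i j m y + dMetricCoeff e j i m y - dMetricCoeff e m i j y)
        * v i * w j := by
    intro m
    simp only [metricOp_apply, christoffelCLM_apply, christoffelForm, Finset.mul_sum]
    rw [Finset.sum_comm]
    refine Finset.sum_congr rfl fun i _ => ?_
    rw [Finset.sum_comm]
    refine Finset.sum_congr rfl fun j _ => ?_
    rw [← h1, Finset.sum_mul, Finset.sum_mul]
    exact Finset.sum_congr rfl fun k _ => by ring
  rw [PiLp.inner_apply]
  simp only [h4, RCLike.inner_apply, conj_trivial, Finset.mul_sum]
  rw [Finset.sum_comm]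
  refine Finset.sum_congr rfl fun i _ => ?_
  rw [Finset.sum_comm]
  exact Finset.sum_congr rfl fun j _ => Finset.sum_congr rfl fun m _ => by ring

theorem contDiffOn_metricOp
    [IsContMDiffRiemannianBundle (𝓡 n) ∞ (Vec n) (fun x : M => TangentSpace (𝓡 n) x)]
    (he : e ∈ IsManifold.maximalAtlas (𝓡 n) ∞ M) : ContDiffOn ℝ ∞ (metricOp e) e.target := by
  refine contDiffOn_clm_apply.2 fun v => contDiffOn_euclidean.2 fun i => ?_
  simp only [metricOp_apply]
  exact ContDiffOn.sum fun j _ => (contDiffOn_metricCoeff he i j).mul contDiffOn_const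

theorem contDiffOn_christoffelCLM
    [IsContMDiffRiemannianBundle (𝓡 n) ∞ (Vec n) (fun x : M => TangentSpace (𝓡 n) x)]
    (he : e ∈ IsManifold.maximalAtlas (𝓡 n) ∞ M) :
    ContDiffOn ℝ ∞ (christoffelCLM e) e.target := by
  refine contDiffOn_clm_apply.2 fun v => contDiffOn_clm_apply.2 fun w =>
    contDiffOn_euclidean.2 fun k => ?_
  simp only [christoffelCLM_apply, christoffelForm]
  exact ContDiffOn.sum fun i _ => ContDiffOn.sum fun j _ =>
    ((contDiffOn_christoffel he k i j).mul contDiffOn_const).mul contDiffOn_const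

theorem inner_fderiv_metricOp
    [IsContMDiffRiemannianBundle (𝓡 n) ∞ (Vec n) (fun x : M => TangentSpace (𝓡 n) x)]
    (he : e ∈ IsManifold.maximalAtlas (𝓡 n) ∞ M) {y : Vec n} (hy : y ∈ e.target)
    (a v w : Vec n) :
    inner ℝ (fderiv ℝ (metricOp e) y a v) w =
      ∑ i, ∑ j, ∑ m, dMetricCoeff e i j m y * a i * v j * w m := by
  have hd : ∀ i j, HasFDerivAt (fun z => metricCoeff e z i j)
      (fderiv ℝ (fun z => metricCoeff e z i j) y) y := fun i j =>
    (((contDiffOn_metricCoeff he i j).contDiffAt (e.open_target.mem_nhds hy)).differentiableAt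
      (by simp)).hasFDerivAt
  have hG := (((contDiffOn_metricOp he).contDiffAt (e.open_target.mem_nhds hy)).differentiableAt
    (by simp)).hasFDerivAt
  have hda : ∀ i j, fderiv ℝ (fun z => metricCoeff e z i j) y a =
      ∑ k, dMetricCoeff e k i j y * a k := by
    intro i j
    conv_lhs => rw [vec_eq_sum a]
    simp only [map_sum, map_smul, dMetricCoeff, smul_eq_mul, mul_comm]
  have h1 := (hG.clm_apply (hasFDerivAt_const v y)).inner ℝ (hasFDerivAt_const w y)
  have h2 : HasFDerivAt (fun z => inner ℝ (metricOp e z v) w) (∑ m, ∑ j, (w m * v j) •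
      fderiv ℝ (fun z => metricCoeff e z m j) y) y := by
    have h3 : HasFDerivAt (fun z => ∑ m, ∑ j, (w m * v j) * metricCoeff e z m j) (∑ m, ∑ j,
        (w m * v j) • fderiv ℝ (fun z => metricCoeff e z m j) y) y :=
      HasFDerivAt.fun_sum fun m _ => HasFDerivAt.fun_sum fun j _ => (hd m j).const_mul _
    refine h3.congr_of_eventuallyEq (Filter.Eventually.of_forall fun z => ?_)
    simp only [PiLp.inner_apply, metricOp_apply, RCLike.inner_apply, conj_trivial, Finset.mul_sum]
    exact Finset.sum_congr rfl fun m _ => Finset.sum_congr rfl fun j _ => by ring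
  have h4 := congrArg (fun L => L a) (h1.unique h2)
  simp [fderivInnerCLM_apply, hda, Finset.mul_sum] at h4
  rw [h4]
  rw [Finset.sum_comm' (t' := Finset.univ) (s' := fun _ => Finset.univ) (by simp)]
  conv_rhs => rw [Finset.sum_comm]
  refine Finset.sum_congr rfl fun j _ => ?_
  conv_rhs => rw [Finset.sum_comm]
  refine Finset.sum_congr rfl fun m _ => Finset.sum_congr rfl fun i _ => ?_
  rw [dMetricCoeff_symm]
  ring

theorem isLeviCivitaOn_chart
    [IsContMDiffRiemannianBundle (𝓡 n) ∞ (Vec n) (fun x : M => TangentSpace (𝓡 n) x)]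
    (he : e ∈ IsManifold.maximalAtlas (𝓡 n) ∞ M) :
    IsLeviCivitaOn e.target (metricOp e) (christoffelCLM e) where
  isOpen := e.open_target
  contDiffOn_metric := contDiffOn_metricOp he
  contDiffOn_conn := contDiffOn_christoffelCLM he
  symm y _ v w := metricOp_symm e y v w
  posDef y hy v hv := metricOp_posDef he hy hv
  torsionFree y _ v w := by
    simp only [christoffelCLM_apply, christoffelForm]
    congr 1
    ext k
    rw [Finset.sum_comm]
    refine Finset.sum_congr rfl fun i _ => Finset.sum_congr rfl fun j _ => ?_
    have : christoffel e y k j i = christoffel e y k i j := by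
      simp only [christoffel]
      congr 1
      refine Finset.sum_congr rfl fun l _ => ?_
      rw [dMetricCoeff_symm e l j i]
      ring
    rw [this]; ring
  compat y hy a v w := by
    rw [inner_fderiv_metricOp he hy, inner_metricOp_christoffel he hy,
      inner_metricOp_christoffel he hy, ← Finset.sum_add_distrib]
    refine Finset.sum_congr rfl fun i _ => ?_
    conv_rhs => rw [add_comm, Finset.sum_comm]
    rw [← Finset.sum_add_distrib]
    refine Finset.sum_congr rfl fun j _ => ?_
    rw [← Finset.sum_add_distrib]
    refine Finset.sum_congr rfl fun m _ => ?_
    rw [dMetricCoeff_symm e i m j]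
    ring

/-- The curvature of the chart in the sense of `chartCurvature` is the curvature of the
Christoffel form. -/
theorem chartCurvature_eq
    [IsContMDiffRiemannianBundle (𝓡 n) ∞ (Vec n) (fun x : M => TangentSpace (𝓡 n) x)]
    (he : e ∈ IsManifold.maximalAtlas (𝓡 n) ∞ M) {y : Vec n} (hy : y ∈ e.target)
    (a b w : Vec n) : chartCurvature e y a b w = curv (christoffelCLM e) y a b w := by
  have hΓ := ((isLeviCivitaOn_chart he).differentiableAt_conn hy).hasFDerivAt
  have h : ∀ b w a : Vec n, fderiv ℝ (fun z => christoffelForm e z b w) y a =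
      fderiv ℝ (christoffelCLM e) y a b w := by
    intro b w a
    have h1 := (hΓ.clm_apply (hasFDerivAt_const b y)).clm_apply (hasFDerivAt_const w y)
    simp only [christoffelCLM_apply] at h1
    rw [h1.fderiv]
    simp
  simp only [chartCurvature, curv, h, christoffelCLM_apply]

/-- The differential of a chart as a linear equivalence. -/
theorem isInvertible_mfderiv_chart (he : e ∈ IsManifold.maximalAtlas (𝓡 n) ∞ M) {x : M}
    (hx : x ∈ e.source) : (mfderiv (𝓡 n) (𝓡 n) e x).IsInvertible := by
  have h : e.MDifferentiable (𝓡 n) (𝓡 n) :=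
    ⟨fun y hy => (mdifferentiableAt_chart he hy).mdifferentiableWithinAt,
      fun y hy => (mdifferentiableAt_symm he hy).mdifferentiableWithinAt⟩
  exact ⟨h.mfderiv hx, rfl⟩

end Smooth

section Transition

variable {e e' : OpenPartialHomeomorph M (Vec n)}

theorem contDiffOn_transition (he : e ∈ IsManifold.maximalAtlas (𝓡 n) ∞ M)
    (he' : e' ∈ IsManifold.maximalAtlas (𝓡 n) ∞ M) :
    ContDiffOn ℝ ∞ (e' ∘ e.symm) (e.symm.trans e').source := by
  rw [← contMDiffOn_iff_contDiffOn]
  refine (contMDiffOn_of_mem_maximalAtlas he').comp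
    ((contMDiffOn_symm_of_mem_maximalAtlas he).mono fun y hy => ?_) fun y hy => ?_
  · rw [OpenPartialHomeomorph.trans_source] at hy; exact hy.1
  · rw [OpenPartialHomeomorph.trans_source] at hy; exact hy.2

theorem fderiv_transition (he : e ∈ IsManifold.maximalAtlas (𝓡 n) ∞ M)
    (he' : e' ∈ IsManifold.maximalAtlas (𝓡 n) ∞ M) {y : Vec n}
    (hy : y ∈ (e.symm.trans e').source) (v : Vec n) :
    fderiv ℝ (e' ∘ e.symm) y v =
      chartDiff e' (e.symm y) (mfderiv (𝓡 n) (𝓡 n) e.symm y v) := by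
  rw [OpenPartialHomeomorph.trans_source] at hy
  rw [← mfderiv_eq_fderiv]
  erw [mfderiv_comp y (mdifferentiableAt_chart he' hy.2) (mdifferentiableAt_symm he hy.1)]
  rfl

theorem fderiv_transition_chartDiff (he : e ∈ IsManifold.maximalAtlas (𝓡 n) ∞ M)
    (he' : e' ∈ IsManifold.maximalAtlas (𝓡 n) ∞ M) {x : M} (hx : x ∈ e.source)
    (hx' : x ∈ e'.source) (v : TangentSpace (𝓡 n) x) :
    fderiv ℝ (e' ∘ e.symm) (e x) (chartDiff e x v) = chartDiff e' x v := by
  have hy : e x ∈ (e.symm.trans e').source := by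
    rw [OpenPartialHomeomorph.trans_source]
    exact ⟨e.map_source hx, by simpa [e.left_inv hx] using hx'⟩
  rw [fderiv_transition he he' hy]
  have key : ∀ (x' : M) (_ : x' = x) (a : TangentSpace (𝓡 n) x'), (a : Vec n) = v →
      chartDiff e' x' a = chartDiff e' x v := by
    rintro _ rfl a rfl; rfl
  exact key _ (e.left_inv hx) _ (mfderiv_symm_chartDiff he hx v)

theorem fderiv_transition_surjective (he : e ∈ IsManifold.maximalAtlas (𝓡 n) ∞ M)
    (he' : e' ∈ IsManifold.maximalAtlas (𝓡 n) ∞ M) {y : Vec n}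
    (hy : y ∈ (e.symm.trans e').source) :
    Function.Surjective (fderiv ℝ (e' ∘ e.symm) y) := by
  intro w
  rw [OpenPartialHomeomorph.trans_source] at hy
  have hx := e.map_target hy.1
  have h1 := fderiv_transition_chartDiff he he' hx hy.2
    (mfderiv (𝓡 n) (𝓡 n) e'.symm (e' (e.symm y)) w)
  rw [e.right_inv hy.1] at h1
  refine ⟨_, h1.trans ?_⟩
  have h2 := chartDiff_mfderiv_symm he' (e'.map_source hy.2) w
  have key : ∀ (x x' : M) (_ : x' = x) (a : TangentSpace (𝓡 n) x') (b : TangentSpace (𝓡 n) x),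
      (a : Vec n) = b → chartDiff e' x' a = chartDiff e' x b := by
    rintro _ _ rfl a _ rfl; rfl
  exact (key _ _ (e'.left_inv hy.2) _ _ rfl).symm.trans h2

theorem curv_transition
    [IsContMDiffRiemannianBundle (𝓡 n) ∞ (Vec n) (fun x : M => TangentSpace (𝓡 n) x)]
    (he : e ∈ IsManifold.maximalAtlas (𝓡 n) ∞ M)
    (he' : e' ∈ IsManifold.maximalAtlas (𝓡 n) ∞ M) {x : M} (hx : x ∈ e.source)
    (hx' : x ∈ e'.source) (a b w : TangentSpace (𝓡 n) x) :
    fderiv ℝ (e' ∘ e.symm) (e x) (curv (christoffelCLM e) (e x) (chartDiff e x a)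
      (chartDiff e x b) (chartDiff e x w)) =
    curv (christoffelCLM e') (e' x) (chartDiff e' x a) (chartDiff e' x b) (chartDiff e' x w) := by
  have hy : e x ∈ (e.symm.trans e').source := by
    rw [OpenPartialHomeomorph.trans_source]
    exact ⟨e.map_source hx, by simpa [e.left_inv hx] using hx'⟩
  have hsrc : ∀ y ∈ (e.symm.trans e').source, y ∈ e.target ∧ e.symm y ∈ e'.source := by
    intro y hy
    rw [OpenPartialHomeomorph.trans_source] at hy
    exact hy
  rw [(isLeviCivitaOn_chart he).curv_change (θ := e' ∘ e.symm) (isLeviCivitaOn_chart he')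
    (W := (e.symm.trans e').source)
    (e.symm.trans e').open_source (fun y hy => (hsrc y hy).1)
    (fun y hy => e'.map_source (hsrc y hy).2) (contDiffOn_transition he he') ?_
    (fun y hy => fderiv_transition_surjective he he' hy) hy]
  · rw [fderiv_transition_chartDiff he he' hx hx', fderiv_transition_chartDiff he he' hx hx',
      fderiv_transition_chartDiff he he' hx hx', Function.comp, e.left_inv hx]
  · intro y hy v w
    rw [fderiv_transition he he' hy, fderiv_transition he he' hy]
    rw [Function.comp_apply, inner_metricOp_chartDiff he' (hsrc y hy).2, inner_metricOp]

/-- The curvature tensor can be computed in any chart. -/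
theorem chartDiff_curvature
    [IsContMDiffRiemannianBundle (𝓡 n) ∞ (Vec n) (fun x : M => TangentSpace (𝓡 n) x)]
    (he : e ∈ IsManifold.maximalAtlas (𝓡 n) ∞ M) {x : M} (hx : x ∈ e.source)
    (a b w : TangentSpace (𝓡 n) x) :
    chartDiff e x (curvature x a b w) =
      curv (christoffelCLM e) (e x) (chartDiff e x a) (chartDiff e x b) (chartDiff e x w) := by
  have hc : chartAt (Vec n) x ∈ IsManifold.maximalAtlas (𝓡 n) ∞ M :=
    IsManifold.chart_mem_maximalAtlas x
  have hxc := mem_chart_source (Vec n) x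
  rw [← curv_transition hc he hxc hx, ← fderiv_transition_chartDiff hc he hxc hx]
  congr 1
  rw [curvature, ← chartCurvature_eq hc ((chartAt (Vec n) x).map_source hxc)]
  set c := chartCurvature (chartAt (Vec n) x) ((chartAt (Vec n) x) x)
    (chartDiff (chartAt (Vec n) x) x a) (chartDiff (chartAt (Vec n) x) x b)
    (chartDiff (chartAt (Vec n) x) x w)
  have hinv : (mfderiv (𝓡 n) (𝓡 n) (chartAt (Vec n) x) x).IsInvertible :=
    isInvertible_mfderiv_chart hc hxc
  exact congrArg (fun L => L c) hinv.self_comp_inverse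

end Transition

end Charts

/-! ### Geodesics: velocity, reparametrization, uniqueness -/

section Geodesics

set_option synthInstance.maxHeartbeats 200000
set_option linter.unusedSectionVars false

variable {n : ℕ} {M : Type*} [MetricSpace M] [ChartedSpace (Vec n) M] [IsManifold (𝓡 n) ∞ M]
  [RiemannianBundle (fun x : M => TangentSpace (𝓡 n) x)]
  {e : OpenPartialHomeomorph M (Vec n)} {γ γ₁ γ₂ : ℝ → M} {t : ℝ}

theorem uniqueDiffWithinAt_unitInterval (ht : t ∈ Icc (0 : ℝ) 1) :
    UniqueDiffWithinAt ℝ (Icc (0 : ℝ) 1) t :=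
  uniqueDiffOn_Icc zero_lt_one t ht

theorem mdifferentiableWithinAt_of_chart (he : e ∈ IsManifold.maximalAtlas (𝓡 n) ∞ M)
    {s : Set ℝ} (hγ : ContinuousWithinAt γ s t) (hte : γ t ∈ e.source)
    (hd : DifferentiableWithinAt ℝ (e ∘ γ) s t) :
    MDifferentiableWithinAt 𝓘(ℝ, ℝ) (𝓡 n) γ s t := by
  have h1 : MDifferentiableWithinAt 𝓘(ℝ, ℝ) (𝓡 n) (e.symm ∘ (e ∘ γ)) s t :=
    MDifferentiableAt.comp_mdifferentiableWithinAt (I' := 𝓡 n) t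
      (mdifferentiableAt_symm he (e.map_source hte)) hd.mdifferentiableWithinAt
  refine h1.congr_of_eventuallyEq ?_ (e.left_inv hte).symm
  filter_upwards [hγ (e.open_source.mem_nhds hte)] with r hr using (e.left_inv hr).symm

theorem chartDiff_velocity (he : e ∈ IsManifold.maximalAtlas (𝓡 n) ∞ M)
    (ht : t ∈ Icc (0 : ℝ) 1) (hγ : ContinuousWithinAt γ (Icc 0 1) t) (hte : γ t ∈ e.source)
    (hd : DifferentiableWithinAt ℝ (e ∘ γ) (Icc 0 1) t) :
    chartDiff e (γ t) (velocity γ t) = derivWithin (e ∘ γ) (Icc 0 1) t := by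
  have h1 := mfderiv_comp_mfderivWithin (I := 𝓘(ℝ, ℝ)) (I' := 𝓡 n) (I'' := 𝓡 n) (x := t)
    (s := Icc 0 1) (g := e) (f := γ)
    (mdifferentiableAt_chart he hte) (mdifferentiableWithinAt_of_chart he hγ hte hd)
    (uniqueDiffWithinAt_unitInterval ht).uniqueMDiffWithinAt
  rw [mfderivWithin_eq_fderivWithin] at h1
  rw [derivWithin]
  erw [h1]
  rfl

theorem chartDiff_injective (he : e ∈ IsManifold.maximalAtlas (𝓡 n) ∞ M) {x : M}
    (hx : x ∈ e.source) : Function.Injective (chartDiff e x) := by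
  intro v w hvw
  have hv := mfderiv_symm_chartDiff he hx v
  have hw := mfderiv_symm_chartDiff he hx w
  rw [hvw] at hv
  exact hv.symm.trans hw

namespace IsGeodesic

theorem chartDiff_velocity (h : IsGeodesic (n := n) γ)
    (he : e ∈ IsManifold.maximalAtlas (𝓡 n) ∞ M) (ht : t ∈ Icc (0 : ℝ) 1)
    (hte : γ t ∈ e.source) :
    chartDiff e (γ t) (velocity γ t) = derivWithin (e ∘ γ) (Icc 0 1) t :=
  PathHessian.chartDiff_velocity he ht (h.1 t ht) hte (h.2 e he t ht hte).1

theorem hasDerivWithinAt (h : IsGeodesic (n := n) γ)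
    (he : e ∈ IsManifold.maximalAtlas (𝓡 n) ∞ M) (ht : t ∈ Icc (0 : ℝ) 1)
    (hte : γ t ∈ e.source) :
    HasDerivWithinAt (e ∘ γ) (derivWithin (e ∘ γ) (Icc 0 1) t) (Icc 0 1) t :=
  (h.2 e he t ht hte).1.hasDerivWithinAt

theorem eventually_mem_source (h : IsGeodesic (n := n) γ) (ht : t ∈ Icc (0 : ℝ) 1)
    (hte : γ t ∈ e.source) : ∀ᶠ s in 𝓝[Icc 0 1] t, γ s ∈ e.source :=
  h.1 t ht (e.open_source.mem_nhds hte)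

/-- An affine change of the parameter turns geodesics into geodesics. -/
theorem comp_affine (h : IsGeodesic (n := n) γ) (a b : ℝ)
    (hab : MapsTo (fun s => a + b * s) (Icc (0 : ℝ) 1) (Icc 0 1)) :
    IsGeodesic (n := n) (fun s => γ (a + b * s)) ∧
    ∀ e ∈ IsManifold.maximalAtlas (𝓡 n) ∞ M, ∀ s ∈ Icc (0 : ℝ) 1, γ (a + b * s) ∈ e.source →
      derivWithin (e ∘ fun s => γ (a + b * s)) (Icc 0 1) s =
        b • derivWithin (e ∘ γ) (Icc 0 1) (a + b * s) := by
  have haff : ∀ s, HasDerivWithinAt (fun s => a + b * s) b (Icc (0 : ℝ) 1) s := fun s => by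
    simpa using ((hasDerivWithinAt_id s (Icc (0 : ℝ) 1)).const_mul b).const_add a
  have hd : ∀ e ∈ IsManifold.maximalAtlas (𝓡 n) ∞ M, ∀ s ∈ Icc (0 : ℝ) 1,
      γ (a + b * s) ∈ e.source → HasDerivWithinAt (e ∘ fun s => γ (a + b * s))
        (b • derivWithin (e ∘ γ) (Icc 0 1) (a + b * s)) (Icc 0 1) s := fun e he s hs hse =>
    HasDerivWithinAt.scomp (g₁ := e ∘ γ) s (h.hasDerivWithinAt he (hab hs) hse) (haff s) hab
  have hd' : ∀ e ∈ IsManifold.maximalAtlas (𝓡 n) ∞ M, ∀ s ∈ Icc (0 : ℝ) 1,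
      γ (a + b * s) ∈ e.source → derivWithin (e ∘ fun s => γ (a + b * s)) (Icc 0 1) s =
        b • derivWithin (e ∘ γ) (Icc 0 1) (a + b * s) := fun e he s hs hse =>
    (hd e he s hs hse).derivWithin (uniqueDiffWithinAt_unitInterval hs)
  have hcont : ContinuousOn (fun s => γ (a + b * s)) (Icc 0 1) :=
    h.1.comp (by fun_prop) hab
  refine ⟨⟨hcont, fun e he s hs hse => ⟨(hd e he s hs hse).differentiableWithinAt, ?_⟩⟩, hd'⟩
  have h2 := (h.2 e he _ (hab hs) hse).2
  have h3 := (HasDerivWithinAt.scomp (g₁ := derivWithin (e ∘ γ) (Icc 0 1)) s h2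
    (haff s) hab).const_smul b
  rw [hd' e he s hs hse]
  simp only [← christoffelCLM_apply] at h3 ⊢
  have h4 : HasDerivWithinAt (b • (derivWithin (e ∘ γ) (Icc 0 1) ∘ fun s => a + b * s))
      (-(((christoffelCLM e (e (γ (a + b * s)))) (b • derivWithin (e ∘ γ) (Icc 0 1) (a + b * s)))
        (b • derivWithin (e ∘ γ) (Icc 0 1) (a + b * s)))) (Icc 0 1) s := by
    refine h3.congr_deriv ?_
    simp only [map_smul, smul_apply, smul_neg]
  refine h4.congr_of_eventuallyEq ?_ (hd' e he s hs hse)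
  filter_upwards [hcont s hs (e.open_source.mem_nhds hse), self_mem_nhdsWithin] with r hr hr'
  exact hd' e he r hr' hr

/-- Two geodesics with the same position and velocity at time `t < 1` agree for a while. -/
theorem eqOn_right
    [IsContMDiffRiemannianBundle (𝓡 n) ∞ (Vec n) (fun x : M => TangentSpace (𝓡 n) x)]
    (h₁ : IsGeodesic (n := n) γ₁) (h₂ : IsGeodesic (n := n) γ₂) (ht : t ∈ Ico (0 : ℝ) 1)
    (he : e ∈ IsManifold.maximalAtlas (𝓡 n) ∞ M) (hte : γ₁ t ∈ e.source) (h0 : γ₁ t = γ₂ t)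
    (h0' : derivWithin (e ∘ γ₁) (Icc 0 1) t = derivWithin (e ∘ γ₂) (Icc 0 1) t) :
    ∃ b ∈ Ioc t 1, EqOn γ₁ γ₂ (Icc t b) := by
  have ht' := Ico_subset_Icc_self ht
  set p₁ := derivWithin (e ∘ γ₁) (Icc 0 1) with hp₁
  set p₂ := derivWithin (e ∘ γ₂) (Icc 0 1) with hp₂
  set X : Vec n × Vec n → Vec n × Vec n := fun z => (z.2, -christoffelCLM e z.1 z.2 z.2) with hX
  have hXc : ContDiffAt ℝ 1 X ((e ∘ γ₁) t, p₁ t) := by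
    have h1 : ContDiffAt ℝ 1 (christoffelCLM e) ((e ∘ γ₁) t) :=
      ((contDiffOn_christoffelCLM he).contDiffAt
        (e.open_target.mem_nhds (e.map_source hte))).of_le (by simp)
    have h2 : ContDiffAt ℝ 1 (fun z : Vec n × Vec n => christoffelCLM e z.1)
        ((e ∘ γ₁) t, p₁ t) := ContDiffAt.comp (g := christoffelCLM e) _ h1 contDiffAt_fst
    exact contDiffAt_snd.prodMk ((h2.clm_apply contDiffAt_snd).clm_apply contDiffAt_snd).neg
  obtain ⟨K, N, hN, hK⟩ := hXc.exists_lipschitzOnWith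
  have hz : ∀ γ : ℝ → M, IsGeodesic (n := n) γ → γ t = γ₁ t →
      derivWithin (e ∘ γ) (Icc 0 1) t = p₁ t →
      ∀ᶠ s in 𝓝[Icc 0 1] t, γ s ∈ e.source ∧ ((e ∘ γ) s, derivWithin (e ∘ γ) (Icc 0 1) s) ∈ N := by
    intro γ hγ hγt hγt'
    have hse : γ t ∈ e.source := hγt ▸ hte
    refine (hγ.eventually_mem_source ht' hse).and ?_
    have h1 : ContinuousWithinAt (fun s => ((e ∘ γ) s, derivWithin (e ∘ γ) (Icc 0 1) s))
        (Icc 0 1) t := (hγ.2 e he t ht' hse).1.continuousWithinAt.prodMk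
      (hγ.2 e he t ht' hse).2.continuousWithinAt
    refine h1 ?_
    have : ((e ∘ γ) t, derivWithin (e ∘ γ) (Icc 0 1) t) = ((e ∘ γ₁) t, p₁ t) := by
      rw [hγt', Function.comp, hγt]; rfl
    beta_reduce
    rw [this]
    exact hN
  have hev := (hz γ₁ h₁ rfl rfl).and (hz γ₂ h₂ h0.symm h0'.symm)
  have hev' := nhdsWithin_mono t (Icc_subset_Icc_left ht.1 : Icc t 1 ⊆ Icc 0 1) hev
  rw [nhdsWithin_Icc_eq_nhdsGE ht.2] at hev'
  obtain ⟨b, hb, hbs⟩ := (mem_nhdsGE_iff_exists_Icc_subset).1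
    (Filter.inter_mem hev' (Icc_mem_nhdsGE ht.2))
  have hb1 : b ≤ 1 := (hbs ⟨le_of_lt hb, le_rfl⟩).2.2
  have hIcc : Icc t b ⊆ Icc 0 1 := Icc_subset_Icc ht.1 hb1
  refine ⟨b, ⟨hb, hb1⟩, ?_⟩
  have hsol : ∀ γ : ℝ → M, IsGeodesic (n := n) γ → (∀ s ∈ Icc t b, γ s ∈ e.source) →
      ContinuousOn (fun s => ((e ∘ γ) s, derivWithin (e ∘ γ) (Icc 0 1) s)) (Icc t b) ∧
      ∀ s ∈ Ico t b, HasDerivWithinAt (fun s => ((e ∘ γ) s, derivWithin (e ∘ γ) (Icc 0 1) s))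
        (X ((e ∘ γ) s, derivWithin (e ∘ γ) (Icc 0 1) s)) (Ici s) s := by
    intro γ hγ hsrc
    have hd : ∀ s ∈ Icc t b, HasDerivWithinAt
        (fun s => ((e ∘ γ) s, derivWithin (e ∘ γ) (Icc 0 1) s))
        (X ((e ∘ γ) s, derivWithin (e ∘ γ) (Icc 0 1) s)) (Icc 0 1) s := fun s hs => by
      have h1 := (hγ.2 e he s (hIcc hs) (hsrc s hs)).2
      rw [← christoffelCLM_apply] at h1
      exact (hγ.hasDerivWithinAt he (hIcc hs) (hsrc s hs)).prodMk h1
    refine ⟨fun s hs => ((hd s hs).continuousWithinAt).mono hIcc, fun s hs => ?_⟩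
    exact (hd s (Ico_subset_Icc_self hs)).mono_of_mem_nhdsWithin
      (Icc_mem_nhdsGE_of_mem ⟨ht.1.trans hs.1, hs.2.trans_le hb1⟩)
  have s1 := hsol γ₁ h₁ fun s hs => (hbs hs).1.1.1
  have s2 := hsol γ₂ h₂ fun s hs => (hbs hs).1.2.1
  have huniq := ODE_solution_unique_of_mem_Icc_right (v := fun _ => X) (s := fun _ => N)
    (fun _ _ => hK) s1.1 s1.2 (fun s hs => (hbs (Ico_subset_Icc_self hs)).1.1.2)
    s2.1 s2.2 (fun s hs => (hbs (Ico_subset_Icc_self hs)).1.2.2)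
    (by simp only [Function.comp, h0]; exact Prod.ext rfl h0')
  intro s hs
  exact e.injOn (hbs hs).1.1.1 (hbs hs).1.2.1 (congrArg Prod.fst (huniq hs))

/-- A geodesic is determined by its initial position and velocity. -/
theorem eqOn
    [IsContMDiffRiemannianBundle (𝓡 n) ∞ (Vec n) (fun x : M => TangentSpace (𝓡 n) x)]
    (h₁ : IsGeodesic (n := n) γ₁) (h₂ : IsGeodesic (n := n) γ₂)
    (h0 : (⟨γ₁ 0, velocity γ₁ 0⟩ : TangentBundle (𝓡 n) M) = ⟨γ₂ 0, velocity γ₂ 0⟩) :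
    EqOn γ₁ γ₂ (Icc 0 1) := by
  set s : Set ℝ := {t | γ₁ t = γ₂ t ∧ ∀ e ∈ IsManifold.maximalAtlas (𝓡 n) ∞ M, γ₁ t ∈ e.source →
    derivWithin (e ∘ γ₁) (Icc 0 1) t = derivWithin (e ∘ γ₂) (Icc 0 1) t} with hs
  have hzero : (0 : ℝ) ∈ Icc (0 : ℝ) 1 := ⟨le_rfl, zero_le_one⟩
  have h0s : (0 : ℝ) ∈ s := by
    have hpt : γ₁ 0 = γ₂ 0 := congrArg (fun z : TangentBundle (𝓡 n) M => z.1) h0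
    refine ⟨hpt, fun e he h0e => ?_⟩
    rw [← h₁.chartDiff_velocity he hzero h0e,
      ← h₂.chartDiff_velocity he hzero (hpt ▸ h0e)]
    exact congrArg (fun z : TangentBundle (𝓡 n) M => chartDiff e z.1 z.2) h0
  have hclosed : IsClosed (s ∩ Icc 0 1) := by
    refine isClosed_of_closure_subset fun t ht => ?_
    have htI : t ∈ Icc (0 : ℝ) 1 := closure_minimal inter_subset_right isClosed_Icc ht
    have hfreq : ∃ᶠ r in 𝓝[Icc 0 1] t, r ∈ s := by
      rw [frequently_nhdsWithin_iff]
      exact mem_closure_iff_frequently.1 ht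
    have hpt : γ₁ t = γ₂ t :=
      tendsto_nhds_unique_of_frequently_eq (h₁.1 t htI) (h₂.1 t htI) (hfreq.mono fun r hr => hr.1)
    refine ⟨⟨hpt, fun e he hte => ?_⟩, htI⟩
    refine tendsto_nhds_unique_of_frequently_eq (h₁.2 e he t htI hte).2.continuousWithinAt
      (h₂.2 e he t htI (hpt ▸ hte)).2.continuousWithinAt ?_
    exact (hfreq.and_eventually (h₁.eventually_mem_source htI hte)).mono
      fun r hr => hr.1.2 e he hr.2
  have hsub : Icc (0 : ℝ) 1 ⊆ s := by
    refine hclosed.Icc_subset_of_forall_exists_gt h0s fun t ht y hy => ?_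
    have hc : chartAt (Vec n) (γ₁ t) ∈ IsManifold.maximalAtlas (𝓡 n) ∞ M :=
      IsManifold.chart_mem_maximalAtlas _
    obtain ⟨b, hb, hEq⟩ := h₁.eqOn_right h₂ ht.2 hc (mem_chart_source _ _) ht.1.1
      (ht.1.2 _ hc (mem_chart_source _ _))
    obtain ⟨r, hr1, hr2⟩ := exists_between (lt_min hb.1 hy)
    have hrb : r < b := hr2.trans_le (min_le_left _ _)
    refine ⟨r, ⟨hEq ⟨hr1.le, hrb.le⟩, fun e he _ => ?_⟩, hr1, (hr2.trans_le (min_le_right _ _)).le⟩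
    refine Filter.EventuallyEq.derivWithin_eq ?_ (congrArg e (hEq ⟨hr1.le, hrb.le⟩))
    filter_upwards [mem_nhdsWithin_of_mem_nhds (Icc_mem_nhds hr1 hrb)] with z hz
    exact congrArg e (hEq hz)
  exact fun t ht => (hsub ht).1

/-- The speed of a geodesic is constant. -/
theorem norm_velocity
    [IsContMDiffRiemannianBundle (𝓡 n) ∞ (Vec n) (fun x : M => TangentSpace (𝓡 n) x)]
    (h : IsGeodesic (n := n) γ) (ht : t ∈ Icc (0 : ℝ) 1) :
    ‖velocity (n := n) γ t‖ = ‖velocity (n := n) γ 0‖ := by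
  have hd : ∀ s ∈ Icc (0 : ℝ) 1, HasDerivWithinAt
      (fun s => inner ℝ (velocity (n := n) γ s) (velocity (n := n) γ s)) 0 (Icc 0 1) s := by
    intro s hs
    have hc : chartAt (Vec n) (γ s) ∈ IsManifold.maximalAtlas (𝓡 n) ∞ M :=
      IsManifold.chart_mem_maximalAtlas _
    have hse := mem_chart_source (Vec n) (γ s)
    set e := chartAt (Vec n) (γ s)
    have h2 := (h.2 e hc s hs hse).2
    have h1 := (isLeviCivitaOn_chart hc).hasDerivWithinAt_inner (x := e ∘ γ) (e.map_source hse)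
      (h.hasDerivWithinAt hc hs hse) h2 h2
    have hval : ∀ r ∈ Icc (0 : ℝ) 1, γ r ∈ e.source →
        inner ℝ (velocity (n := n) γ r) (velocity (n := n) γ r) = inner ℝ
        (metricOp e ((e ∘ γ) r) (derivWithin (e ∘ γ) (Icc 0 1) r))
        (derivWithin (e ∘ γ) (Icc 0 1) r) := fun r hr hre => by
      rw [← h.chartDiff_velocity hc hr hre, Function.comp_apply, inner_metricOp_chartDiff hc hre]
    refine (h1.congr_deriv ?_).congr_of_eventuallyEq ?_ (hval s hs hse)
    · simp [christoffelCLM_apply]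
    · filter_upwards [h.eventually_mem_source hs hse, self_mem_nhdsWithin] with r hr hr'
      exact hval r hr' hr
  have hconst := constant_of_derivWithin_zero (a := 0) (b := 1)
    (fun s hs => (hd s hs).differentiableWithinAt)
    (fun s hs => (hd s (Ico_subset_Icc_self hs)).derivWithin
      (uniqueDiffWithinAt_unitInterval (Ico_subset_Icc_self hs))) t ht
  simp only [real_inner_self_eq_norm_sq] at hconst
  exact (sq_eq_sq₀ (norm_nonneg _) (norm_nonneg _)).1 hconst

theorem pathELength
    [IsContMDiffRiemannianBundle (𝓡 n) ∞ (Vec n) (fun x : M => TangentSpace (𝓡 n) x)]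
    (h : IsGeodesic (n := n) γ) :
    Manifold.pathELength (𝓡 n) γ 0 1 = ENNReal.ofReal ‖velocity (n := n) γ 0‖ := by
  rw [Manifold.pathELength_eq_lintegral_mfderivWithin_Icc]
  have h1 : ∀ t ∈ Icc (0 : ℝ) 1, ‖mfderivWithin 𝓘(ℝ, ℝ) (𝓡 n) γ (Icc 0 1) t 1‖ₑ =
      ENNReal.ofReal ‖velocity (n := n) γ 0‖ := fun t ht => by
    rw [← h.norm_velocity ht, ← ofReal_norm]; rfl
  rw [setLIntegral_congr_fun measurableSet_Icc h1]
  simp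

end IsGeodesic

end Geodesics

/-! ### The exponential map and normal coordinates -/

section NormalCoordinates

set_option synthInstance.maxHeartbeats 200000
set_option linter.unusedSectionVars false

variable {n : ℕ} {M : Type*} [MetricSpace M] [ChartedSpace (Vec n) M] [IsManifold (𝓡 n) ∞ M]
  [RiemannianBundle (fun x : M => TangentSpace (𝓡 n) x)]
  {e : OpenPartialHomeomorph M (Vec n)} {γ : ℝ → M} {x : M} {v : TangentSpace (𝓡 n) x}

theorem zero_mem_unitInterval : (0 : ℝ) ∈ Icc (0 : ℝ) 1 := ⟨le_rfl, zero_le_one⟩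

theorem one_mem_unitInterval : (1 : ℝ) ∈ Icc (0 : ℝ) 1 := ⟨zero_le_one, le_rfl⟩

theorem chartDiff_zero (e : OpenPartialHomeomorph M (Vec n)) (x : M) :
    chartDiff e x (0 : TangentSpace (𝓡 n) x) = 0 :=
  map_zero (mfderiv (𝓡 n) (𝓡 n) e x)

theorem IsGeodesic.initial_eq (h : IsGeodesic (n := n) γ)
    (he : e ∈ IsManifold.maximalAtlas (𝓡 n) ∞ M) (hx : γ 0 = x) (hxe : x ∈ e.source)
    (hv : derivWithin (e ∘ γ) (Icc 0 1) 0 = chartDiff e x v) :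
    (⟨γ 0, velocity γ 0⟩ : TangentBundle (𝓡 n) M) = ⟨x, v⟩ := by
  subst hx
  congr 1
  exact chartDiff_injective he hxe ((h.chartDiff_velocity he zero_mem_unitInterval hxe).trans hv)

theorem IsGeodesic.derivWithin_zero (h : IsGeodesic (n := n) γ)
    (he : e ∈ IsManifold.maximalAtlas (𝓡 n) ∞ M) (hxe : x ∈ e.source)
    (h0 : (⟨γ 0, velocity γ 0⟩ : TangentBundle (𝓡 n) M) = ⟨x, v⟩) :
    derivWithin (e ∘ γ) (Icc 0 1) 0 = chartDiff e x v := by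
  have hx : γ 0 = x := congrArg (fun z : TangentBundle (𝓡 n) M => z.1) h0
  rw [← h.chartDiff_velocity he zero_mem_unitInterval (hx ▸ hxe)]
  exact congrArg (fun z : TangentBundle (𝓡 n) M => chartDiff e z.1 z.2) h0

theorem isGeodesic_const (x : M) : IsGeodesic (n := n) (fun _ : ℝ => x) := by
  refine ⟨continuousOn_const, fun e _ t _ _ => ?_⟩
  have h : e ∘ (fun _ : ℝ => x) = fun _ => e x := rfl
  have h1 : derivWithin (fun _ : ℝ => e x) (Icc 0 1) = fun _ => 0 := by
    funext s; simp
  rw [h, h1]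
  refine ⟨differentiableWithinAt_const _, ?_⟩
  rw [← christoffelCLM_apply]
  simpa using hasDerivWithinAt_const t (Icc (0 : ℝ) 1) (0 : Vec n)

variable [IsContMDiffRiemannianBundle (𝓡 n) ∞ (Vec n) (fun x : M => TangentSpace (𝓡 n) x)]

theorem IsGeodesic.expMap_eq (h : IsGeodesic (n := n) γ)
    (h0 : (⟨γ 0, velocity γ 0⟩ : TangentBundle (𝓡 n) M) = ⟨x, v⟩) : expMap x v = γ 1 := by
  have hex : ∃ γ : ℝ → M, IsGeodesic (n := n) γ ∧
      (⟨γ 0, velocity γ 0⟩ : TangentBundle (𝓡 n) M) = ⟨x, v⟩ := ⟨γ, h, h0⟩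
  rw [expMap, dif_pos hex]
  exact hex.choose_spec.1.eqOn h (hex.choose_spec.2.trans h0.symm) one_mem_unitInterval

theorem IsGeodesic.expMap_smul_eq (h : IsGeodesic (n := n) γ)
    (h0 : (⟨γ 0, velocity γ 0⟩ : TangentBundle (𝓡 n) M) = ⟨x, v⟩) {t : ℝ}
    (ht : t ∈ Icc (0 : ℝ) 1) : expMap x (t • v) = γ t := by
  have hmaps : MapsTo (fun s => 0 + t * s) (Icc (0 : ℝ) 1) (Icc 0 1) := fun s hs => by
    simp only [zero_add]
    exact ⟨mul_nonneg ht.1 hs.1, mul_le_one₀ ht.2 hs.1 hs.2⟩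
  obtain ⟨h1, h2⟩ := h.comp_affine 0 t hmaps
  have hx : γ 0 = x := congrArg (fun z : TangentBundle (𝓡 n) M => z.1) h0
  have hx' : γ (0 + t * 0) = x := by simpa using hx
  have hc : chartAt (Vec n) x ∈ IsManifold.maximalAtlas (𝓡 n) ∞ M :=
    IsManifold.chart_mem_maximalAtlas _
  have hxc := mem_chart_source (Vec n) x
  have h3 := h1.expMap_eq (v := t • v) (h1.initial_eq hc hx' hxc (by
    rw [h2 _ hc 0 zero_mem_unitInterval (by rw [hx']; exact hxc)]
    simp only [mul_zero, add_zero]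
    rw [h.derivWithin_zero hc hxc h0]
    exact (map_smul (mfderiv (𝓡 n) (𝓡 n) (chartAt (Vec n) x) x) t v).symm))
  simpa using h3

theorem expMap_zero (x : M) : expMap x (0 : TangentSpace (𝓡 n) x) = x := by
  have hc : chartAt (Vec n) x ∈ IsManifold.maximalAtlas (𝓡 n) ∞ M :=
    IsManifold.chart_mem_maximalAtlas _
  refine (isGeodesic_const x).expMap_eq ((isGeodesic_const x).initial_eq hc rfl
    (mem_chart_source (Vec n) x) ?_)
  have h : (chartAt (Vec n) x) ∘ (fun _ : ℝ => x) = fun _ => chartAt (Vec n) x x := rfl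
  rw [h, chartDiff_zero]
  simp

/-- Where `exp_x` is injective and agrees with a diffeomorphism of a ball, geodesics with the
initial velocities in this ball exist: for a velocity `v` without geodesic, `expMap x v` would
be `x = expMap x 0`. -/
theorem exists_isGeodesic_of_injOn {ρ : ℝ} (hinj : InjOn (expMap x) (Metric.ball
    (0 : TangentSpace (𝓡 n) x) ρ)) (hv : v ∈ Metric.ball (0 : TangentSpace (𝓡 n) x) ρ) :
    ∃ γ : ℝ → M, IsGeodesic (n := n) γ ∧
      (⟨γ 0, velocity γ 0⟩ : TangentBundle (𝓡 n) M) = ⟨x, v⟩ := by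
  have hc : chartAt (Vec n) x ∈ IsManifold.maximalAtlas (𝓡 n) ∞ M :=
    IsManifold.chart_mem_maximalAtlas _
  by_contra hex
  have h1 : expMap x v = x := by rw [expMap, dif_neg hex]
  have h2 : v = 0 := hinj hv (Metric.mem_ball_self (Metric.pos_of_mem_ball hv))
    (h1.trans (expMap_zero x).symm)
  subst h2
  refine hex ⟨_, isGeodesic_const x, (isGeodesic_const x).initial_eq hc rfl
    (mem_chart_source (Vec n) x) ?_⟩
  have h : (chartAt (Vec n) x) ∘ (fun _ : ℝ => x) = fun _ => chartAt (Vec n) x x := rfl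
  rw [h, chartDiff_zero]
  simp

/-- Normal coordinates: a chart whose inverse is `exp_x` on a ball. In it the geodesics from `x`
are the rays `t ↦ t w`. -/
theorem exists_normalChart {ρ : ℝ} (ι : Vec n ≃ₗᵢ[ℝ] TangentSpace (𝓡 n) x)
    (Φ : PartialDiffeomorph 𝓘(ℝ, TangentSpace (𝓡 n) x) (𝓡 n) (TangentSpace (𝓡 n) x) M ∞)
    (hsrc : Φ.source = Metric.ball 0 ρ) (hΦ : EqOn Φ (expMap x) (Metric.ball 0 ρ)) :
    ∃ e ∈ IsManifold.maximalAtlas (𝓡 n) ∞ M,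
      (∀ γ : ℝ → M, IsGeodesic (n := n) γ → ∀ w : Vec n, ‖w‖ < ρ →
        (⟨γ 0, velocity γ 0⟩ : TangentBundle (𝓡 n) M) = ⟨x, ι w⟩ → ∀ t ∈ Icc (0 : ℝ) 1,
          γ t ∈ e.source ∧ e (γ t) = t • w) ∧
      ∀ w : Vec n, ‖w‖ < ρ → ∀ t ∈ Icc (0 : ℝ) 1,
        t • w ∈ e.target ∧ christoffelCLM e (t • w) w w = 0 := by
  set e : OpenPartialHomeomorph M (Vec n) :=
    (ι.toHomeomorph.toOpenPartialHomeomorph.trans Φ.toOpenPartialHomeomorph).symm with he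
  have htgt : ∀ z : Vec n, z ∈ e.target ↔ ‖z‖ < ρ := by
    intro z
    have : z ∈ e.target ↔ ι z ∈ Φ.source := by
      simp [he, PartialDiffeomorph.toOpenPartialHomeomorph]
    rw [this, hsrc, mem_ball_zero_iff, ι.norm_map]
  have hsymm : ∀ z : Vec n, e.symm z = Φ (ι z) := fun z => rfl
  have hcoe : ∀ y : M, e y = ι.symm (Φ.symm y) := fun y => rfl
  have hι : ContMDiff (𝓡 n) 𝓘(ℝ, TangentSpace (𝓡 n) x) ∞ ι :=
    (ι.toContinuousLinearEquiv : Vec n →L[ℝ] TangentSpace (𝓡 n) x).contMDiff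
  have hι' : ContMDiff 𝓘(ℝ, TangentSpace (𝓡 n) x) (𝓡 n) ∞ ι.symm :=
    (ι.symm.toContinuousLinearEquiv : TangentSpace (𝓡 n) x →L[ℝ] Vec n).contMDiff
  have heA : e ∈ IsManifold.maximalAtlas (𝓡 n) ∞ M := by
    refine e.mem_maximalAtlas_of_contMDiffOn ?_ ?_
    · refine hι'.comp_contMDiffOn (Φ.symm.contMDiffOn.mono fun y hy => ?_)
      simpa [he, PartialDiffeomorph.toOpenPartialHomeomorph, PartialDiffeomorph.symm] using hy
    · refine Φ.contMDiffOn.comp hι.contMDiffOn fun z hz => ?_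
      rw [htgt] at hz
      rw [mem_preimage, hsrc, mem_ball_zero_iff]
      exact (ι.norm_map z).trans_lt hz
  have hgeo : ∀ γ : ℝ → M, IsGeodesic (n := n) γ → ∀ w : Vec n, ‖w‖ < ρ →
      (⟨γ 0, velocity γ 0⟩ : TangentBundle (𝓡 n) M) = ⟨x, ι w⟩ → ∀ t ∈ Icc (0 : ℝ) 1,
        γ t ∈ e.source ∧ e (γ t) = t • w := by
    intro γ hγ w hw h0 t ht
    have hball : ‖t • w‖ < ρ := by
      rw [norm_smul, Real.norm_of_nonneg ht.1]
      exact (mul_le_of_le_one_left (norm_nonneg _) ht.2).trans_lt hw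
    have h1 : e.symm (t • w) = γ t := by
      rw [hsymm, hΦ (by rw [mem_ball_zero_iff, ι.norm_map]; exact hball), map_smul,
        hγ.expMap_smul_eq h0 ht]
    rw [← h1]
    exact ⟨e.map_target ((htgt _).2 hball), e.right_inv ((htgt _).2 hball)⟩
  refine ⟨e, heA, hgeo, fun w hw t ht => ?_⟩
  have hball : ‖t • w‖ < ρ := by
    rw [norm_smul, Real.norm_of_nonneg ht.1]
    exact (mul_le_of_le_one_left (norm_nonneg _) ht.2).trans_lt hw
  refine ⟨(htgt _).2 hball, ?_⟩
  have hinj : InjOn (expMap x) (Metric.ball (0 : TangentSpace (𝓡 n) x) ρ) := by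
    rw [← hΦ.injOn_iff, ← hsrc]
    exact Φ.toPartialEquiv.injOn
  obtain ⟨γ, hγ, h0⟩ := exists_isGeodesic_of_injOn (v := ι w) hinj
    (by rw [mem_ball_zero_iff, ι.norm_map]; exact hw)
  have hline : ∀ s ∈ Icc (0 : ℝ) 1, (e ∘ γ) s = s • w := fun s hs => (hgeo γ hγ w hw h0 s hs).2
  have hder : ∀ s ∈ Icc (0 : ℝ) 1, derivWithin (e ∘ γ) (Icc 0 1) s = w := fun s hs => by
    have h1 : HasDerivWithinAt (fun s : ℝ => s • w) w (Icc 0 1) s := by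
      simpa using (hasDerivWithinAt_id s (Icc (0 : ℝ) 1)).smul_const w
    exact (h1.congr hline (hline s hs)).derivWithin (uniqueDiffWithinAt_unitInterval hs)
  have h1 := (hγ.2 e heA t ht (hgeo γ hγ w hw h0 t ht).1).2
  have h2 : HasDerivWithinAt (derivWithin (e ∘ γ) (Icc 0 1)) 0 (Icc 0 1) t :=
    (hasDerivWithinAt_const t _ w).congr hder (hder t ht)
  have h3 := (uniqueDiffWithinAt_unitInterval ht).eq_deriv _ h1 h2
  rw [hder t ht, ← christoffelCLM_apply, (hgeo γ hγ w hw h0 t ht).2] at h3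
  exact neg_eq_zero.1 h3

end NormalCoordinates

/-! ### Parallel frames and Jacobi fields in coordinates -/

section Frames

set_option synthInstance.maxHeartbeats 200000
set_option linter.unusedSectionVars false

variable {E : Type*} [NormedAddCommGroup E] [InnerProductSpace ℝ E] [FiniteDimensional ℝ E]

/-- In finite dimension a family of operators that is differentiable at each vector is
differentiable in norm. -/
theorem hasDerivWithinAt_clm_of_apply {f : ℝ → E →L[ℝ] E} {f' : E →L[ℝ] E}
    {s : Set ℝ} {t : ℝ} (h : ∀ v, HasDerivWithinAt (fun r => f r v) (f' v) s t) :
    HasDerivWithinAt f f' s t := by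
  set b := stdOrthonormalBasis ℝ E with hb
  have key : ∀ L : E →L[ℝ] E, L = ∑ i, ContinuousLinearMap.smulRightL ℝ E E
      (innerSL ℝ (b i)) (L (b i)) := fun L => by
    ext1 v
    conv_lhs => rw [← b.sum_repr' v]
    simp
  rw [key f']
  refine (HasDerivWithinAt.fun_sum (A := fun i r => ContinuousLinearMap.smulRightL ℝ E E
      (innerSL ℝ (b i)) (f r (b i))) fun i _ => ?_).congr (fun r _ => key (f r)) (key (f t))
  exact (ContinuousLinearMap.smulRightL ℝ E E
    (innerSL ℝ (b i))).hasFDerivAt.comp_hasDerivWithinAt t (h _)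

theorem hasDerivWithinAt_of_inner {f : ℝ → E} {f' : E} {s : Set ℝ} {t : ℝ}
    (h : ∀ v, HasDerivWithinAt (fun r => inner ℝ (f r) v) (inner ℝ f' v) s t) :
    HasDerivWithinAt f f' s t := by
  set b := stdOrthonormalBasis ℝ E with hb
  have key : ∀ v : E, v = ∑ i, (inner ℝ v (b i) : ℝ) • b i := fun v => by
    conv_lhs => rw [← b.sum_repr' v]
    simp only [real_inner_comm]
  rw [key f']
  exact (HasDerivWithinAt.fun_sum (A := fun i r => (inner ℝ (f r) (b i) : ℝ) • b i)
    fun i _ => (h (b i)).smul_const (b i)).congr (fun r _ => key (f r)) (key (f t))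

theorem continuousOn_of_inner {f : ℝ → E} {s : Set ℝ}
    (h : ∀ v, ContinuousOn (fun r => inner ℝ (f r) v) s) : ContinuousOn f s := by
  set b := stdOrthonormalBasis ℝ E with hb
  have key : ∀ v : E, v = ∑ i, (inner ℝ v (b i) : ℝ) • b i := fun v => by
    conv_lhs => rw [← b.sum_repr' v]
    simp only [real_inner_comm]
  exact (continuousOn_finsetSum (f := fun i r => (inner ℝ (f r) (b i) : ℝ) • b i) Finset.univ
    fun i _ => (h (b i)).smul continuousOn_const).congr fun r _ => key (f r)

/-- In coordinates: `x` is a geodesic with velocity `p` on `[0,1]`, `B(t)` a parallel orthonormal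
frame along it, and `R(t) = B(t)⁻¹ R(B(t) ·, p(t)) p(t)`. -/
structure IsFrameAlong (Ω : Set (E)) (G : E → E →L[ℝ] E)
    (Γ : E → E →L[ℝ] E →L[ℝ] E) (x p : ℝ → E)
    (B R : ℝ → E →L[ℝ] E) : Prop where
  leviCivita : IsLeviCivitaOn Ω G Γ
  mem : ∀ t ∈ Icc (0 : ℝ) 1, x t ∈ Ω
  deriv : ∀ t ∈ Icc (0 : ℝ) 1, HasDerivWithinAt x (p t) (Icc 0 1) t
  geodesic : ∀ t ∈ Icc (0 : ℝ) 1, HasDerivWithinAt p (-Γ (x t) (p t) (p t)) (Icc 0 1) t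
  parallel : ∀ t ∈ Icc (0 : ℝ) 1, ∀ v,
    HasDerivWithinAt (fun s => B s v) (-Γ (x t) (p t) (B t v)) (Icc 0 1) t
  isometry : ∀ t ∈ Icc (0 : ℝ) 1, ∀ v w,
    inner ℝ (G (x t) (B t v)) (B t w) = inner ℝ v w
  curvature : ∀ t ∈ Icc (0 : ℝ) 1, ∀ v, B t (R t v) = curv Γ (x t) (B t v) (p t) (p t)

namespace IsFrameAlong

variable {Ω : Set (E)} {G : E → E →L[ℝ] E}
  {Γ : E → E →L[ℝ] E →L[ℝ] E} {x p : ℝ → E} {B R : ℝ → E →L[ℝ] E}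

theorem inner_R (h : IsFrameAlong Ω G Γ x p B R) {t : ℝ} (ht : t ∈ Icc (0 : ℝ) 1) (v w : E) :
    inner ℝ (R t v) w = inner ℝ (G (x t) (curv Γ (x t) (B t v) (p t) (p t))) (B t w) := by
  rw [← h.curvature t ht, h.isometry t ht]

theorem R_symm (h : IsFrameAlong Ω G Γ x p B R) {t : ℝ} (ht : t ∈ Icc (0 : ℝ) 1) (v w : E) :
    inner ℝ (R t v) w = inner ℝ v (R t w) := by
  rw [real_inner_comm _ v, h.inner_R ht, h.inner_R ht, h.leviCivita.inner_curv_symm (h.mem t ht)]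

theorem continuousOn_x (h : IsFrameAlong Ω G Γ x p B R) : ContinuousOn x (Icc 0 1) :=
  fun t ht => (h.deriv t ht).continuousWithinAt

theorem continuousOn_p (h : IsFrameAlong Ω G Γ x p B R) : ContinuousOn p (Icc 0 1) :=
  fun t ht => (h.geodesic t ht).continuousWithinAt

theorem continuousOn_B (h : IsFrameAlong Ω G Γ x p B R) : ContinuousOn B (Icc 0 1) :=
  continuousOn_clm_apply.2 fun v t ht => (h.parallel t ht v).continuousWithinAt

theorem continuousOn_G (h : IsFrameAlong Ω G Γ x p B R) :
    ContinuousOn (fun t => G (x t)) (Icc 0 1) :=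
  h.leviCivita.contDiffOn_metric.continuousOn.comp h.continuousOn_x h.mem

theorem continuousOn_Γ (h : IsFrameAlong Ω G Γ x p B R) :
    ContinuousOn (fun t => Γ (x t)) (Icc 0 1) :=
  h.leviCivita.contDiffOn_conn.continuousOn.comp h.continuousOn_x h.mem

theorem continuousOn_fderiv_Γ (h : IsFrameAlong Ω G Γ x p B R) :
    ContinuousOn (fun t => fderiv ℝ Γ (x t)) (Icc 0 1) :=
  (h.leviCivita.contDiffOn_conn.continuousOn_fderiv_of_isOpen h.leviCivita.isOpen
    (by simp)).comp h.continuousOn_x h.mem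

theorem continuousOn_R (h : IsFrameAlong Ω G Γ x p B R) : ContinuousOn R (Icc 0 1) := by
  refine continuousOn_clm_apply.2 fun v => continuousOn_of_inner fun w => ?_
  have hx := h.continuousOn_Γ
  have hD := h.continuousOn_fderiv_Γ
  have hG := h.continuousOn_G
  have hp := h.continuousOn_p
  have hB := h.continuousOn_B
  have hBv : ContinuousOn (fun t => B t v) (Icc 0 1) := hB.clm_apply continuousOn_const
  have hΓ2 : ∀ {a b : ℝ → E}, ContinuousOn a (Icc 0 1) → ContinuousOn b (Icc 0 1) →
      ContinuousOn (fun t => Γ (x t) (a t) (b t)) (Icc 0 1) :=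
    fun ha hb => (hx.clm_apply ha).clm_apply hb
  have hD2 : ∀ {a b d : ℝ → E}, ContinuousOn a (Icc 0 1) → ContinuousOn b (Icc 0 1) →
      ContinuousOn d (Icc 0 1) →
      ContinuousOn (fun t => fderiv ℝ Γ (x t) (a t) (b t) (d t)) (Icc 0 1) :=
    fun ha hb hd => ((hD.clm_apply ha).clm_apply hb).clm_apply hd
  have hc : ContinuousOn (fun t => inner ℝ (G (x t) (curv Γ (x t) (B t v) (p t) (p t)))
      (B t w)) (Icc 0 1) :=
    (hG.clm_apply ((((hD2 hBv hp hp).sub (hD2 hp hBv hp)).add (hΓ2 hBv (hΓ2 hp hp))).sub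
      (hΓ2 hp (hΓ2 hBv hp)))).inner (hB.clm_apply continuousOn_const)
  exact hc.congr fun t ht => h.inner_R ht v w

/-- `B(t)* G(x(t))` is the inverse of the orthonormal frame `B(t)`. -/
theorem adjoint_comp (h : IsFrameAlong Ω G Γ x p B R) {t : ℝ} (ht : t ∈ Icc (0 : ℝ) 1) :
    (ContinuousLinearMap.adjoint (B t) ∘L G (x t)) ∘L B t = 1 := by
  ext1 v
  refine ext_inner_right ℝ fun w => ?_
  simp only [ContinuousLinearMap.comp_apply, ContinuousLinearMap.adjoint_inner_left,
    h.isometry t ht, one_apply_eq_self]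

theorem comp_adjoint (h : IsFrameAlong Ω G Γ x p B R) {t : ℝ} (ht : t ∈ Icc (0 : ℝ) 1) :
    B t ∘L (ContinuousLinearMap.adjoint (B t) ∘L G (x t)) = 1 := by
  have h1 := h.adjoint_comp ht
  have hinj : Function.Injective (B t : E →ₗ[ℝ] E) := fun v w hvw => by
    have hv := congrArg (fun L => L v) h1
    have hw := congrArg (fun L => L w) h1
    exact hv.symm.trans ((congrArg (ContinuousLinearMap.adjoint (B t) ∘L G (x t)) hvw).trans hw)
  ext1 w
  obtain ⟨v, rfl⟩ := LinearMap.injective_iff_surjective.1 hinj w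
  exact congrArg (B t) (congrArg (fun L => L v) h1)

end IsFrameAlong

/-- A solution `f` of the Jacobi equation with symmetric coefficient `R` that vanishes at `1`, of
the form `f(t) = (1 - t) A(t)` with `A(t)` invertible with inverse `D(t)`. -/
structure IsJacobiFactorization (R f f' A D : ℝ → E →L[ℝ] E) : Prop where
  continuousOn_R : ContinuousOn R (Icc 0 1)
  symm : ∀ t ∈ Icc (0 : ℝ) 1, ∀ v w, inner ℝ (R t v) w = inner ℝ v (R t w)
  deriv : ∀ t ∈ Icc (0 : ℝ) 1, HasDerivWithinAt f (f' t) (Icc 0 1) t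
  jacobi : ∀ t ∈ Icc (0 : ℝ) 1, HasDerivWithinAt f' (-(R t ∘L f t)) (Icc 0 1) t
  factor : ∀ t ∈ Icc (0 : ℝ) 1, f t = (1 - t) • A t
  continuousOn_A : ContinuousOn A (Icc 0 1)
  continuousOn_D : ContinuousOn D (Icc 0 1)
  mul_inv : ∀ t ∈ Icc (0 : ℝ) 1, A t * D t = 1
  inv_mul : ∀ t ∈ Icc (0 : ℝ) 1, D t * A t = 1

/-- Uniqueness for the linear equation `k'' + R k = 0` with terminal values at `t = 1`. -/
theorem jacobi_unique {R : ℝ → E →L[ℝ] E} (hR : ContinuousOn R (Icc 0 1))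
    {k k' l l' : ℝ → E}
    (hk : ∀ t ∈ Icc (0 : ℝ) 1, HasDerivWithinAt k (k' t) (Icc 0 1) t)
    (hk' : ∀ t ∈ Icc (0 : ℝ) 1, HasDerivWithinAt k' (-R t (k t)) (Icc 0 1) t)
    (hl : ∀ t ∈ Icc (0 : ℝ) 1, HasDerivWithinAt l (l' t) (Icc 0 1) t)
    (hl' : ∀ t ∈ Icc (0 : ℝ) 1, HasDerivWithinAt l' (-R t (l t)) (Icc 0 1) t)
    (h1 : k 1 = l 1) (h1' : k' 1 = l' 1) : EqOn k l (Icc 0 1) := by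
  obtain ⟨C, hC⟩ := isCompact_Icc.exists_bound_of_continuousOn hR
  have hlip : ∀ t ∈ Ioc (0 : ℝ) 1, LipschitzOnWith (1 + C.toNNReal)
      (fun z : E × E => (z.2, -R t z.1)) univ := by
    intro t ht
    have hle : ∀ z : E, ‖R t z‖ ≤ C.toNNReal * ‖z‖ := fun z =>
      (R t).le_of_opNorm_le ((hC t (Ioc_subset_Icc_self ht)).trans (Real.le_coe_toNNReal C)) z
    refine LipschitzOnWith.of_dist_le_mul fun z _ w _ => ?_
    rw [dist_eq_norm, dist_eq_norm, Prod.norm_def, NNReal.coe_add, NNReal.coe_one]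
    refine max_le ?_ ?_
    · exact (norm_snd_le (z - w)).trans
        (le_mul_of_one_le_left (norm_nonneg _) (by simp))
    · have e1 : ((z.2, -R t z.1) - (w.2, -R t w.1)).2 = -R t (z - w).1 := by
        simp only [Prod.snd_sub, Prod.fst_sub, map_sub]; abel
      rw [e1, norm_neg]
      refine (hle _).trans (mul_le_mul ?_ (norm_fst_le (z - w)) (norm_nonneg _) (by positivity))
      simp
  have hd : ∀ {k k' : ℝ → E},
      (∀ t ∈ Icc (0 : ℝ) 1, HasDerivWithinAt k (k' t) (Icc 0 1) t) →
      (∀ t ∈ Icc (0 : ℝ) 1, HasDerivWithinAt k' (-R t (k t)) (Icc 0 1) t) →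
      ContinuousOn (fun t => (k t, k' t)) (Icc 0 1) ∧ ∀ t ∈ Ioc (0 : ℝ) 1,
        HasDerivWithinAt (fun t => (k t, k' t)) (k' t, -R t (k t)) (Iic t) t := by
    intro k k' hk hk'
    refine ⟨fun t ht => ((hk t ht).prodMk (hk' t ht)).continuousWithinAt, fun t ht => ?_⟩
    exact ((hk t (Ioc_subset_Icc_self ht)).prodMk (hk' t (Ioc_subset_Icc_self ht))).mono_of_mem_nhdsWithin
      (Icc_mem_nhdsLE_of_mem ht)
  have h := ODE_solution_unique_of_mem_Icc_left (v := fun t z => (z.2, -R t z.1))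
    (s := fun _ => univ) hlip (hd hk hk').1 (hd hk hk').2 (fun _ _ => mem_univ _)
    (hd hl hl').1 (hd hl hl').2 (fun _ _ => mem_univ _) (Prod.ext h1 h1')
  exact fun t ht => congrArg Prod.fst (h ht)

section Jacobi

variable {Ω : Set (E)} {G : E → E →L[ℝ] E}
  {Γ : E → E →L[ℝ] E →L[ℝ] E} {x p : ℝ → E} {B R : ℝ → E →L[ℝ] E}

/-- In normal coordinates around the end point of the geodesic `x(t) = (1 - t) w₀`, the field
`(1 - t) a` solves the linearized geodesic equation, for every vector `a`: this is the derivative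
with respect to `w` of the equation `Γ_{tw}(w, w) = 0` of the radial geodesics. -/
theorem normal_linearized {ρ : ℝ} (hΓ : IsLeviCivitaOn Ω G Γ)
    (hrad : ∀ w : E, ‖w‖ < ρ → ∀ t ∈ Icc (0 : ℝ) 1, t • w ∈ Ω ∧ Γ (t • w) w w = 0)
    {w₀ : E} (hw₀ : ‖w₀‖ < ρ) {t : ℝ} (ht : t ∈ Icc (0 : ℝ) 1) (a : E) :
    fderiv ℝ Γ (t • w₀) (t • a) w₀ w₀ + 2 • Γ (t • w₀) w₀ a = 0 := by
  have hd := (hΓ.differentiableAt_conn (hrad w₀ hw₀ t ht).1).hasFDerivAt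
  have h0 : HasFDerivAt (fun w : E => t • w) (t • ContinuousLinearMap.id ℝ (E)) w₀ :=
    (hasFDerivAt_id w₀).const_smul t
  have h1 : HasFDerivAt (fun w : E => Γ (t • w))
      ((fderiv ℝ Γ (t • w₀)).comp (t • ContinuousLinearMap.id ℝ (E))) w₀ :=
    HasFDerivAt.comp (g := Γ) w₀ hd h0
  have h2 := (h1.clm_apply (hasFDerivAt_id w₀)).clm_apply (hasFDerivAt_id w₀)
  have h3 : HasFDerivAt (fun w : E => Γ (t • w) w w) (0 : E →L[ℝ] E) w₀ := by
    refine (hasFDerivAt_const (0 : E) w₀).congr_of_eventuallyEq ?_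
    have : ∀ᶠ w in 𝓝 w₀, ‖w‖ < ρ := continuous_norm.continuousAt.eventually_lt_const hw₀
    filter_upwards [this] with w hw using (hrad w hw t ht).2
  have h4 := congrArg (fun L => L a) (h2.unique h3)
  simp only [add_apply, ContinuousLinearMap.comp_apply, ContinuousLinearMap.flip_apply,
    smul_apply, ContinuousLinearMap.id_apply, zero_apply, id_eq] at h4
  rw [hΓ.torsionFree _ (hrad w₀ hw₀ t ht).1 a w₀] at h4
  rw [← h4, two_smul]
  abel

/-- If the geodesic is radial in normal coordinates around its end point, the Jacobi field `f`
is `(1 - t) B(t)⁻¹ B(1)`. -/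
theorem IsFrameAlong.isJacobiFactorization {ρ : ℝ} (h : IsFrameAlong Ω G Γ x p B R)
    (hrad : ∀ w : E, ‖w‖ < ρ → ∀ t ∈ Icc (0 : ℝ) 1, t • w ∈ Ω ∧ Γ (t • w) w w = 0)
    {w₀ : E} (hw₀ : ‖w₀‖ < ρ) (hx : ∀ t ∈ Icc (0 : ℝ) 1, x t = (1 - t) • w₀)
    (hp : ∀ t ∈ Icc (0 : ℝ) 1, p t = -w₀) {f f' : ℝ → E →L[ℝ] E}
    (hf : ∀ t ∈ Icc (0 : ℝ) 1, HasDerivWithinAt f (f' t) (Icc 0 1) t)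
    (hf' : ∀ t ∈ Icc (0 : ℝ) 1, ∀ v, HasDerivWithinAt (fun s => f' s v) (-R t (f t v)) (Icc 0 1) t)
    (hf1 : f 1 = 0) (hf1' : f' 1 = -1) :
    IsJacobiFactorization R f f'
      (fun t => (ContinuousLinearMap.adjoint (B t) ∘L G (x t)) ∘L B 1)
      (fun t => (ContinuousLinearMap.adjoint (B 1) ∘L G (x 1)) ∘L B t) := by
  have h1I : (1 : ℝ) ∈ Icc (0 : ℝ) 1 := one_mem_unitInterval
  have hadj : ContinuousOn (fun t => ContinuousLinearMap.adjoint (B t)) (Icc 0 1) :=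
    (ContinuousLinearMap.adjoint (𝕜 := ℝ) (E := E) (F := E)).continuous.comp_continuousOn
      h.continuousOn_B
  -- the field `J = (1 - t) B(1) v` and its covariant derivative
  have hJ : ∀ v t, HasDerivWithinAt (fun t : ℝ => (1 - t) • B 1 v) (-B 1 v) (Icc 0 1) t :=
    fun v t => by
      simpa using ((hasDerivWithinAt_id t (Icc (0 : ℝ) 1)).const_sub 1).smul_const (B 1 v)
  have hDJ : ∀ v, ∀ t ∈ Icc (0 : ℝ) 1, HasDerivWithinAt
      (fun r => -B 1 v + Γ (x r) (p r) ((1 - r) • B 1 v))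
      (-curv Γ (x t) ((1 - t) • B 1 v) (p t) (p t)
        - Γ (x t) (p t) (-B 1 v + Γ (x t) (p t) ((1 - t) • B 1 v))) (Icc 0 1) t := by
    intro v t ht
    refine linearized_geodesic (J' := fun _ => -B 1 v) (J'' := 0)
      (h.leviCivita.differentiableAt_conn (h.mem t ht)) (h.leviCivita.torsionFree _ (h.mem t ht))
      (h.leviCivita.fderiv_conn_symm (h.mem t ht)) (h.deriv t ht) (h.geodesic t ht) (hJ v t)
      (hasDerivWithinAt_const _ _ _) ?_
    have h3 := normal_linearized h.leviCivita hrad hw₀ (t := 1 - t)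
      ⟨by linarith [ht.2], by linarith [ht.1]⟩ (B 1 v)
    rw [hx t ht, hp t ht]
    simp only [zero_add, map_neg, neg_apply, neg_neg]
    exact h3
  set F : ℝ → E →L[ℝ] E := fun t =>
    (1 - t) • ((ContinuousLinearMap.adjoint (B t) ∘L G (x t)) ∘L B 1) with hF
  set F' : ℝ → E → E := fun t v => ContinuousLinearMap.adjoint (B t)
    (G (x t) (-B 1 v + Γ (x t) (p t) ((1 - t) • B 1 v))) with hF'
  have hFin : ∀ t v w, inner ℝ (F t v) w = inner ℝ (G (x t) ((1 - t) • B 1 v)) (B t w) := by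
    intro t v w
    simp only [hF, smul_apply, ContinuousLinearMap.comp_apply, inner_smul_left,
      ContinuousLinearMap.adjoint_inner_left, map_smul]
  have hBF : ∀ t ∈ Icc (0 : ℝ) 1, ∀ v, B t (F t v) = (1 - t) • B 1 v := by
    intro t ht v
    have h3 := congrArg (fun L => L (B 1 v)) (h.comp_adjoint ht)
    simp only [hF, smul_apply, map_smul]
    exact congrArg _ h3
  have hd1 : ∀ v, ∀ t ∈ Icc (0 : ℝ) 1, HasDerivWithinAt (fun s => F s v) (F' t v) (Icc 0 1) t := by
    intro v t ht
    refine hasDerivWithinAt_of_inner fun w => ?_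
    have h3 := h.leviCivita.hasDerivWithinAt_inner (h.mem t ht) (h.deriv t ht) (hJ v t)
      (h.parallel t ht w)
    simp only [hFin]
    refine h3.congr_deriv ?_
    rw [hF', ContinuousLinearMap.adjoint_inner_left]
    simp
  have hd2 : ∀ v, ∀ t ∈ Icc (0 : ℝ) 1,
      HasDerivWithinAt (fun s => F' s v) (-R t (F t v)) (Icc 0 1) t := by
    intro v t ht
    refine hasDerivWithinAt_of_inner fun w => ?_
    have h3 := h.leviCivita.hasDerivWithinAt_inner (h.mem t ht) (h.deriv t ht) (hDJ v t ht)
      (h.parallel t ht w)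
    simp only [hF', ContinuousLinearMap.adjoint_inner_left]
    refine h3.congr_deriv ?_
    rw [inner_neg_left, h.inner_R ht, hBF t ht]
    simp
  have hfF : ∀ t ∈ Icc (0 : ℝ) 1, f t = F t := by
    intro t ht
    ext1 v
    refine jacobi_unique h.continuousOn_R (k := fun t => f t v) (k' := fun t => f' t v)
      (l := fun t => F t v) (l' := fun t => F' t v) (fun s hs => ?_) (fun s hs => hf' s hs v)
      (hd1 v) (hd2 v) ?_ ?_ ht
    · simpa using (hf s hs).clm_apply (hasDerivWithinAt_const s _ v)
    · simp [hf1, hF]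
    · have h3 := congrArg (fun L => L v) (h.adjoint_comp h1I)
      simp only [ContinuousLinearMap.comp_apply, one_apply_eq_self] at h3
      simp [hf1', hF', h3]
  refine ⟨h.continuousOn_R, fun t ht => h.R_symm ht, hf, fun t ht =>
    hasDerivWithinAt_clm_of_apply fun v => hf' t ht v, hfF, ?_, ?_, fun t ht => ?_,
    fun t ht => ?_⟩
  · exact (hadj.clm_comp h.continuousOn_G).clm_comp continuousOn_const
  · exact continuousOn_const.clm_comp h.continuousOn_B
  · have e1 := h.comp_adjoint h1I
    have e2 := h.adjoint_comp ht
    simp only [← ContinuousLinearMap.mul_def] at e1 e2 ⊢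
    rw [mul_assoc, ← mul_assoc (B 1), e1, one_mul, e2]
  · have e1 := h.comp_adjoint ht
    have e2 := h.adjoint_comp h1I
    simp only [← ContinuousLinearMap.mul_def] at e1 e2 ⊢
    rw [mul_assoc, ← mul_assoc (B t), e1, one_mul, e2]

end Jacobi

end Frames

/-! ### The minimal geodesic in charts -/

section MinimalGeodesic

set_option synthInstance.maxHeartbeats 200000
set_option linter.unusedSectionVars false

variable {n : ℕ} {M : Type*} [MetricSpace M] [ChartedSpace (Vec n) M] [IsManifold (𝓡 n) ∞ M]
  [RiemannianBundle (fun x : M => TangentSpace (𝓡 n) x)]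
  [IsContMDiffRiemannianBundle (𝓡 n) ∞ (Vec n) (fun x : M => TangentSpace (𝓡 n) x)]
  {e : OpenPartialHomeomorph M (Vec n)} {c : ℝ → M}
  {u : ∀ t, Vec n ≃ₗᵢ[ℝ] TangentSpace (𝓡 n) (c t)}

theorem chartDiff_add (e : OpenPartialHomeomorph M (Vec n)) (x : M) (v w : TangentSpace (𝓡 n) x) :
    chartDiff e x (v + w) = chartDiff e x v + chartDiff e x w :=
  map_add (mfderiv (𝓡 n) (𝓡 n) e x) v w

theorem chartDiff_smul (e : OpenPartialHomeomorph M (Vec n)) (x : M) (a : ℝ)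
    (v : TangentSpace (𝓡 n) x) : chartDiff e x (a • v) = a • chartDiff e x v :=
  map_smul (mfderiv (𝓡 n) (𝓡 n) e x) a v

theorem curv_add {E : Type*} [NormedAddCommGroup E] [InnerProductSpace ℝ E]
    (Γ : E → E →L[ℝ] E →L[ℝ] E) (y a a' b w : E) :
    curv Γ y (a + a') b w = curv Γ y a b w + curv Γ y a' b w := by
  simp only [curv, map_add, add_apply]
  abel

theorem curv_smul {E : Type*} [NormedAddCommGroup E] [InnerProductSpace ℝ E]
    (Γ : E → E →L[ℝ] E →L[ℝ] E) (y : E) (r : ℝ) (a b w : E) :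
    curv Γ y (r • a) b w = r • curv Γ y a b w := by
  simp only [curv, map_smul, smul_apply, smul_sub, smul_add]

theorem curvature_add (x : M) (a a' b w : TangentSpace (𝓡 n) x) :
    curvature x (a + a') b w = curvature x a b w + curvature x a' b w := by
  have hc : chartAt (Vec n) x ∈ IsManifold.maximalAtlas (𝓡 n) ∞ M :=
    IsManifold.chart_mem_maximalAtlas _
  have hxc := mem_chart_source (Vec n) x
  have h := chartDiff_curvature hc hxc (a + a') b w
  rw [chartDiff_add, curv_add] at h
  refine chartDiff_injective hc hxc (h.trans ?_)
  rw [chartDiff_add, chartDiff_curvature hc hxc, chartDiff_curvature hc hxc]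

theorem curvature_smul (x : M) (r : ℝ) (a b w : TangentSpace (𝓡 n) x) :
    curvature x (r • a) b w = r • curvature x a b w := by
  have hc : chartAt (Vec n) x ∈ IsManifold.maximalAtlas (𝓡 n) ∞ M :=
    IsManifold.chart_mem_maximalAtlas _
  have hxc := mem_chart_source (Vec n) x
  have h := chartDiff_curvature hc hxc (r • a) b w
  rw [chartDiff_smul, curv_smul] at h
  refine chartDiff_injective hc hxc (h.trans ?_)
  rw [chartDiff_smul, chartDiff_curvature hc hxc]

/-- The curvature `R(t)` along `c` as a bounded operator. -/
def curvatureOp (c : ℝ → M) (u : ∀ t, Vec n ≃ₗᵢ[ℝ] TangentSpace (𝓡 n) (c t)) (t : ℝ) :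
    Vec n →L[ℝ] Vec n :=
  LinearMap.toContinuousLinearMap
    { toFun := curvatureAlong c u t
      map_add' := fun v w => by simp only [curvatureAlong, map_add, curvature_add]
      map_smul' := fun r v => by
        simp only [curvatureAlong, map_smul, curvature_smul, RingHom.id_apply] }

theorem curvatureOp_apply (c : ℝ → M) (u : ∀ t, Vec n ≃ₗᵢ[ℝ] TangentSpace (𝓡 n) (c t)) (t : ℝ)
    (v : Vec n) : curvatureOp c u t v = curvatureAlong c u t v := rfl

/-- The frame `u` in the coordinates `e`. -/
def frameOp (e : OpenPartialHomeomorph M (Vec n)) (c : ℝ → M)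
    (u : ∀ t, Vec n ≃ₗᵢ[ℝ] TangentSpace (𝓡 n) (c t)) (t : ℝ) : Vec n →L[ℝ] Vec n :=
  LinearMap.toContinuousLinearMap
    { toFun := fun v => chartDiff e (c t) (u t v)
      map_add' := fun v w => by rw [map_add, chartDiff_add]
      map_smul' := fun r v => by rw [map_smul, chartDiff_smul, RingHom.id_apply] }

theorem frameOp_apply (e : OpenPartialHomeomorph M (Vec n)) (c : ℝ → M)
    (u : ∀ t, Vec n ≃ₗᵢ[ℝ] TangentSpace (𝓡 n) (c t)) (t : ℝ) (v : Vec n) :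
    frameOp e c u t v = chartDiff e (c t) (u t v) := rfl

theorem isFrameAlong_chart (hc : IsGeodesic (n := n) c) (hu : IsParallelFrame c u)
    (he : e ∈ IsManifold.maximalAtlas (𝓡 n) ∞ M) (hce : MapsTo c (Icc 0 1) e.source) :
    IsFrameAlong e.target (metricOp e) (christoffelCLM e) (e ∘ c)
      (derivWithin (e ∘ c) (Icc 0 1)) (frameOp e c u) (curvatureOp c u) where
  leviCivita := isLeviCivitaOn_chart he
  mem t ht := e.map_source (hce ht)
  deriv t ht := hc.hasDerivWithinAt he ht (hce ht)
  geodesic t ht := by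
    rw [christoffelCLM_apply]
    exact (hc.2 e he t ht (hce ht)).2
  parallel t ht v := by
    rw [christoffelCLM_apply]
    exact hu e he t ht (hce ht) v
  isometry t ht v w := by
    rw [frameOp_apply, frameOp_apply, Function.comp_apply, inner_metricOp_chartDiff he (hce ht),
      LinearIsometryEquiv.inner_map_map]
  curvature t ht v := by
    rw [frameOp_apply, curvatureOp_apply, curvatureAlong, LinearIsometryEquiv.apply_symm_apply,
      chartDiff_curvature he (hce ht), hc.chartDiff_velocity he ht (hce ht), frameOp_apply,
      Function.comp_apply]

/-- A minimal geodesic that is shorter than the injectivity radius at its end point lies in a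
chart of normal coordinates around the end point, in which it is a ray. -/
theorem exists_chart_of_lt_injectivityRadius {x₀ y₀ : M}
    (u : ∀ t, Vec n ≃ₗᵢ[ℝ] TangentSpace (𝓡 n) (c t))
    (hinj : edist x₀ y₀ < injectivityRadius (n := n) y₀)
    (hc : IsMinimalGeodesic (n := n) c x₀ y₀) :
    ∃ e ∈ IsManifold.maximalAtlas (𝓡 n) ∞ M, MapsTo c (Icc 0 1) e.source ∧
      ∃ (ρ : ℝ) (w₀ : Vec n), ‖w₀‖ < ρ ∧
      (∀ w : Vec n, ‖w‖ < ρ → ∀ t ∈ Icc (0 : ℝ) 1,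
        t • w ∈ e.target ∧ christoffelCLM e (t • w) w w = 0) ∧
      (∀ t ∈ Icc (0 : ℝ) 1, (e ∘ c) t = (1 - t) • w₀) ∧
      ∀ t ∈ Icc (0 : ℝ) 1, derivWithin (e ∘ c) (Icc 0 1) t = -w₀ := by
  obtain ⟨hgeo, rfl, rfl, hlen⟩ := hc
  rw [injectivityRadius, lt_iSup_iff] at hinj
  obtain ⟨ρ, hinj⟩ := hinj
  rw [lt_iSup_iff] at hinj
  obtain ⟨⟨Φ, hsrc, hΦ⟩, hρ⟩ := hinj
  obtain ⟨e, he, hray, hrad⟩ := exists_normalChart (u 1) Φ hsrc hΦ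
  -- the reversed geodesic
  obtain ⟨hγ, -⟩ := hgeo.comp_affine 1 (-1) (fun s hs => by
    constructor <;> simp only [neg_mul, one_mul] <;> linarith [hs.1, hs.2])
  have hpt : (fun s => c (1 + -1 * s)) 0 = c 1 := by simp
  set γ : ℝ → M := fun s => c (1 + -1 * s) with hγdef
  set v : TangentSpace (𝓡 n) (c 1) := hpt ▸ velocity γ 0 with hv
  have h0 : (⟨γ 0, velocity γ 0⟩ : TangentBundle (𝓡 n) M) = ⟨c 1, v⟩ := by
    have key : ∀ (x : M) (hx : γ 0 = x) (a : TangentSpace (𝓡 n) (γ 0)),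
        (⟨γ 0, a⟩ : TangentBundle (𝓡 n) M) = ⟨x, hx ▸ a⟩ := by
      rintro _ rfl a; rfl
    exact key _ hpt _
  have hnorm : ∀ (x : M) (a : TangentSpace (𝓡 n) x),
      (⟨γ 0, velocity γ 0⟩ : TangentBundle (𝓡 n) M) = ⟨x, a⟩ →
      ‖velocity (n := n) γ 0‖ = ‖a‖ := by
    intro x a h
    exact congrArg (fun z : TangentBundle (𝓡 n) M => ‖z.2‖) h
  have hspeed : ‖velocity (n := n) γ 0‖ = ‖velocity (n := n) c 0‖ := by
    rw [← hgeo.norm_velocity one_mem_unitInterval]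
    have hchart : chartAt (Vec n) (c 1) ∈ IsManifold.maximalAtlas (𝓡 n) ∞ M :=
      IsManifold.chart_mem_maximalAtlas _
    have hcs := mem_chart_source (Vec n) (c 1)
    obtain ⟨-, hder⟩ := hgeo.comp_affine 1 (-1) (fun s hs => by
      constructor <;> simp only [neg_mul, one_mul] <;> linarith [hs.1, hs.2])
    have h1 := hγ.initial_eq (v := -velocity (n := n) c 1) hchart hpt hcs (by
      rw [hder _ hchart 0 zero_mem_unitInterval (by simp [hcs])]
      simp only [mul_zero, add_zero]
      rw [← hgeo.chartDiff_velocity hchart one_mem_unitInterval hcs, ← chartDiff_smul]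
      rw [neg_one_smul])
    rw [hnorm _ _ h1, norm_neg]
  have hvρ : ‖(u 1).symm v‖ < ρ := by
    rw [LinearIsometryEquiv.norm_map, ← hnorm _ _ h0, hspeed]
    rw [← hlen, hgeo.pathELength] at hρ
    exact (ENNReal.ofReal_lt_ofReal_iff_of_nonneg (norm_nonneg _)).1 hρ
  have h3 := hray γ hγ ((u 1).symm v) hvρ (by rw [LinearIsometryEquiv.apply_symm_apply]; exact h0)
  have hcγ : ∀ t : ℝ, c t = γ (1 - t) := fun t => by simp [hγdef]
  have hflip : ∀ t ∈ Icc (0 : ℝ) 1, 1 - t ∈ Icc (0 : ℝ) 1 := fun t ht =>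
    ⟨by linarith [ht.2], by linarith [ht.1]⟩
  have hline : ∀ t ∈ Icc (0 : ℝ) 1, (e ∘ c) t = (1 - t) • (u 1).symm v := fun t ht => by
    rw [Function.comp_apply, hcγ t, (h3 _ (hflip t ht)).2]
  refine ⟨e, he, fun t ht => by rw [hcγ t]; exact (h3 _ (hflip t ht)).1, ρ, (u 1).symm v, hvρ, hrad,
    hline, fun t ht => ?_⟩
  have h4 : HasDerivWithinAt (fun t : ℝ => (1 - t) • (u 1).symm v) (-(u 1).symm v) (Icc 0 1) t := by
    refine (((hasDerivWithinAt_id t (Icc (0 : ℝ) 1)).const_sub 1).smul_const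
      ((u 1).symm v)).congr_deriv ?_
    rw [neg_one_smul]
  exact (h4.congr hline (hline t ht)).derivWithin (uniqueDiffWithinAt_unitInterval ht)

/-- Below the injectivity radius the Jacobi field `f` is `1 - t` times an invertible factor: read in
normal coordinates around `y₀`, its columns are the variations `(1 - t) w` of a ray. -/
theorem exists_isJacobiFactorization {x₀ y₀ : M}
    (hinj : edist x₀ y₀ < injectivityRadius (n := n) y₀)
    (hc : IsMinimalGeodesic (n := n) c x₀ y₀) (hu : IsParallelFrame c u)
    {f f' : ℝ → Vec n →L[ℝ] Vec n} (hf : IsJacobiSolution (curvatureAlong c u) f f') :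
    ∃ A D, IsJacobiFactorization (curvatureOp c u) f f' A D := by
  obtain ⟨e, he, hce, ρ, w₀, hw₀, hrad, hx, hp⟩ := exists_chart_of_lt_injectivityRadius u hinj hc
  exact ⟨_, _, (isFrameAlong_chart hc.1 hu he hce).isJacobiFactorization hrad hw₀ hx hp
    hf.deriv_eq (fun t ht v => hf.jacobi t ht v) hf.terminal hf.terminal_deriv⟩

end MinimalGeodesic

/-! ### Absolutely continuous functions -/

section AbsolutelyContinuous

open AbsolutelyContinuousOnInterval in
/-- A function whose increments are dominated by those of an absolutely continuous one is absolutely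
continuous. -/
theorem absolutelyContinuousOnInterval_of_dist_le {X : Type*} [PseudoMetricSpace X] {f : ℝ → X}
    {m : ℝ → ℝ} {a b : ℝ} (hm : AbsolutelyContinuousOnInterval m a b)
    (h : ∀ x ∈ uIcc a b, ∀ y ∈ uIcc a b, dist (f x) (f y) ≤ dist (m x) (m y)) :
    AbsolutelyContinuousOnInterval f a b := by
  rw [absolutelyContinuousOnInterval_iff] at hm ⊢
  intro ε hε
  obtain ⟨δ, hδ, H⟩ := hm ε hε
  refine ⟨δ, hδ, fun I hI hI' => (Finset.sum_le_sum fun i hi => ?_).trans_lt (H I hI hI')⟩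
  exact h _ (hI.1 i hi).1 _ (hI.1 i hi).2

variable {F G H : Type*} [NormedAddCommGroup F] [NormedSpace ℝ F] [NormedAddCommGroup G]
  [NormedSpace ℝ G] [NormedAddCommGroup H] [NormedSpace ℝ H]

theorem absolutelyContinuousOnInterval_primitive {φ : ℝ → F} {a b : ℝ}
    (h : IntervalIntegrable φ volume a b) :
    AbsolutelyContinuousOnInterval (fun t => ∫ s in a..t, φ s) a b := by
  refine absolutelyContinuousOnInterval_of_dist_le (m := fun t => ∫ s in a..t, ‖φ s‖)
    (h.norm.absolutelyContinuousOnInterval_intervalIntegral left_mem_uIcc) fun x hx y hy => ?_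
  have hi : ∀ z ∈ uIcc a b, IntervalIntegrable φ volume a z := fun z hz =>
    h.mono_set (uIcc_subset_uIcc_left hz)
  rw [dist_eq_norm, dist_eq_norm, intervalIntegral.integral_interval_sub_left (hi x hx) (hi y hy),
    intervalIntegral.integral_interval_sub_left (hi x hx).norm (hi y hy).norm, Real.norm_eq_abs]
  exact intervalIntegral.norm_integral_le_abs_integral_norm

/-- A bounded bilinear map applied to two absolutely continuous functions is absolutely
continuous. -/
theorem AbsolutelyContinuousOnInterval.clm_apply₂ (L : F →L[ℝ] G →L[ℝ] H) {f : ℝ → F} {g : ℝ → G}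
    {a b : ℝ} (hf : AbsolutelyContinuousOnInterval f a b)
    (hg : AbsolutelyContinuousOnInterval g a b) :
    AbsolutelyContinuousOnInterval (fun t => L (f t) (g t)) a b := by
  obtain ⟨C, hC⟩ := hf.exists_bound
  obtain ⟨D, hD⟩ := hg.exists_bound
  rw [absolutelyContinuousOnInterval_iff] at hf hg ⊢
  intro ε hε
  set K := ‖L‖ * (|C| + |D|) + 1 with hK
  have hK0 : 0 < K := by positivity
  obtain ⟨δ₁, hδ₁, H₁⟩ := hf (ε / (2 * K)) (by positivity)
  obtain ⟨δ₂, hδ₂, H₂⟩ := hg (ε / (2 * K)) (by positivity)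
  refine ⟨min δ₁ δ₂, lt_min hδ₁ hδ₂, fun I hI hI' => ?_⟩
  have h1 := H₁ I hI (hI'.trans_le (min_le_left _ _))
  have h2 := H₂ I hI (hI'.trans_le (min_le_right _ _))
  have key : ∀ x ∈ uIcc a b, ∀ y ∈ uIcc a b, dist (L (f x) (g x)) (L (f y) (g y)) ≤
      K * (dist (f x) (f y) + dist (g x) (g y)) := by
    intro x hx y hy
    have e1 : L (f x) (g x) - L (f y) (g y) = L (f x) (g x - g y) + L (f x - f y) (g y) := by
      simp only [map_sub, sub_apply]; abel
    rw [dist_eq_norm, dist_eq_norm, dist_eq_norm, e1]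
    refine (norm_add_le _ _).trans ((add_le_add (L.le_opNorm₂ _ _) (L.le_opNorm₂ _ _)).trans ?_)
    have b1 : ‖f x‖ ≤ |C| := (hC x hx).trans (le_abs_self C)
    have b2 : ‖g y‖ ≤ |D| := (hD y hy).trans (le_abs_self D)
    have c1 : ‖L‖ * ‖f x‖ * ‖g x - g y‖ ≤ ‖L‖ * |C| * ‖g x - g y‖ := by gcongr
    have c2 : ‖L‖ * ‖f x - f y‖ * ‖g y‖ ≤ ‖L‖ * ‖f x - f y‖ * |D| := by gcongr
    have c3 : 0 ≤ ‖L‖ * |D| * ‖g x - g y‖ := by positivity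
    have c4 : 0 ≤ ‖L‖ * |C| * ‖f x - f y‖ := by positivity
    have c5 : 0 ≤ ‖f x - f y‖ := norm_nonneg _
    have c6 : 0 ≤ ‖g x - g y‖ := norm_nonneg _
    rw [hK]
    nlinarith
  refine (Finset.sum_le_sum fun i hi => key _ (hI.1 i hi).1 _ (hI.1 i hi).2).trans_lt ?_
  rw [← Finset.mul_sum, Finset.sum_add_distrib]
  calc K * _ < K * (ε / (2 * K) + ε / (2 * K)) := by gcongr
    _ = ε := by field_simp; ring

theorem absolutelyContinuousOnInterval_of_hasDerivWithinAt {f f' : ℝ → F} {a b : ℝ} (hab : a ≤ b)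
    (hf : ∀ t ∈ Icc a b, HasDerivWithinAt f (f' t) (Icc a b) t) (hf' : ContinuousOn f' (Icc a b)) :
    AbsolutelyContinuousOnInterval f a b := by
  obtain ⟨C, hC⟩ := isCompact_Icc.exists_bound_of_continuousOn hf'
  refine LipschitzOnWith.absolutelyContinuousOnInterval (K := C.toNNReal) ?_
  rw [uIcc_of_le hab]
  refine (convex_Icc a b).lipschitzOnWith_of_nnnorm_hasDerivWithin_le hf fun t ht => ?_
  rw [← NNReal.coe_le_coe, coe_nnnorm]
  exact (hC t ht).trans (Real.le_coe_toNNReal C)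

/-- The fundamental theorem of calculus for an absolutely continuous function whose derivative is
known almost everywhere. -/
theorem AbsolutelyContinuousOnInterval.integral_eq_sub {q q' : ℝ → ℝ} {a b : ℝ} (hab : a ≤ b)
    (hq : AbsolutelyContinuousOnInterval q a b)
    (hq' : ∀ᵐ t, t ∈ Ioo a b → HasDerivAt q (q' t) t) :
    IntervalIntegrable q' volume a b ∧ ∫ t in a..b, q' t = q b - q a := by
  have h : ∀ᵐ t, t ∈ uIoc a b → deriv q t = q' t := by
    have hb : ∀ᵐ t : ℝ, t ≠ b := by simp [ae_iff, measure_singleton]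
    filter_upwards [hq', hb] with t ht htb hmem
    rw [uIoc_of_le hab] at hmem
    exact (ht ⟨hmem.1, lt_of_le_of_ne hmem.2 htb⟩).deriv
  refine ⟨?_, ?_⟩
  · exact hq.intervalIntegrable_deriv.congr_ae ((ae_restrict_iff' measurableSet_uIoc).2 h)
  · rw [← hq.integral_deriv_eq_sub]
    refine intervalIntegral.integral_congr_ae ?_
    filter_upwards [h] with t ht hmem using (ht hmem).symm

/-- The primitive of an integrable function has it as derivative almost everywhere. -/
theorem ae_hasDerivAt_primitive [CompleteSpace F] {φ : ℝ → F} {a b : ℝ}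
    (h : IntervalIntegrable φ volume a b) :
    ∀ᵐ t, t ∈ Ioo a b → HasDerivAt (fun t => ∫ s in a..t, φ s) (φ t) t := by
  filter_upwards [h.ae_hasDerivAt_integral] with t ht htI
  exact ht (Icc_subset_uIcc (Ioo_subset_Icc_self htI)) a left_mem_uIcc

end AbsolutelyContinuous

/-! ### Operators on `L²([0,1])` -/

section Operators

variable {n : ℕ}

/-- The Lebesgue measure on `[0,1]`, as a measure on `ℝ`. -/
abbrev unitVolume : Measure ℝ := volume.restrict (Icc (0 : ℝ) 1)

instance : IsProbabilityMeasure unitVolume := ⟨by simp⟩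

theorem ae_unitVolume_Ioo : ∀ᵐ t ∂unitVolume, t ∈ Ioo (0 : ℝ) 1 := by
  rw [unitVolume, ← restrict_Ioo_eq_restrict_Icc]
  exact ae_restrict_mem measurableSet_Ioo

theorem integral_unitVolume {F : Type*} [NormedAddCommGroup F] [NormedSpace ℝ F] (g : ℝ → F) :
    ∫ t, g t ∂unitVolume = ∫ t in (0 : ℝ)..1, g t := by
  rw [intervalIntegral.integral_of_le zero_le_one, integral_Icc_eq_integral_Ioc]

/-- For `t ∈ [0,1]`, functions that agree almost everywhere on `[0,1]` have the same integrals
over subintervals. -/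
theorem integral_congr_unitVolume {F : Type*} [NormedAddCommGroup F] [NormedSpace ℝ F]
    {g h : ℝ → F} (hgh : g =ᵐ[unitVolume] h) {a b : ℝ} (ha : a ∈ Icc (0 : ℝ) 1)
    (hb : b ∈ Icc (0 : ℝ) 1) : ∫ t in a..b, g t = ∫ t in a..b, h t := by
  refine intervalIntegral.integral_congr_ae ?_
  filter_upwards [(ae_restrict_iff' measurableSet_Icc).1 hgh] with s hs hst
  rw [uIoc, mem_Ioc] at hst
  exact hs ⟨(le_min ha.1 hb.1).trans hst.1.le, hst.2.trans (max_le ha.2 hb.2)⟩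

section Ext

set_option linter.unusedSectionVars false

variable {F : Type*} [NormedAddCommGroup F] [NormedSpace ℝ F]

theorem norm_IccExtend_le (a : C(Icc (0 : ℝ) 1, F)) (t : ℝ) :
    ‖IccExtend zero_le_one a t‖ ≤ ‖a‖ := a.norm_coe_le_norm _

theorem memLp_IccExtend (p : ℝ≥0∞) (a : C(Icc (0 : ℝ) 1, F)) :
    MemLp (IccExtend (zero_le_one' ℝ) a) p unitVolume :=
  MemLp.of_bound (a.continuous.Icc_extend').aestronglyMeasurable ‖a‖
    (Filter.Eventually.of_forall fun t => norm_IccExtend_le a t)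

/-- The inclusion of the continuous functions on `[0,1]` into `L^p`. -/
def contToLp (F : Type*) [NormedAddCommGroup F] [NormedSpace ℝ F] (p : ℝ≥0∞) [Fact (1 ≤ p)] :
    C(Icc (0 : ℝ) 1, F) →L[ℝ] Lp F p unitVolume :=
  LinearMap.mkContinuous
    { toFun := fun a => (memLp_IccExtend p a).toLp
      map_add' := fun a b => by
        rw [← MemLp.toLp_add]; rfl
      map_smul' := fun r a => by
        rw [RingHom.id_apply, ← MemLp.toLp_const_smul]; rfl }
    1 (fun a => by
      have h := Lp.norm_le_of_ae_bound (f := (memLp_IccExtend p a).toLp) (norm_nonneg a) (by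
        filter_upwards [(memLp_IccExtend p a).coeFn_toLp] with t ht
        rw [ht]
        exact norm_IccExtend_le a t)
      simpa [measureUnivNNReal] using h)

theorem contToLp_coe (p : ℝ≥0∞) [Fact (1 ≤ p)] (a : C(Icc (0 : ℝ) 1, F)) :
    contToLp F p a =ᵐ[unitVolume] IccExtend (zero_le_one' ℝ) a :=
  (memLp_IccExtend p a).coeFn_toLp

end Ext

/-- Multiplication of `L²` functions by continuous operator valued functions. -/
def mulL2 (n : ℕ) : C(Icc (0 : ℝ) 1, Vec n →L[ℝ] Vec n) →L[ℝ] L2 n →L[ℝ] L2 n :=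
  (ContinuousLinearMap.holderL unitVolume ∞ 2 2
    (ContinuousLinearMap.id ℝ (Vec n →L[ℝ] Vec n))) ∘L contToLp (Vec n →L[ℝ] Vec n) ∞

theorem mulL2_coe (a : C(Icc (0 : ℝ) 1, Vec n →L[ℝ] Vec n)) (φ : L2 n) :
    mulL2 n a φ =ᵐ[unitVolume] fun t => IccExtend (zero_le_one' ℝ) a t (φ t) := by
  have h1 := (ContinuousLinearMap.id ℝ (Vec n →L[ℝ] Vec n)).coeFn_holder (r := 2)
    (contToLp (Vec n →L[ℝ] Vec n) ∞ a) φ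
  have h2 := contToLp_coe ∞ a
  filter_upwards [h1, h2] with t h1 h2
  rw [← h2]
  exact h1

theorem inner_eq_integral (φ ψ : L2 n) :
    inner ℝ φ ψ = ∫ t in (0 : ℝ)..1, inner ℝ (φ t) (ψ t) := by
  rw [L2.inner_def, integral_unitVolume]

theorem L2.intervalIntegrable_zero (φ : L2 n) {t : ℝ} (ht : t ∈ Icc (0 : ℝ) 1) :
    IntervalIntegrable φ volume 0 t :=
  L2.intervalIntegrable φ zero_mem_unitInterval ht

theorem continuousOn_prim (φ : L2 n) : ContinuousOn (prim φ) (Icc 0 1) := by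
  have h := (absolutelyContinuousOnInterval_primitive
    (L2.intervalIntegrable_zero φ one_mem_unitInterval)).continuousOn
  rwa [uIcc_of_le zero_le_one] at h

theorem norm_prim_le (φ : L2 n) {t : ℝ} (ht : t ∈ Icc (0 : ℝ) 1) : ‖prim φ t‖ ≤ ‖φ‖ := by
  have h1 : ‖prim φ t‖ ≤ ∫ s in (0 : ℝ)..t, ‖φ s‖ :=
    intervalIntegral.norm_integral_le_integral_norm ht.1
  have h2 : ∫ s in (0 : ℝ)..t, ‖φ s‖ ≤ ∫ s in (0 : ℝ)..1, ‖φ s‖ :=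
    intervalIntegral.integral_mono_interval le_rfl ht.1 ht.2
      (Filter.Eventually.of_forall fun _ => norm_nonneg _)
      (L2.intervalIntegrable_zero φ one_mem_unitInterval).norm
  refine (h1.trans h2).trans ?_
  rw [← integral_unitVolume, integral_norm_eq_lintegral_enorm (Lp.aestronglyMeasurable φ),
    ← eLpNorm_one_eq_lintegral_enorm, Lp.norm_def]
  exact ENNReal.toReal_mono (Lp.eLpNorm_ne_top φ)
    (eLpNorm_le_eLpNorm_of_exponent_le (by norm_num) (Lp.aestronglyMeasurable φ))

/-- The primitive `φ ↦ ∫₀^· φ` as a bounded operator from `L²` to the continuous functions. -/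
def primC (n : ℕ) : L2 n →L[ℝ] C(Icc (0 : ℝ) 1, Vec n) :=
  LinearMap.mkContinuous
    { toFun := fun φ => ⟨fun t => prim φ t, continuousOn_iff_continuous_domRestrict.1
        (continuousOn_prim φ)⟩
      map_add' := fun φ ψ => ContinuousMap.ext fun t => prim_add φ ψ t.2
      map_smul' := fun r φ => ContinuousMap.ext fun t => prim_smul r φ t.2 }
    1 (fun φ => by
      rw [one_mul]
      exact (ContinuousMap.norm_le _ (norm_nonneg _)).2 fun t => norm_prim_le φ t.2)

theorem ae_hasDerivAt_prim (φ : L2 n) : ∀ᵐ t, t ∈ Ioo (0 : ℝ) 1 → HasDerivAt (prim φ) (φ t) t :=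
  ae_hasDerivAt_primitive (L2.intervalIntegrable_zero φ one_mem_unitInterval)

theorem absolutelyContinuousOnInterval_prim (φ : L2 n) {b : ℝ} (hb : b ∈ Icc (0 : ℝ) 1) :
    AbsolutelyContinuousOnInterval (prim φ) 0 b :=
  absolutelyContinuousOnInterval_primitive (L2.intervalIntegrable_zero φ hb)

theorem L20.prim_one (φ : L20 n) : prim (φ : L2 n) 1 = 0 := φ.2

theorem prim_zero (φ : ℝ → Vec n) : prim φ 0 = 0 := intervalIntegral.integral_same

end Operators

/-! ### The operator `T` -/

section OperatorT

variable {n : ℕ}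

/-- The restriction of a function to `[0,1]`, as a continuous map. -/
def restrictC {F : Type*} [TopologicalSpace F] {f : ℝ → F} (hf : ContinuousOn f (Icc 0 1)) :
    C(Icc (0 : ℝ) 1, F) :=
  ⟨fun t => f t, continuousOn_iff_continuous_domRestrict.1 hf⟩

theorem IccExtend_restrictC {F : Type*} [TopologicalSpace F] {f : ℝ → F}
    (hf : ContinuousOn f (Icc 0 1)) {t : ℝ} (ht : t ∈ Icc (0 : ℝ) 1) :
    IccExtend (zero_le_one' ℝ) (restrictC hf) t = f t :=
  IccExtend_of_mem zero_le_one _ ht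

theorem contToLp_restrictC {F : Type*} [NormedAddCommGroup F] [NormedSpace ℝ F] {f : ℝ → F}
    (hf : ContinuousOn f (Icc 0 1)) (p : ℝ≥0∞) [Fact (1 ≤ p)] :
    contToLp F p (restrictC hf) =ᵐ[unitVolume] f := by
  filter_upwards [contToLp_coe p (restrictC hf), ae_restrict_mem measurableSet_Icc] with t h1 h2
  rw [h1, IccExtend_restrictC hf h2]

theorem mulL2_restrictC {f : ℝ → Vec n →L[ℝ] Vec n} (hf : ContinuousOn f (Icc 0 1)) (φ : L2 n) :
    mulL2 n (restrictC hf) φ =ᵐ[unitVolume] fun t => f t (φ t) := by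
  filter_upwards [mulL2_coe (restrictC hf) φ, ae_restrict_mem measurableSet_Icc] with t h1 h2
  rw [h1, IccExtend_restrictC hf h2]

/-- The Volterra operator `φ ↦ ∫₀^· φ` on `L²`. -/
def volterra (n : ℕ) : L2 n →L[ℝ] L2 n := contToLp (Vec n) 2 ∘L primC n

theorem volterra_coe (φ : L2 n) : volterra n φ =ᵐ[unitVolume] prim φ :=
  contToLp_restrictC (continuousOn_prim φ) 2

theorem inner_eq_integral_of_ae {φ ψ : L2 n} {f g : ℝ → Vec n} (hf : φ =ᵐ[unitVolume] f)
    (hg : ψ =ᵐ[unitVolume] g) :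
    inner ℝ φ ψ = ∫ t in (0 : ℝ)..1, inner ℝ (f t) (g t) := by
  rw [L2.inner_def, ← integral_unitVolume]
  refine integral_congr_ae ?_
  filter_upwards [hf, hg] with t h1 h2
  rw [h1, h2]

theorem intervalIntegrable_inner (φ ψ : L2 n) :
    IntervalIntegrable (fun t => (inner ℝ (φ t) (ψ t) : ℝ)) volume 0 1 := by
  rw [intervalIntegrable_iff_integrableOn_Icc_of_le zero_le_one]
  exact L2.integrable_inner φ ψ

theorem hasDerivAt_inner_clm {F : Type*} [NormedAddCommGroup F] [InnerProductSpace ℝ F]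
    {f g : ℝ → F} {f' g' : F} {t : ℝ}
    (hf : HasDerivAt f f' t) (hg : HasDerivAt g g' t) :
    HasDerivAt (fun s => innerSL ℝ (f s) (g s)) (inner ℝ (f t) g' + inner ℝ f' (g t)) t := by
  simpa using hf.inner ℝ hg

/-- Integration by parts for primitives of `L²` functions. -/
theorem inner_volterra_add (φ ψ : L2 n) :
    inner ℝ (volterra n φ) ψ + inner ℝ φ (volterra n ψ) = inner ℝ (prim φ 1) (prim ψ 1) := by
  have hac : AbsolutelyContinuousOnInterval (fun t => innerSL ℝ (prim φ t) (prim ψ t)) 0 1 :=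
    PathHessian.AbsolutelyContinuousOnInterval.clm_apply₂ (innerSL ℝ)
      (absolutelyContinuousOnInterval_prim φ one_mem_unitInterval)
      (absolutelyContinuousOnInterval_prim ψ one_mem_unitInterval)
  have h := (PathHessian.AbsolutelyContinuousOnInterval.integral_eq_sub
    (q' := fun t => inner ℝ (prim φ t) (ψ t) + inner ℝ (φ t) (prim ψ t)) zero_le_one hac (by
      filter_upwards [ae_hasDerivAt_prim φ, ae_hasDerivAt_prim ψ] with t h1 h2 ht
      exact hasDerivAt_inner_clm (h1 ht) (h2 ht))).2
  simp only [innerSL_apply_apply, prim_zero, inner_zero_left, sub_zero] at h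
  rw [← h, inner_eq_integral_of_ae (volterra_coe φ) (Filter.EventuallyEq.refl _ _),
    inner_eq_integral_of_ae (Filter.EventuallyEq.refl _ _) (volterra_coe ψ),
    intervalIntegral.integral_add]
  · rw [intervalIntegrable_iff_integrableOn_Icc_of_le zero_le_one]
    refine (L2.integrable_inner (𝕜 := ℝ) (volterra n φ) ψ).congr ?_
    filter_upwards [volterra_coe φ] with t ht
    rw [ht]
  · rw [intervalIntegrable_iff_integrableOn_Icc_of_le zero_le_one]
    refine (L2.integrable_inner (𝕜 := ℝ) φ (volterra n ψ)).congr ?_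
    filter_upwards [volterra_coe ψ] with t ht
    rw [ht]

variable {R : ℝ → Vec n →L[ℝ] Vec n}

/-- The function `t ↦ R(t) ∫₀ᵗ φ` as an element of `L²`. -/
def mulVolterra (hR : ContinuousOn R (Icc 0 1)) : L2 n →L[ℝ] L2 n :=
  mulL2 n (restrictC hR) ∘L volterra n

theorem mulVolterra_coe (hR : ContinuousOn R (Icc 0 1)) (φ : L2 n) :
    mulVolterra hR φ =ᵐ[unitVolume] fun t => R t (prim φ t) := by
  filter_upwards [mulL2_restrictC hR (volterra n φ), volterra_coe φ] with t h1 h2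
  rw [← h2]
  exact h1

/-- The operator `T` as the compression to `L²₀` of `-V* R V`, where `V` is the Volterra
operator. -/
def operatorT (hR : ContinuousOn R (Icc 0 1)) : L20 n →L[ℝ] L20 n :=
  -((volterra n ∘L (L20 n).subtypeL).adjoint ∘L (mulVolterra hR ∘L (L20 n).subtypeL))

theorem inner_operatorT (hR : ContinuousOn R (Icc 0 1)) (φ ψ : L20 n) :
    inner ℝ (operatorT hR φ) ψ = -inner ℝ (mulVolterra hR φ) (volterra n ψ) := by
  simp only [operatorT, neg_apply, inner_neg_left, ContinuousLinearMap.comp_apply,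
    ContinuousLinearMap.adjoint_inner_left]
  rfl

theorem inner_operatorT_eq_integral (hR : ContinuousOn R (Icc 0 1)) (φ ψ : L20 n) :
    inner ℝ (operatorT hR φ) ψ =
      -∫ t in (0 : ℝ)..1, inner ℝ (R t (prim (φ : L2 n) t)) (prim (ψ : L2 n) t) := by
  rw [inner_operatorT, inner_eq_integral_of_ae (mulVolterra_coe hR _) (volterra_coe _)]

theorem isSelfAdjoint_operatorT (hR : ContinuousOn R (Icc 0 1))
    (hs : ∀ t ∈ Icc (0 : ℝ) 1, ∀ v w, inner ℝ (R t v) w = (inner ℝ v (R t w) : ℝ)) :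
    IsSelfAdjoint (operatorT hR) := by
  rw [ContinuousLinearMap.isSelfAdjoint_iff_isSymmetric]
  intro φ ψ
  change inner ℝ (operatorT hR φ) ψ = inner ℝ φ (operatorT hR ψ)
  rw [real_inner_comm (operatorT hR ψ) φ, inner_operatorT_eq_integral, inner_operatorT_eq_integral]
  congr 1
  refine intervalIntegral.integral_congr fun t ht => ?_
  rw [uIcc_of_le zero_le_one] at ht
  rw [hs t ht, real_inner_comm]

theorem isOperatorT_operatorT (hR : ContinuousOn R (Icc 0 1)) :
    IsOperatorT (fun t => R t) (operatorT hR) := by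
  intro φ
  set ξ : L2 n := mulVolterra hR φ with hξ
  have hξi : ∀ {a b : ℝ}, a ∈ Icc (0 : ℝ) 1 → b ∈ Icc (0 : ℝ) 1 →
      ∫ s in a..b, R s (∫ r in (0 : ℝ)..s, (φ : L2 n) r) = prim ξ b - prim ξ a := by
    intro a b ha hb
    refine (integral_congr_unitVolume (mulVolterra_coe hR φ) ha hb).symm.trans ?_
    rw [prim, prim, intervalIntegral.integral_interval_sub_left (L2.intervalIntegrable_zero ξ hb)
      (L2.intervalIntegrable_zero ξ ha)]
  have hi : IntervalIntegrable (prim ξ) volume 0 1 := by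
    refine ContinuousOn.intervalIntegrable ?_
    rw [uIcc_of_le zero_le_one]
    exact continuousOn_prim ξ
  set k : Vec n := ∫ r in (0 : ℝ)..1, prim ξ r with hk
  have hcont : ContinuousOn (fun t => prim ξ t - k) (Icc 0 1) :=
    (continuousOn_prim ξ).sub continuousOn_const
  have hw := contToLp_restrictC hcont 2
  set w := contToLp (Vec n) 2 (restrictC hcont) with hwdef
  have hw0 : w ∈ L20 n := by
    change ∫ t in (0 : ℝ)..1, w t = 0
    rw [integral_congr_unitVolume hw zero_mem_unitInterval one_mem_unitInterval,
      intervalIntegral.integral_sub hi intervalIntegrable_const]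
    simp [hk]
  have key : operatorT hR φ = ⟨w, hw0⟩ := by
    refine ext_inner_right ℝ fun ψ => ?_
    have hp := inner_volterra_add ξ (ψ : L2 n)
    rw [L20.prim_one, inner_zero_right] at hp
    have hconst : ∫ t in (0 : ℝ)..1, (inner ℝ k ((ψ : L2 n) t) : ℝ) = 0 := by
      rw [← integral_unitVolume, integral_inner (L2.integrableOn _), integral_unitVolume]
      have : ∫ t in (0 : ℝ)..1, (ψ : L2 n) t = 0 := ψ.2
      rw [this, inner_zero_right]
    rw [inner_operatorT, ← hξ]
    change _ = inner ℝ w (ψ : L2 n)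
    rw [inner_eq_integral_of_ae hw (Filter.EventuallyEq.refl _ (ψ : L2 n))]
    simp only [inner_sub_left]
    rw [intervalIntegral.integral_sub, hconst, sub_zero,
      ← inner_eq_integral_of_ae (volterra_coe ξ) (Filter.EventuallyEq.refl _ (ψ : L2 n))]
    · linarith
    · rw [intervalIntegrable_iff_integrableOn_Icc_of_le zero_le_one]
      refine (L2.integrable_inner (𝕜 := ℝ) (volterra n ξ) (ψ : L2 n)).congr ?_
      filter_upwards [volterra_coe ξ] with t ht
      rw [ht]
    · rw [intervalIntegrable_iff_integrableOn_Icc_of_le zero_le_one]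
      exact (L2.integrableOn (ψ : L2 n)).const_inner k
  rw [key]
  filter_upwards [hw, ae_restrict_mem measurableSet_Icc] with t h1 ht
  change w t = _
  rw [h1, hξi ht one_mem_unitInterval]
  have : ∫ r in (0 : ℝ)..1, ∫ s in r..1, R s (∫ q in (0 : ℝ)..s, (φ : L2 n) q) =
      ∫ r in (0 : ℝ)..1, (prim ξ 1 - prim ξ r) := by
    refine intervalIntegral.integral_congr fun r hr => ?_
    rw [uIcc_of_le zero_le_one] at hr
    exact hξi hr one_mem_unitInterval
  rw [this, intervalIntegral.integral_sub intervalIntegrable_const hi, ← hk]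
  simp

end OperatorT

/-! ### The quotient of a primitive by the Jacobi field -/

section Quotient

open Filter

variable {n : ℕ}

theorem intervalIntegrable_norm_sq (φ : L2 n) :
    IntervalIntegrable (fun t => ‖φ t‖ ^ 2) volume 0 1 := by
  simpa only [real_inner_self_eq_norm_sq] using intervalIntegrable_inner φ φ

theorem norm_sq_eq_integral (φ : L2 n) : ‖φ‖ ^ 2 = ∫ t in (0 : ℝ)..1, ‖φ t‖ ^ 2 := by
  rw [← real_inner_self_eq_norm_sq, inner_eq_integral]
  simp only [real_inner_self_eq_norm_sq]

/-- The Cauchy–Schwarz inequality for the mean value over an interval. -/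
theorem norm_sq_integral_le {φ : ℝ → Vec n} {a b : ℝ} (hab : a < b)
    (h1 : IntervalIntegrable φ volume a b)
    (h2 : IntervalIntegrable (fun t => ‖φ t‖ ^ 2) volume a b) :
    ‖∫ t in a..b, φ t‖ ^ 2 ≤ (b - a) * ∫ t in a..b, ‖φ t‖ ^ 2 := by
  set m := ∫ t in a..b, φ t with hm
  set w : Vec n := (b - a)⁻¹ • m with hw
  have hba : 0 < b - a := sub_pos.2 hab
  have hin : IntervalIntegrable (fun t => (inner ℝ w (φ t) : ℝ)) volume a b :=
    ⟨h1.1.const_inner w, h1.2.const_inner w⟩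
  have e0 : ∫ t in a..b, (inner ℝ w (φ t) : ℝ) = inner ℝ w m := by
    rw [hm, intervalIntegral.integral_of_le hab.le, intervalIntegral.integral_of_le hab.le,
      integral_inner h1.1]
  have e1 : ∫ t in a..b, ‖φ t - w‖ ^ 2 =
      (∫ t in a..b, ‖φ t‖ ^ 2) - 2 * inner ℝ w m + (b - a) * ‖w‖ ^ 2 := by
    have : ∀ t, ‖φ t - w‖ ^ 2 = ‖φ t‖ ^ 2 - 2 * inner ℝ w (φ t) + ‖w‖ ^ 2 := fun t => by
      rw [norm_sub_sq_real, real_inner_comm]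
    simp only [this]
    rw [intervalIntegral.integral_add (h2.sub (hin.const_mul 2)) intervalIntegrable_const,
      intervalIntegral.integral_sub h2 (hin.const_mul 2), intervalIntegral.integral_const_mul, e0]
    simp
  have e2 : 0 ≤ ∫ t in a..b, ‖φ t - w‖ ^ 2 :=
    intervalIntegral.integral_nonneg hab.le fun t _ => by positivity
  rw [e1, hw, inner_smul_left, real_inner_self_eq_norm_sq, norm_smul, mul_pow, Real.norm_eq_abs,
    sq_abs] at e2
  have e3 : (starRingEnd ℝ) (b - a)⁻¹ = (b - a)⁻¹ := rfl
  rw [e3] at e2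
  have e4 : (b - a) * ((b - a)⁻¹ ^ 2 * ‖m‖ ^ 2) = (b - a)⁻¹ * ‖m‖ ^ 2 := by
    field_simp
  rw [e4] at e2
  have e5 : (b - a)⁻¹ * ‖m‖ ^ 2 ≤ ∫ t in a..b, ‖φ t‖ ^ 2 := by linarith
  calc ‖m‖ ^ 2 = (b - a) * ((b - a)⁻¹ * ‖m‖ ^ 2) := by field_simp
    _ ≤ _ := by gcongr

/-- The fundamental theorem of calculus for absolutely continuous functions with values in
`ℝⁿ`. -/
theorem AbsolutelyContinuousOnInterval.integral_vec_eq_sub {q q' : ℝ → Vec n} {a b : ℝ}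
    (hab : a ≤ b) (hq : AbsolutelyContinuousOnInterval q a b)
    (hi : IntervalIntegrable q' volume a b)
    (hq' : ∀ᵐ t, t ∈ Ioo a b → HasDerivAt q (q' t) t) :
    ∫ t in a..b, q' t = q b - q a := by
  refine ext_inner_left ℝ fun w => ?_
  have h := (PathHessian.AbsolutelyContinuousOnInterval.integral_eq_sub
    (q := fun t => innerSL ℝ w (q t)) (q' := fun t => inner ℝ w (q' t)) hab
    (PathHessian.AbsolutelyContinuousOnInterval.clm_apply₂ (innerSL ℝ)
      ((LipschitzWith.const w).lipschitzOnWith.absolutelyContinuousOnInterval) hq) (by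
        filter_upwards [hq'] with t ht htI
        exact (innerSL ℝ w).hasFDerivAt.comp_hasDerivAt t (ht htI))).2
  rw [inner_sub_right, ← innerSL_apply_apply ℝ w (q b), ← innerSL_apply_apply ℝ w (q a), ← h,
    intervalIntegral.integral_of_le hab, intervalIntegral.integral_of_le hab, integral_inner hi.1]

end Quotient

section Jacobi

open Filter

variable {E : Type*} [NormedAddCommGroup E] [InnerProductSpace ℝ E]
  {R f f' A D : ℝ → E →L[ℝ] E}

namespace IsJacobiFactorization

variable (J : IsJacobiFactorization R f f' A D)
include J

theorem inverse_eq {t : ℝ} (ht : t ∈ Ico (0 : ℝ) 1) :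
    IsUnit (f t) ∧ Ring.inverse (f t) = (1 - t)⁻¹ • D t := by
  have ht' := Ico_subset_Icc_self ht
  have h0 : (1 - t) ≠ 0 := (sub_pos.2 ht.2).ne'
  have h1 : f t * ((1 - t)⁻¹ • D t) = 1 := by
    rw [J.factor t ht', smul_mul_smul_comm, J.mul_inv t ht', mul_inv_cancel₀ h0, one_smul]
  have h2 : ((1 - t)⁻¹ • D t) * f t = 1 := by
    rw [J.factor t ht', smul_mul_smul_comm, J.inv_mul t ht', inv_mul_cancel₀ h0, one_smul]
  exact ⟨⟨⟨_, _, h1, h2⟩, rfl⟩, Ring.inverse_unit ⟨_, _, h1, h2⟩⟩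

theorem isUnit {t : ℝ} (ht : t ∈ Ico (0 : ℝ) 1) : IsUnit (f t) := (J.inverse_eq ht).1

theorem apply_inverse {t : ℝ} (ht : t ∈ Ico (0 : ℝ) 1) (v : E) :
    f t (Ring.inverse (f t) v) = v :=
  congrArg (fun a : E →L[ℝ] E => a v) (Ring.mul_inverse_cancel _ (J.isUnit ht))

theorem inverse_apply {t : ℝ} (ht : t ∈ Ico (0 : ℝ) 1) (v : E) :
    Ring.inverse (f t) (f t v) = v :=
  congrArg (fun a : E →L[ℝ] E => a v) (Ring.inverse_mul_cancel _ (J.isUnit ht))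

theorem hasDerivWithinAt_inverse [CompleteSpace E] {s : Set ℝ} {t : ℝ} (ht : t ∈ Ico (0 : ℝ) 1)
    (hs : s ⊆ Icc 0 1) :
    HasDerivWithinAt (fun t => Ring.inverse (f t))
      (-(Ring.inverse (f t) * f' t * Ring.inverse (f t))) s t := by
  obtain ⟨x, hx⟩ := J.isUnit ht
  have h1 := (hasFDerivAt_ringInverse (𝕜 := ℝ) x)
  rw [hx] at h1
  have h2 := h1.comp_hasDerivWithinAt t ((J.deriv t (Ico_subset_Icc_self ht)).mono hs)
  refine h2.congr_deriv ?_
  rw [← hx, Ring.inverse_unit]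
  rfl

theorem continuousOn_f : ContinuousOn f (Icc 0 1) := fun t ht =>
  (J.deriv t ht).continuousWithinAt

theorem continuousOn_f' : ContinuousOn f' (Icc 0 1) := fun t ht =>
  (J.jacobi t ht).continuousWithinAt

theorem continuousOn_inverse [CompleteSpace E] {b : ℝ} (hb : b ∈ Ico (0 : ℝ) 1) :
    ContinuousOn (fun t => Ring.inverse (f t)) (Icc 0 b) := fun _ ht =>
  (J.hasDerivWithinAt_inverse ⟨ht.1, ht.2.trans_lt hb.2⟩
    (Icc_subset_Icc_right hb.2.le)).continuousWithinAt

/-- The Wronskian of two Jacobi fields that vanish at `1` is zero. -/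
theorem wronskian {t : ℝ} (ht : t ∈ Icc (0 : ℝ) 1) (v w : E) :
    (inner ℝ (f' t v) (f t w) : ℝ) = inner ℝ (f t v) (f' t w) := by
  have hd : ∀ s ∈ Icc (0 : ℝ) 1, HasDerivWithinAt
      (fun s => (inner ℝ (f' s v) (f s w) - inner ℝ (f s v) (f' s w) : ℝ)) 0 (Icc 0 1) s := by
    intro s hs
    have ev : ∀ {g : ℝ → E →L[ℝ] E} {g' : E →L[ℝ] E}, HasDerivWithinAt g g' (Icc 0 1) s → ∀ z,
        HasDerivWithinAt (fun s => g s z) (g' z) (Icc 0 1) s := fun hg z =>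
      ((ContinuousLinearMap.apply ℝ E z).hasFDerivAt.comp_hasDerivWithinAt s hg)
    have h := ((ev (J.jacobi s hs) v).inner ℝ (ev (J.deriv s hs) w)).sub
      ((ev (J.deriv s hs) v).inner ℝ (ev (J.jacobi s hs) w))
    refine h.congr_deriv ?_
    simp only [neg_apply, ContinuousLinearMap.comp_apply, inner_neg_left,
      inner_neg_right, J.symm s hs]
    ring
  have h := Convex.norm_image_sub_le_of_norm_hasDerivWithin_le hd (C := 0) (fun _ _ => by simp)
    (convex_Icc 0 1) one_mem_unitInterval ht
  have h1 : f 1 = 0 := by rw [J.factor 1 one_mem_unitInterval]; simp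
  rw [zero_mul, norm_le_zero_iff] at h
  simp only [h1, zero_apply, inner_zero_left, inner_zero_right, sub_zero] at h
  exact sub_eq_zero.1 h

end IsJacobiFactorization

end Jacobi

/-! ### The operator `S` -/

section OperatorS

set_option synthInstance.maxHeartbeats 200000

open Filter

variable {n : ℕ} {R f f' A D : ℝ → Vec n →L[ℝ] Vec n}

/-- The function `t ↦ f(t)⁻¹ ∫₀ᵗ φ`. -/
def jacobiQuot (f : ℝ → Vec n →L[ℝ] Vec n) (φ : ℝ → Vec n) (t : ℝ) : Vec n :=
  Ring.inverse (f t) (prim φ t)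

/-- The function `t ↦ φ(t) - f'(t) f(t)⁻¹ ∫₀ᵗ φ`. -/
def jacobiDefect (f f' : ℝ → Vec n →L[ℝ] Vec n) (φ : ℝ → Vec n) (t : ℝ) : Vec n :=
  φ t - f' t (jacobiQuot f φ t)

theorem Ioo_subset_Ioo_of_mem {b : ℝ} (hb : b ∈ Ico (0 : ℝ) 1) : Ioo 0 b ⊆ Ioo 0 1 :=
  Ioo_subset_Ioo_right hb.2.le

theorem norm_apply_sq_le (a : Vec n →L[ℝ] Vec n) {C : ℝ} (h : ‖a‖ ≤ C) (v : Vec n) :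
    ‖a v‖ ^ 2 ≤ C ^ 2 * ‖v‖ ^ 2 := by
  rw [← mul_pow]
  exact pow_le_pow_left₀ (norm_nonneg _)
    ((a.le_opNorm v).trans (mul_le_mul_of_nonneg_right h (norm_nonneg _))) 2

/-- A nonnegative function on `[0,1)` with bounded integrals is integrable. -/
theorem intervalIntegrable_of_integral_le {g : ℝ → ℝ} {I : ℝ} (hg : ∀ t ∈ Ico (0 : ℝ) 1, 0 ≤ g t)
    (hi : ∀ b ∈ Ico (0 : ℝ) 1, IntervalIntegrable g volume 0 b)
    (hI : ∀ b ∈ Ico (0 : ℝ) 1, ∫ t in (0 : ℝ)..b, g t ≤ I) : IntervalIntegrable g volume 0 1 := by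
  rw [intervalIntegrable_iff_integrableOn_Ioc_of_le zero_le_one]
  have hb : ∀ k : ℕ, (1 - 1 / ((k : ℝ) + 1)) ∈ Ico (0 : ℝ) 1 := fun k => by
    have h1 : (0 : ℝ) < 1 / ((k : ℝ) + 1) := by positivity
    have h2 : 1 / ((k : ℝ) + 1) ≤ 1 := by
      rw [div_le_one (by positivity)]; linarith [(Nat.cast_nonneg k : (0 : ℝ) ≤ k)]
    exact ⟨by linarith, by linarith⟩
  refine integrableOn_Ioc_of_intervalIntegral_norm_bounded_right (l := atTop) (I := I)
    (b := fun k : ℕ => 1 - 1 / ((k : ℝ) + 1)) (fun k => ?_) ?_ (Eventually.of_forall fun k => ?_)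
  · exact (intervalIntegrable_iff_integrableOn_Ioc_of_le (hb k).1).1 (hi _ (hb k))
  · simpa using (tendsto_const_nhds (x := (1 : ℝ))).sub tendsto_one_div_add_atTop_nhds_zero_nat
  · refine le_trans (le_of_eq ?_) (hI _ (hb k))
    rw [intervalIntegral.integral_of_le (hb k).1]
    refine setIntegral_congr_fun measurableSet_Ioc fun t ht => ?_
    rw [Real.norm_of_nonneg (hg t ⟨ht.1.le, ht.2.trans_lt (hb k).2⟩)]

theorem tendsto_primitive_one {F : Type*} [NormedAddCommGroup F] [NormedSpace ℝ F] {g : ℝ → F}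
    (hg : IntervalIntegrable g volume 0 1) :
    Tendsto (fun b => ∫ t in (0 : ℝ)..b, g t) (𝓝[<] 1) (𝓝 (∫ t in (0 : ℝ)..1, g t)) := by
  have h := (absolutelyContinuousOnInterval_primitive hg).continuousOn 1 right_mem_uIcc
  rw [uIcc_of_le zero_le_one] at h
  refine h.mono_left ?_
  rw [← nhdsWithin_Ioo_eq_nhdsLT (zero_lt_one' ℝ)]
  exact nhdsWithin_mono _ Ioo_subset_Icc_self

theorem eventually_mem_Ico : ∀ᶠ b in 𝓝[<] (1 : ℝ), b ∈ Ico (0 : ℝ) 1 :=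
  Ico_mem_nhdsLT zero_lt_one

theorem exists_norm_le_of_continuousOn {a : ℝ → Vec n →L[ℝ] Vec n} (ha : ContinuousOn a (Icc 0 1)) :
    ∃ C, 0 < C ∧ ∀ t ∈ Icc (0 : ℝ) 1, ‖a t‖ ≤ C := by
  obtain ⟨C, hC⟩ := isCompact_Icc.exists_bound_of_continuousOn ha
  exact ⟨max C 1, by positivity, fun t ht => (hC t ht).trans (le_max_left _ _)⟩

theorem continuousOn_Ico_of_Icc {F : Type*} [TopologicalSpace F] {k : ℝ → F}
    (h : ∀ b ∈ Ico (0 : ℝ) 1, ContinuousOn k (Icc 0 b)) : ContinuousOn k (Ico 0 1) := by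
  intro t ht
  obtain ⟨b, hb⟩ := exists_between ht.2
  refine (h b ⟨ht.1.trans hb.1.le, hb.2⟩ t ⟨ht.1, hb.1.le⟩).mono_of_mem_nhdsWithin ?_
  rw [mem_nhdsWithin]
  exact ⟨Iio b, isOpen_Iio, hb.1, fun x hx => ⟨hx.2.1, le_of_lt hx.1⟩⟩

theorem aestronglyMeasurable_of_continuousOn {k : ℝ → Vec n}
    (h : ContinuousOn k (Ico 0 1)) : AEStronglyMeasurable k unitVolume := by
  rw [unitVolume, ← restrict_Ioo_eq_restrict_Icc]
  exact (h.mono Ioo_subset_Ico_self).aestronglyMeasurable measurableSet_Ioo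

theorem memLp_two {k : ℝ → Vec n} (h : AEStronglyMeasurable k unitVolume)
    (hi : IntervalIntegrable (fun t => ‖k t‖ ^ 2) volume 0 1) : MemLp k 2 unitVolume := by
  rw [memLp_two_iff_integrable_sq_norm h]
  exact (intervalIntegrable_iff_integrableOn_Icc_of_le zero_le_one).1 hi

namespace IsJacobiFactorization

variable (J : IsJacobiFactorization R f f' A D)
include J

theorem f_jacobiQuot (φ : ℝ → Vec n) {t : ℝ} (ht : t ∈ Ico (0 : ℝ) 1) :
    f t (jacobiQuot f φ t) = prim φ t :=
  J.apply_inverse ht _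

theorem absolutelyContinuousOnInterval_f {b : ℝ} (hb : b ∈ Ico (0 : ℝ) 1) :
    AbsolutelyContinuousOnInterval f 0 b :=
  absolutelyContinuousOnInterval_of_hasDerivWithinAt hb.1
    (fun t ht => (J.deriv t ⟨ht.1, ht.2.trans hb.2.le⟩).mono (Icc_subset_Icc_right hb.2.le))
    (J.continuousOn_f'.mono (Icc_subset_Icc_right hb.2.le))

theorem absolutelyContinuousOnInterval_f' {b : ℝ} (hb : b ∈ Ico (0 : ℝ) 1) :
    AbsolutelyContinuousOnInterval f' 0 b :=
  absolutelyContinuousOnInterval_of_hasDerivWithinAt hb.1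
    (fun t ht => (J.jacobi t ⟨ht.1, ht.2.trans hb.2.le⟩).mono (Icc_subset_Icc_right hb.2.le))
    ((J.continuousOn_R.clm_comp J.continuousOn_f).neg.mono (Icc_subset_Icc_right hb.2.le))

theorem absolutelyContinuousOnInterval_inverse {b : ℝ} (hb : b ∈ Ico (0 : ℝ) 1) :
    AbsolutelyContinuousOnInterval (fun t => Ring.inverse (f t)) 0 b :=
  absolutelyContinuousOnInterval_of_hasDerivWithinAt hb.1
    (fun _ ht => J.hasDerivWithinAt_inverse ⟨ht.1, ht.2.trans_lt hb.2⟩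
      (Icc_subset_Icc_right hb.2.le))
    (((J.continuousOn_inverse hb).mul (J.continuousOn_f'.mono (Icc_subset_Icc_right hb.2.le))).mul
      (J.continuousOn_inverse hb)).neg

theorem absolutelyContinuousOnInterval_jacobiQuot (φ : L2 n) {b : ℝ} (hb : b ∈ Ico (0 : ℝ) 1) :
    AbsolutelyContinuousOnInterval (jacobiQuot f φ) 0 b :=
  PathHessian.AbsolutelyContinuousOnInterval.clm_apply₂
    (ContinuousLinearMap.id ℝ (Vec n →L[ℝ] Vec n)) (J.absolutelyContinuousOnInterval_inverse hb)
    (absolutelyContinuousOnInterval_prim φ (Ico_subset_Icc_self hb))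

theorem hasDerivAt_f {t : ℝ} (ht : t ∈ Ioo (0 : ℝ) 1) : HasDerivAt f (f' t) t :=
  (J.deriv t (Ioo_subset_Icc_self ht)).hasDerivAt (Icc_mem_nhds ht.1 ht.2)

theorem hasDerivAt_f' {t : ℝ} (ht : t ∈ Ioo (0 : ℝ) 1) : HasDerivAt f' (-(R t ∘L f t)) t :=
  (J.jacobi t (Ioo_subset_Icc_self ht)).hasDerivAt (Icc_mem_nhds ht.1 ht.2)

theorem ae_hasDerivAt_jacobiQuot (φ : L2 n) : ∀ᵐ t, t ∈ Ioo (0 : ℝ) 1 →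
    HasDerivAt (jacobiQuot f φ) (Ring.inverse (f t) (jacobiDefect f f' φ t)) t := by
  filter_upwards [ae_hasDerivAt_prim φ] with t ht htI
  have h := ((J.hasDerivWithinAt_inverse (Ioo_subset_Ico_self htI) Subset.rfl).hasDerivAt
    (Icc_mem_nhds htI.1 htI.2)).clm_apply (ht htI)
  refine h.congr_deriv ?_
  simp only [jacobiDefect, jacobiQuot, map_sub, neg_apply, mul_apply_eq_comp]
  abel

/-- The integrand of the energy is a perfect square up to the derivative of
`⟨f' f⁻¹ h, h⟩`, where `h = ∫₀^· φ`. -/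
theorem integral_defect (φ : L2 n) {b : ℝ} (hb : b ∈ Ico (0 : ℝ) 1) :
    IntervalIntegrable (fun t => ‖φ t‖ ^ 2 - inner ℝ (R t (prim φ t)) (prim φ t) -
      ‖jacobiDefect f f' φ t‖ ^ 2) volume 0 b ∧
    ∫ t in (0 : ℝ)..b, (‖φ t‖ ^ 2 - inner ℝ (R t (prim φ t)) (prim φ t) -
      ‖jacobiDefect f f' φ t‖ ^ 2) = inner ℝ (f' b (jacobiQuot f φ b)) (prim φ b) := by
  have hac : AbsolutelyContinuousOnInterval
      (fun t => innerSL ℝ (f' t (jacobiQuot f φ t)) (prim φ t)) 0 b :=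
    PathHessian.AbsolutelyContinuousOnInterval.clm_apply₂ (innerSL ℝ)
      (PathHessian.AbsolutelyContinuousOnInterval.clm_apply₂
        (ContinuousLinearMap.id ℝ (Vec n →L[ℝ] Vec n)) (J.absolutelyContinuousOnInterval_f' hb)
        (J.absolutelyContinuousOnInterval_jacobiQuot φ hb))
      (absolutelyContinuousOnInterval_prim φ (Ico_subset_Icc_self hb))
  have h := PathHessian.AbsolutelyContinuousOnInterval.integral_eq_sub
    (q' := fun t => ‖φ t‖ ^ 2 - inner ℝ (R t (prim φ t)) (prim φ t) -
      ‖jacobiDefect f f' φ t‖ ^ 2) hb.1 hac (by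
      filter_upwards [ae_hasDerivAt_prim φ, J.ae_hasDerivAt_jacobiQuot φ] with t h1 h2 ht
      have htI := Ioo_subset_Ioo_of_mem hb ht
      have htc := Ioo_subset_Ico_self htI
      refine (hasDerivAt_inner_clm ((J.hasDerivAt_f' htI).clm_apply (h2 htI))
        (h1 htI)).congr_deriv ?_
      have hφ : φ t = jacobiDefect f f' φ t + f' t (jacobiQuot f φ t) := by
        simp [jacobiDefect]
      have hw := J.wronskian (Ioo_subset_Icc_self htI)
        (Ring.inverse (f t) (jacobiDefect f f' φ t)) (jacobiQuot f φ t)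
      rw [J.f_jacobiQuot φ htc, J.apply_inverse htc] at hw
      have e1 : ‖φ t‖ ^ 2 = ‖jacobiDefect f f' φ t‖ ^ 2 +
          2 * inner ℝ (jacobiDefect f f' φ t) (f' t (jacobiQuot f φ t)) +
          ‖f' t (jacobiQuot f φ t)‖ ^ 2 := by
        conv_lhs => rw [hφ]
        exact norm_add_sq_real _ _
      have e2 : (inner ℝ (f' t (jacobiQuot f φ t)) (φ t) : ℝ) =
          inner ℝ (jacobiDefect f f' φ t) (f' t (jacobiQuot f φ t)) +
          ‖f' t (jacobiQuot f φ t)‖ ^ 2 := by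
        conv_lhs => rw [hφ]
        rw [inner_add_right, real_inner_self_eq_norm_sq, real_inner_comm]
      simp only [neg_apply, ContinuousLinearMap.comp_apply,
        inner_add_left, inner_neg_left]
      rw [J.f_jacobiQuot φ htc, hw, e1, e2]
      ring)
  simpa [prim_zero] using h

/-- The boundary term `⟨f' f⁻¹ h, h⟩` vanishes in the limit, although `f` is singular at `1`: the
numerator is of order `o(1 - b)`. -/
theorem tendsto_boundary (φ : L20 n) : Tendsto (fun b => (inner ℝ
    (f' b (jacobiQuot f (φ : L2 n) b)) (prim (φ : L2 n) b) : ℝ)) (𝓝[<] 1) (𝓝 0) := by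
  obtain ⟨C, hC0, hC⟩ := exists_norm_le_of_continuousOn J.continuousOn_f'
  obtain ⟨C', hC0', hC'⟩ := exists_norm_le_of_continuousOn J.continuousOn_D
  have hsq := intervalIntegrable_norm_sq (φ : L2 n)
  have hlim := tendsto_primitive_one hsq
  have hlim' : Tendsto (fun b => C * C' * ((∫ t in (0 : ℝ)..1, ‖(φ : L2 n) t‖ ^ 2) -
      ∫ t in (0 : ℝ)..b, ‖(φ : L2 n) t‖ ^ 2)) (𝓝[<] 1) (𝓝 0) := by
    have h := (hlim.const_sub (∫ t in (0 : ℝ)..1, ‖(φ : L2 n) t‖ ^ 2)).const_mul (C * C')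
    rwa [sub_self, mul_zero] at h
  refine squeeze_zero_norm' ?_ hlim'
  filter_upwards [eventually_mem_Ico] with b hb
  have hbI := Ico_subset_Icc_self hb
  have h1b : 0 < 1 - b := sub_pos.2 hb.2
  have hsub : uIcc (0 : ℝ) b ⊆ uIcc 0 1 := by
    rw [uIcc_of_le hb.1, uIcc_of_le zero_le_one]; exact Icc_subset_Icc_right hb.2.le
  have hsub' : uIcc b 1 ⊆ uIcc (0 : ℝ) 1 := by
    rw [uIcc_of_le hb.2.le, uIcc_of_le zero_le_one]; exact Icc_subset_Icc_left hb.1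
  rw [intervalIntegral.integral_interval_sub_left hsq (hsq.mono_set hsub)]
  have hcs := norm_sq_integral_le (φ := (φ : L2 n)) hb.2
    (L2.intervalIntegrable _ hbI one_mem_unitInterval) (hsq.mono_set hsub')
  have hh : ∫ t in b..1, (φ : L2 n) t = -prim (φ : L2 n) b := by
    rw [← intervalIntegral.integral_interval_sub_left
      (L2.intervalIntegrable_zero (φ : L2 n) one_mem_unitInterval)
      (L2.intervalIntegrable_zero (φ : L2 n) hbI)]
    change prim (φ : L2 n) 1 - prim (φ : L2 n) b = _
    rw [L20.prim_one, zero_sub]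
  rw [hh, norm_neg] at hcs
  have hq : ‖jacobiQuot f (φ : L2 n) b‖ ≤ (1 - b)⁻¹ * (C' * ‖prim (φ : L2 n) b‖) := by
    rw [jacobiQuot, (J.inverse_eq hb).2, smul_apply, norm_smul,
      Real.norm_of_nonneg (inv_nonneg.2 h1b.le)]
    gcongr
    exact ((D b).le_opNorm _).trans (by gcongr; exact hC' b hbI)
  calc ‖(inner ℝ (f' b (jacobiQuot f (φ : L2 n) b)) (prim (φ : L2 n) b) : ℝ)‖
      ≤ ‖f' b (jacobiQuot f (φ : L2 n) b)‖ * ‖prim (φ : L2 n) b‖ := norm_inner_le_norm _ _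
    _ ≤ (C * ((1 - b)⁻¹ * (C' * ‖prim (φ : L2 n) b‖))) * ‖prim (φ : L2 n) b‖ := by
        gcongr
        exact ((f' b).le_opNorm _).trans (by gcongr; exact hC b hbI)
    _ = C * C' * ((1 - b)⁻¹ * ‖prim (φ : L2 n) b‖ ^ 2) := by ring
    _ ≤ C * C' * ((1 - b)⁻¹ * ((1 - b) * ∫ t in b..1, ‖(φ : L2 n) t‖ ^ 2)) := by gcongr
    _ = C * C' * ∫ t in b..1, ‖(φ : L2 n) t‖ ^ 2 := by
        rw [inv_mul_cancel_left₀ h1b.ne']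

theorem intervalIntegrable_index (φ : L2 n) : IntervalIntegrable
    (fun t => (inner ℝ (R t (prim φ t)) (prim φ t) : ℝ)) volume 0 1 := by
  refine ContinuousOn.intervalIntegrable ?_
  rw [uIcc_of_le zero_le_one]
  exact (J.continuousOn_R.clm_apply (continuousOn_prim φ)).inner (continuousOn_prim φ)

theorem norm_sq_defect (φ : L20 n) :
    IntervalIntegrable (fun t => ‖jacobiDefect f f' (φ : L2 n) t‖ ^ 2) volume 0 1 ∧
    ∫ t in (0 : ℝ)..1, ‖jacobiDefect f f' (φ : L2 n) t‖ ^ 2 =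
      ‖φ‖ ^ 2 - ∫ t in (0 : ℝ)..1,
        inner ℝ (R t (prim (φ : L2 n) t)) (prim (φ : L2 n) t) := by
  have hg : IntervalIntegrable (fun t => ‖(φ : L2 n) t‖ ^ 2 -
      inner ℝ (R t (prim (φ : L2 n) t)) (prim (φ : L2 n) t)) volume 0 1 :=
    (intervalIntegrable_norm_sq (φ : L2 n)).sub (J.intervalIntegrable_index (φ : L2 n))
  have hsub : ∀ b ∈ Ico (0 : ℝ) 1, uIcc (0 : ℝ) b ⊆ uIcc 0 1 := fun b hb => by
    rw [uIcc_of_le hb.1, uIcc_of_le zero_le_one]; exact Icc_subset_Icc_right hb.2.le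
  have hi : ∀ b ∈ Ico (0 : ℝ) 1,
      IntervalIntegrable (fun t => ‖jacobiDefect f f' (φ : L2 n) t‖ ^ 2) volume 0 b := by
    intro b hb
    have h := (hg.mono_set (hsub b hb)).sub (J.integral_defect (φ : L2 n) hb).1
    simpa using h
  have heq : ∀ b ∈ Ico (0 : ℝ) 1, ∫ t in (0 : ℝ)..b, ‖jacobiDefect f f' (φ : L2 n) t‖ ^ 2 =
      (∫ t in (0 : ℝ)..b, (‖(φ : L2 n) t‖ ^ 2 -
        inner ℝ (R t (prim (φ : L2 n) t)) (prim (φ : L2 n) t))) -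
      inner ℝ (f' b (jacobiQuot f (φ : L2 n) b)) (prim (φ : L2 n) b) := by
    intro b hb
    rw [← (J.integral_defect (φ : L2 n) hb).2,
      ← intervalIntegral.integral_sub (hg.mono_set (hsub b hb)) (J.integral_defect (φ : L2 n) hb).1]
    simp
  have hlim : Tendsto (fun b => ∫ t in (0 : ℝ)..b, ‖jacobiDefect f f' (φ : L2 n) t‖ ^ 2) (𝓝[<] 1)
      (𝓝 (∫ t in (0 : ℝ)..1, (‖(φ : L2 n) t‖ ^ 2 -
        inner ℝ (R t (prim (φ : L2 n) t)) (prim (φ : L2 n) t)))) := by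
    have h := (tendsto_primitive_one hg).sub (J.tendsto_boundary φ)
    rw [sub_zero] at h
    refine h.congr' ?_
    filter_upwards [eventually_mem_Ico] with b hb using (heq b hb).symm
  have hint : IntervalIntegrable (fun t => ‖jacobiDefect f f' (φ : L2 n) t‖ ^ 2) volume 0 1 := by
    refine intervalIntegrable_of_integral_le (fun t _ => by positivity) hi
      (I := ∫ t in (0 : ℝ)..1, (‖(φ : L2 n) t‖ ^ 2 -
        inner ℝ (R t (prim (φ : L2 n) t)) (prim (φ : L2 n) t))) fun b hb => ?_
    refine ge_of_tendsto hlim ?_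
    have : ∀ᶠ b' in 𝓝[<] (1 : ℝ), b < b' :=
      mem_nhdsWithin_of_mem_nhds (Ioi_mem_nhds hb.2)
    filter_upwards [this, eventually_mem_Ico] with b' hbb hb'
    exact intervalIntegral.integral_mono_interval le_rfl hb.1 hbb.le
      (Eventually.of_forall fun t => by positivity) (hi b' hb')
  refine ⟨hint, ?_⟩
  rw [tendsto_nhds_unique (tendsto_primitive_one hint) hlim,
    intervalIntegral.integral_sub (intervalIntegrable_norm_sq (φ : L2 n))
      (J.intervalIntegrable_index (φ : L2 n)), ← norm_sq_eq_integral]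
  rfl

theorem continuousOn_jacobiQuot (φ : L2 n) : ContinuousOn (jacobiQuot f φ) (Ico 0 1) := by
  refine continuousOn_Ico_of_Icc fun b hb => ?_
  have h := (J.absolutelyContinuousOnInterval_jacobiQuot φ hb).continuousOn
  rwa [uIcc_of_le hb.1] at h

theorem memLp_jacobiDefect (φ : L20 n) :
    MemLp (jacobiDefect f f' (φ : L2 n)) 2 unitVolume := by
  refine memLp_two ?_ (J.norm_sq_defect φ).1
  exact (Lp.aestronglyMeasurable (φ : L2 n)).sub (aestronglyMeasurable_of_continuousOn
    ((J.continuousOn_f'.mono Ico_subset_Icc_self).clm_apply (J.continuousOn_jacobiQuot _)))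

/-- The operator `S` as a linear map. -/
def linS : L20 n →ₗ[ℝ] L2 n where
  toFun φ := (J.memLp_jacobiDefect φ).toLp
  map_add' φ ψ := by
    rw [← MemLp.toLp_add, MemLp.toLp_eq_toLp_iff]
    filter_upwards [Lp.coeFn_add (φ : L2 n) (ψ : L2 n), ae_restrict_mem measurableSet_Icc]
      with t h1 ht
    have h2 := prim_add (φ : L2 n) (ψ : L2 n) ht
    change ((φ : L2 n) + (ψ : L2 n) : L2 n) t - f' t (Ring.inverse (f t)
      (prim ((φ : L2 n) + (ψ : L2 n) : L2 n) t)) = _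
    rw [h1, h2]
    simp only [Pi.add_apply, jacobiDefect, jacobiQuot, map_add]
    abel
  map_smul' a φ := by
    rw [RingHom.id_apply, ← MemLp.toLp_const_smul, MemLp.toLp_eq_toLp_iff]
    filter_upwards [Lp.coeFn_smul a (φ : L2 n), ae_restrict_mem measurableSet_Icc]
      with t h1 ht
    have h2 := prim_smul a (φ : L2 n) ht
    change (a • (φ : L2 n) : L2 n) t - f' t (Ring.inverse (f t)
      (prim (a • (φ : L2 n) : L2 n) t)) = _
    rw [h1, h2]
    simp only [Pi.smul_apply, jacobiDefect, jacobiQuot, map_smul, smul_sub]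

theorem linS_coe (φ : L20 n) : J.linS φ =ᵐ[unitVolume] jacobiDefect f f' (φ : L2 n) :=
  (J.memLp_jacobiDefect φ).coeFn_toLp

theorem norm_sq_linS (φ : L20 n) :
    ‖J.linS φ‖ ^ 2 = inner ℝ ((1 + operatorT J.continuousOn_R) φ) φ := by
  rw [norm_sq_eq_integral, add_apply, inner_add_left,
    inner_operatorT_eq_integral, ← sub_eq_add_neg]
  change _ = inner ℝ φ φ - _
  rw [real_inner_self_eq_norm_sq, ← (J.norm_sq_defect φ).2]
  refine integral_congr_unitVolume ?_ zero_mem_unitInterval one_mem_unitInterval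
  filter_upwards [J.linS_coe φ] with t ht
  rw [ht]

theorem norm_linS_le (φ : L20 n) :
    ‖J.linS φ‖ ≤ Real.sqrt ‖1 + operatorT J.continuousOn_R‖ * ‖φ‖ := by
  refine le_of_sq_le_sq ?_ (by positivity)
  rw [J.norm_sq_linS, mul_pow, Real.sq_sqrt (ContinuousLinearMap.opNorm_nonneg _)]
  calc _ ≤ ‖(1 + operatorT J.continuousOn_R) φ‖ * ‖φ‖ := real_inner_le_norm _ _
    _ ≤ ‖1 + operatorT J.continuousOn_R‖ * ‖φ‖ * ‖φ‖ := by
        gcongr; exact ContinuousLinearMap.le_opNorm _ _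
    _ = _ := by ring

/-- The operator `S`. -/
def clmS : L20 n →L[ℝ] L2 n := J.linS.mkContinuous _ J.norm_linS_le

/-- `f⁻¹ h` is the primitive of `f⁻¹ S φ`; hence `S φ = 0` forces `φ = 0`. -/
theorem linS_injective : Function.Injective J.linS := by
  rw [← LinearMap.ker_eq_bot, LinearMap.ker_eq_bot']
  intro φ hφ
  have h0 : jacobiDefect f f' (φ : L2 n) =ᵐ[unitVolume] 0 := by
    refine (J.linS_coe φ).symm.trans ?_
    rw [hφ]
    exact Lp.coeFn_zero _ _ _
  have h0' := (ae_restrict_iff' measurableSet_Icc).1 h0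
  refine (primLin_bijective n).1 ?_
  rw [map_zero]
  refine Subtype.ext (funext fun t => ?_)
  change prim (φ : L2 n) t = 0
  rcases eq_or_lt_of_le t.2.2 with h1 | h1
  · rw [h1, L20.prim_one]
  have hb : (t : ℝ) ∈ Ico (0 : ℝ) 1 := ⟨t.2.1, h1⟩
  have h := PathHessian.AbsolutelyContinuousOnInterval.integral_vec_eq_sub (q' := fun _ => 0) hb.1
    (J.absolutelyContinuousOnInterval_jacobiQuot (φ : L2 n) hb) intervalIntegrable_const (by
      filter_upwards [J.ae_hasDerivAt_jacobiQuot (φ : L2 n), h0'] with s hs h0s hsI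
      have hsI' := Ioo_subset_Ioo_of_mem hb hsI
      have := hs hsI'
      rwa [h0s (Ioo_subset_Icc_self hsI'), Pi.zero_apply, map_zero] at this)
  have hz : jacobiQuot f (φ : L2 n) 0 = 0 := by rw [jacobiQuot, prim_zero, map_zero]
  rw [intervalIntegral.integral_zero, hz, sub_zero] at h
  rw [← J.f_jacobiQuot (φ : L2 n) hb, ← h, map_zero]

end IsJacobiFactorization

end OperatorS

/-! ### Invertibility of `S` -/

section Surjectivity

open Filter

variable {n : ℕ} {R f f' A D : ℝ → Vec n →L[ℝ] Vec n}

set_option synthInstance.maxHeartbeats 200000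

namespace IsJacobiFactorization

variable (J : IsJacobiFactorization R f f' A D)
include J

/-- A Hardy inequality for `k(t) = ∫₀ᵗ f⁻¹ ψ`: although `f⁻¹` has a pole at `1`, the function `k`
is square integrable. It follows by integrating the derivative of `(1 - t) |k(t)|²`. -/
theorem hardy (ψ : L2 n) : ∃ I : ℝ, ∀ b ∈ Ico (0 : ℝ) 1,
    IntervalIntegrable (fun t => Ring.inverse (f t) (ψ t)) volume 0 b ∧
    AbsolutelyContinuousOnInterval (fun t => ∫ s in (0 : ℝ)..t, Ring.inverse (f s) (ψ s)) 0 b ∧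
    (1 - b) * ‖∫ s in (0 : ℝ)..b, Ring.inverse (f s) (ψ s)‖ ^ 2 ≤ I ∧
    ∫ t in (0 : ℝ)..b, ‖∫ s in (0 : ℝ)..t, Ring.inverse (f s) (ψ s)‖ ^ 2 ≤ I := by
  obtain ⟨C, hC0, hC⟩ := exists_norm_le_of_continuousOn J.continuousOn_D
  refine ⟨4 * C ^ 2 * ∫ t in (0 : ℝ)..1, ‖ψ t‖ ^ 2, fun b hb => ?_⟩
  set k : ℝ → Vec n := fun t => ∫ s in (0 : ℝ)..t, Ring.inverse (f s) (ψ s) with hk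
  have hbI := Ico_subset_Icc_self hb
  have hi : IntervalIntegrable (fun t => Ring.inverse (f t) (ψ t)) volume 0 b := by
    obtain ⟨C', hC'⟩ := isCompact_Icc.exists_bound_of_continuousOn (J.continuousOn_inverse hb)
    have hψ := (L2.intervalIntegrable_zero ψ hbI)
    rw [intervalIntegrable_iff_integrableOn_Icc_of_le hb.1] at hψ ⊢
    refine (hψ.norm.const_mul C').mono' ?_ ?_
    · have hm : AEStronglyMeasurable (fun t => Ring.inverse (f t)) (volume.restrict (Icc 0 b)) :=
        (J.continuousOn_inverse hb).aestronglyMeasurable measurableSet_Icc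
      exact (ContinuousLinearMap.id ℝ (Vec n →L[ℝ] Vec n)).aestronglyMeasurable_comp₂ hm hψ.1
    · filter_upwards [ae_restrict_mem measurableSet_Icc] with t ht
      exact ((Ring.inverse (f t)).le_opNorm _).trans (by gcongr; exact hC' t ht)
  have hkac : AbsolutelyContinuousOnInterval k 0 b := absolutelyContinuousOnInterval_primitive hi
  have hac : AbsolutelyContinuousOnInterval
      (fun t => innerSL ℝ ((1 - t) • k t) (k t)) 0 b := by
    have h1 : AbsolutelyContinuousOnInterval (fun t : ℝ => 1 - t) 0 b :=
      absolutelyContinuousOnInterval_of_hasDerivWithinAt (f' := fun _ => -1) hb.1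
        (fun t _ => ((hasDerivAt_id t).const_sub 1).hasDerivWithinAt) continuousOn_const
    exact PathHessian.AbsolutelyContinuousOnInterval.clm_apply₂ (innerSL ℝ)
      (PathHessian.AbsolutelyContinuousOnInterval.clm_apply₂
        (ContinuousLinearMap.lsmul ℝ ℝ : ℝ →L[ℝ] Vec n →L[ℝ] Vec n) h1 hkac) hkac
  have hq := PathHessian.AbsolutelyContinuousOnInterval.integral_eq_sub
    (q' := fun t => 2 * inner ℝ (k t) (D t (ψ t)) - ‖k t‖ ^ 2) hb.1 hac (by
      filter_upwards [ae_hasDerivAt_primitive hi] with t h1 ht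
      have h2 : HasDerivAt (fun s => (1 - s) • k s)
          ((1 - t) • Ring.inverse (f t) (ψ t) + (-1 : ℝ) • k t) t :=
        ((hasDerivAt_id t).const_sub 1).smul (h1 ht)
      refine (hasDerivAt_inner_clm h2 (h1 ht)).congr_deriv ?_
      have ht1 : t ∈ Ico (0 : ℝ) 1 := ⟨ht.1.le, ht.2.trans hb.2⟩
      have h0 : (1 - t) ≠ 0 := (sub_pos.2 ht1.2).ne'
      have e : (1 - t) • Ring.inverse (f t) (ψ t) = D t (ψ t) := by
        rw [(J.inverse_eq ht1).2, smul_apply, smul_smul, mul_inv_cancel₀ h0, one_smul]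
      simp only [neg_smul, one_smul, inner_add_left, inner_neg_left, e]
      rw [inner_smul_left_eq_smul, ← inner_smul_right_eq_smul, e, real_inner_self_eq_norm_sq,
        real_inner_comm (k t)]
      ring)
  have hk0 : k 0 = 0 := intervalIntegral.integral_same
  have hq2 := hq.2
  simp only [innerSL_apply_apply, hk0, inner_zero_right, sub_zero, inner_smul_left_eq_smul,
    smul_eq_mul, real_inner_self_eq_norm_sq] at hq2
  have hkc : ContinuousOn k (Icc 0 b) := by
    have := hkac.continuousOn; rwa [uIcc_of_le hb.1] at this
  have hk2 : IntervalIntegrable (fun t => ‖k t‖ ^ 2) volume 0 b := by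
    refine ContinuousOn.intervalIntegrable ?_
    rw [uIcc_of_le hb.1]; exact hkc.norm.pow 2
  have hψ2 := intervalIntegrable_norm_sq ψ
  have hψ2b : IntervalIntegrable (fun t => ‖ψ t‖ ^ 2) volume 0 b := hψ2.mono_set (by
    rw [uIcc_of_le hb.1, uIcc_of_le zero_le_one]; exact Icc_subset_Icc_right hb.2.le)
  have hle : ∫ t in (0 : ℝ)..b, (2 * inner ℝ (k t) (D t (ψ t)) - ‖k t‖ ^ 2) ≤
      ∫ t in (0 : ℝ)..b, (2 * C ^ 2 * ‖ψ t‖ ^ 2 - 1 / 2 * ‖k t‖ ^ 2) := by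
    refine intervalIntegral.integral_mono_on hb.1 hq.1
      ((hψ2b.const_mul _).sub (hk2.const_mul _)) fun t ht => ?_
    have h1 := norm_apply_sq_le (D t) (hC t ⟨ht.1, ht.2.trans hb.2.le⟩) (ψ t)
    have h2 := real_inner_le_norm (k t) (D t (ψ t))
    nlinarith [sq_nonneg (‖k t‖ - 2 * ‖D t (ψ t)‖)]
  rw [hq2, intervalIntegral.integral_sub (hψ2b.const_mul _) (hk2.const_mul _),
    intervalIntegral.integral_const_mul, intervalIntegral.integral_const_mul] at hle
  have hψm : ∫ t in (0 : ℝ)..b, ‖ψ t‖ ^ 2 ≤ ∫ t in (0 : ℝ)..1, ‖ψ t‖ ^ 2 :=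
    intervalIntegral.integral_mono_interval le_rfl hb.1 hb.2.le
      (Eventually.of_forall fun t => by positivity) hψ2
  have hψm' := mul_le_mul_of_nonneg_left hψm (by positivity : 0 ≤ 2 * C ^ 2)
  have hk0' : 0 ≤ ∫ t in (0 : ℝ)..b, ‖k t‖ ^ 2 :=
    intervalIntegral.integral_nonneg hb.1 fun t _ => by positivity
  have h1b : 0 ≤ (1 - b) * ‖k b‖ ^ 2 := mul_nonneg (sub_nonneg.2 hb.2.le) (by positivity)
  have hψ0 : 0 ≤ C ^ 2 * ∫ t in (0 : ℝ)..1, ‖ψ t‖ ^ 2 := mul_nonneg (by positivity)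
    (intervalIntegral.integral_nonneg zero_le_one fun t _ => by positivity)
  exact ⟨hi, hkac, by linarith, by linarith⟩

theorem linS_surjective : Function.Surjective J.linS := by
  intro ψ
  obtain ⟨I, hI⟩ := J.hardy ψ
  set k : ℝ → Vec n := fun t => ∫ s in (0 : ℝ)..t, Ring.inverse (f s) (ψ s) with hk
  have hkc : ContinuousOn k (Ico 0 1) := continuousOn_Ico_of_Icc fun b hb => by
    have := (hI b hb).2.1.continuousOn
    rwa [uIcc_of_le hb.1] at this
  have hk2 : IntervalIntegrable (fun t => ‖k t‖ ^ 2) volume 0 1 := by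
    refine intervalIntegrable_of_integral_le (fun t _ => by positivity) (fun b hb => ?_)
      fun b hb => (hI b hb).2.2.2
    refine ContinuousOn.intervalIntegrable ?_
    rw [uIcc_of_le hb.1]
    exact (hkc.mono fun t ht => ⟨ht.1, ht.2.trans_lt hb.2⟩).norm.pow 2
  have hkL : MemLp k 2 unitVolume := memLp_two (aestronglyMeasurable_of_continuousOn hkc) hk2
  -- the solution is `ψ + f' k`
  set φ : L2 n := ψ + mulL2 n (restrictC J.continuousOn_f') hkL.toLp with hφ
  have hφc : φ =ᵐ[unitVolume] fun t => ψ t + f' t (k t) := by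
    filter_upwards [Lp.coeFn_add ψ (mulL2 n (restrictC J.continuousOn_f') hkL.toLp),
      mulL2_restrictC J.continuousOn_f' hkL.toLp, hkL.coeFn_toLp] with t h1 h2 h3
    rw [h1, Pi.add_apply, h2, h3]
  have hprim : ∀ b ∈ Ico (0 : ℝ) 1, prim φ b = f b (k b) := by
    intro b hb
    have hac : AbsolutelyContinuousOnInterval (fun t => f t (k t)) 0 b :=
      PathHessian.AbsolutelyContinuousOnInterval.clm_apply₂
        (ContinuousLinearMap.id ℝ (Vec n →L[ℝ] Vec n)) (J.absolutelyContinuousOnInterval_f hb)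
        (hI b hb).2.1
    have h := PathHessian.AbsolutelyContinuousOnInterval.integral_vec_eq_sub hb.1 hac
      (L2.intervalIntegrable_zero φ (Ico_subset_Icc_self hb)) (by
        filter_upwards [ae_hasDerivAt_primitive (hI b hb).1,
          (ae_restrict_iff' measurableSet_Icc).1 hφc] with t h1 h2 ht
        have htI := Ioo_subset_Ioo_of_mem hb ht
        refine ((J.hasDerivAt_f htI).clm_apply (h1 ht)).congr_deriv ?_
        rw [h2 (Ioo_subset_Icc_self htI), J.apply_inverse (Ioo_subset_Ico_self htI), add_comm])
    have hk0 : k 0 = 0 := intervalIntegral.integral_same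
    rw [hk0, map_zero, sub_zero] at h
    exact h
  have hφ0 : φ ∈ L20 n := by
    change prim φ 1 = 0
    obtain ⟨C, hC0, hC⟩ := exists_norm_le_of_continuousOn J.continuousOn_A
    have h1 : Tendsto (fun b => ‖prim φ b‖ ^ 2) (𝓝[<] 1) (𝓝 (‖prim φ 1‖ ^ 2)) :=
      ((tendsto_primitive_one
        (L2.intervalIntegrable_zero φ one_mem_unitInterval)).norm).pow 2
    have h2 : Tendsto (fun b : ℝ => (1 - b) * (C ^ 2 * I)) (𝓝[<] 1) (𝓝 0) := by
      have : Tendsto (fun b : ℝ => (1 - b) * (C ^ 2 * I)) (𝓝 1) (𝓝 ((1 - 1) * (C ^ 2 * I))) :=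
        (Continuous.tendsto (by fun_prop) 1)
      rw [sub_self, zero_mul] at this
      exact this.mono_left nhdsWithin_le_nhds
    have h3 : ‖prim φ 1‖ ^ 2 ≤ 0 := by
      refine le_of_tendsto_of_tendsto h1 h2 ?_
      filter_upwards [eventually_mem_Ico] with b hb
      have hb1 : 0 ≤ 1 - b := sub_nonneg.2 hb.2.le
      rw [hprim b hb, J.factor b (Ico_subset_Icc_self hb), smul_apply, norm_smul, mul_pow,
        Real.norm_of_nonneg hb1]
      have h4 := norm_apply_sq_le (A b) (hC b (Ico_subset_Icc_self hb)) (k b)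
      calc (1 - b) ^ 2 * ‖A b (k b)‖ ^ 2 ≤ (1 - b) ^ 2 * (C ^ 2 * ‖k b‖ ^ 2) := by gcongr
        _ = (1 - b) * (C ^ 2 * ((1 - b) * ‖k b‖ ^ 2)) := by ring
        _ ≤ (1 - b) * (C ^ 2 * I) := by gcongr; exact (hI b hb).2.2.1
    have h5 : ‖prim φ 1‖ = 0 := by nlinarith [norm_nonneg (prim φ 1)]
    exact norm_eq_zero.1 h5
  refine ⟨⟨φ, hφ0⟩, Lp.ext ?_⟩
  filter_upwards [J.linS_coe ⟨φ, hφ0⟩, hφc, ae_unitVolume_Ioo] with t h1 h2 ht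
  have htc := Ioo_subset_Ico_self ht
  rw [h1]
  change φ t - f' t (Ring.inverse (f t) (prim φ t)) = ψ t
  rw [hprim t htc, J.inverse_apply htc, h2, add_sub_cancel_right]

/-- The operator `S` as an isomorphism of Hilbert spaces. -/
def equivS : L20 n ≃L[ℝ] L2 n :=
  ContinuousLinearEquiv.ofBijective J.clmS (LinearMap.ker_eq_bot.2 J.linS_injective)
    (LinearMap.range_eq_top.2 J.linS_surjective)

end IsJacobiFactorization

end Surjectivity

/-! ### A positive operator factored as `S* S` -/

section Factorization

set_option linter.unusedSectionVars false

variable {H K : Type*} [NormedAddCommGroup H] [InnerProductSpace ℝ H] [CompleteSpace H]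
  [NormedAddCommGroup K] [InnerProductSpace ℝ K] [CompleteSpace K]
  {B : H →L[ℝ] H} {S : H ≃L[ℝ] K}

theorem eq_adjoint_comp (hB : IsSelfAdjoint B) (h : ∀ φ, ‖S φ‖ ^ 2 = inner ℝ (B φ) φ) :
    B = (S : H →L[ℝ] K).adjoint ∘L (S : H →L[ℝ] K) := by
  rw [← sub_eq_zero]
  have hs : IsSelfAdjoint (B - (S : H →L[ℝ] K).adjoint ∘L (S : H →L[ℝ] K)) := by
    refine hB.sub ?_
    rw [ContinuousLinearMap.isSelfAdjoint_iff', ContinuousLinearMap.adjoint_comp,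
      ContinuousLinearMap.adjoint_adjoint]
  refine ContinuousLinearMap.coe_injective ?_
  refine ((ContinuousLinearMap.isSelfAdjoint_iff_isSymmetric.1 hs).inner_map_self_eq_zero).1
    fun φ => ?_
  change inner ℝ (B φ - (S : H →L[ℝ] K).adjoint (S φ)) φ = 0
  rw [inner_sub_left, ContinuousLinearMap.adjoint_inner_left, ← h]
  change _ - inner ℝ (S φ) (S φ) = (0 : ℝ)
  rw [real_inner_self_eq_norm_sq, sub_self]

theorem adjoint_symm_comp_adjoint :
    (S.symm : K →L[ℝ] H).adjoint ∘L (S : H →L[ℝ] K).adjoint = ContinuousLinearMap.id ℝ K := by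
  rw [← ContinuousLinearMap.adjoint_comp, ContinuousLinearEquiv.coe_comp_coe_symm]
  exact ContinuousLinearMap.adjoint_id

theorem adjoint_comp_adjoint_symm :
    (S : H →L[ℝ] K).adjoint ∘L (S.symm : K →L[ℝ] H).adjoint = ContinuousLinearMap.id ℝ H := by
  rw [← ContinuousLinearMap.adjoint_comp, ContinuousLinearEquiv.coe_symm_comp_coe]
  exact ContinuousLinearMap.adjoint_id

theorem adjoint_symm_comp_eq (h : B = (S : H →L[ℝ] K).adjoint ∘L (S : H →L[ℝ] K)) :
    (S.symm : K →L[ℝ] H).adjoint ∘L B = (S : H →L[ℝ] K) := by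
  rw [h, ← ContinuousLinearMap.comp_assoc, adjoint_symm_comp_adjoint,
    ContinuousLinearMap.id_comp]

theorem isUnit_and_inverse_eq (h : B = (S : H →L[ℝ] K).adjoint ∘L (S : H →L[ℝ] K)) :
    IsUnit B ∧ Ring.inverse B = (S.symm : K →L[ℝ] H) ∘L (S.symm : K →L[ℝ] H).adjoint := by
  have h1 : B * ((S.symm : K →L[ℝ] H) ∘L (S.symm : K →L[ℝ] H).adjoint) = 1 := by
    ext v
    have := DFunLike.congr_fun (adjoint_comp_adjoint_symm (S := S)) v
    rw [h]
    simpa using this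
  have h2 : ((S.symm : K →L[ℝ] H) ∘L (S.symm : K →L[ℝ] H).adjoint) * B = 1 := by
    ext v
    have := DFunLike.congr_fun (adjoint_symm_comp_eq h) v
    change S.symm ((S.symm : K →L[ℝ] H).adjoint (B v)) = v
    have e : (S.symm : K →L[ℝ] H).adjoint (B v) = S v := this
    rw [e, S.symm_apply_apply]
  exact ⟨⟨⟨_, _, h1, h2⟩, rfl⟩, Ring.inverse_unit ⟨_, _, h1, h2⟩⟩

theorem norm_symm_pos [Nontrivial H] : 0 < ‖(S.symm : K →L[ℝ] H)‖ := by
  rw [norm_pos_iff]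
  intro h
  obtain ⟨v, hv⟩ := exists_ne (0 : H)
  have := DFunLike.congr_fun h (S v)
  exact hv (by simpa using this)

theorem norm_sq_le_of_norm_symm [Nontrivial H] (φ : H) :
    1 / ‖(S.symm : K →L[ℝ] H)‖ ^ 2 * ‖φ‖ ^ 2 ≤ ‖S φ‖ ^ 2 := by
  have h0 := norm_symm_pos (S := S)
  have h1 : ‖φ‖ ≤ ‖(S.symm : K →L[ℝ] H)‖ * ‖S φ‖ := by
    simpa using (S.symm : K →L[ℝ] H).le_opNorm (S φ)
  have h2 := pow_le_pow_left₀ (norm_nonneg _) h1 2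
  rw [mul_pow] at h2
  rw [one_div, inv_mul_le_iff₀ (by positivity)]
  exact h2

theorem le_of_forall_norm_sq_le [Nontrivial H] {b : ℝ} (hb : ∀ φ, b * ‖φ‖ ^ 2 ≤ ‖S φ‖ ^ 2) :
    b ≤ 1 / ‖(S.symm : K →L[ℝ] H)‖ ^ 2 := by
  have h0 := norm_symm_pos (S := S)
  rcases le_or_gt b 0 with hb0 | hb0
  · exact hb0.trans (by positivity)
  have h1 : ‖(S.symm : K →L[ℝ] H)‖ ≤ Real.sqrt b⁻¹ := by
    refine ContinuousLinearMap.opNorm_le_bound _ (Real.sqrt_nonneg _) fun v => ?_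
    refine le_of_sq_le_sq ?_ (by positivity)
    rw [mul_pow, Real.sq_sqrt (by positivity)]
    have := hb (S.symm v)
    rw [S.apply_symm_apply] at this
    rw [le_inv_mul_iff₀ hb0]
    exact this
  have h2 : ‖(S.symm : K →L[ℝ] H)‖ ^ 2 ≤ b⁻¹ := by
    rw [← Real.sq_sqrt (by positivity : 0 ≤ b⁻¹)]
    exact pow_le_pow_left₀ h0.le h1 2
  rw [le_div_iff₀ (by positivity)]
  calc b * _ ≤ b * b⁻¹ := by gcongr
    _ = 1 := mul_inv_cancel₀ hb0.ne'

theorem isGLB_norm_sq [Nontrivial H] : IsGLB {r : ℝ | ∃ φ : H, ‖φ‖ = 1 ∧ r = ‖S φ‖ ^ 2}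
    (1 / ‖(S.symm : K →L[ℝ] H)‖ ^ 2) := by
  refine ⟨?_, fun b hb => le_of_forall_norm_sq_le fun φ => ?_⟩
  · rintro _ ⟨φ, hφ, rfl⟩
    simpa [hφ] using norm_sq_le_of_norm_symm (S := S) φ
  · by_cases h0 : φ = 0
    · simp [h0]
    have hn : 0 < ‖φ‖ := norm_pos_iff.2 h0
    have h1 : b ≤ ‖S (‖φ‖⁻¹ • φ)‖ ^ 2 := hb ⟨‖φ‖⁻¹ • φ, by
      rw [norm_smul, norm_inv, norm_norm, inv_mul_cancel₀ hn.ne'], rfl⟩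
    rw [map_smul, norm_smul, norm_inv, norm_norm, mul_pow, inv_pow] at h1
    rw [mul_comm]
    exact (le_inv_mul_iff₀ (by positivity)).1 h1

/-- The greatest lower bound of the quadratic form of a symmetric operator `B` is the least element
of the spectrum of `B`: if `B - m` were invertible, then the Cauchy–Schwarz inequality for the
positive form of `B - m` would make this form bounded below by a positive constant. -/
theorem isGLB_spectrum [Nontrivial H] (hB : IsSelfAdjoint B)
    (h : ∀ φ, ‖S φ‖ ^ 2 = inner ℝ (B φ) φ) :
    IsGLB (spectrum ℝ B) (1 / ‖(S.symm : K →L[ℝ] H)‖ ^ 2) := by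
  set m := 1 / ‖(S.symm : K →L[ℝ] H)‖ ^ 2 with hm
  have hlow : ∀ φ, m * ‖φ‖ ^ 2 ≤ inner ℝ (B φ) φ := fun φ => by
    rw [← h]; exact norm_sq_le_of_norm_symm φ
  refine IsLeast.isGLB ⟨?_, ?_⟩
  · rw [spectrum.mem_iff]
    intro hu
    rw [← IsUnit.neg_iff, neg_sub] at hu
    set P := B - algebraMap ℝ (H →L[ℝ] H) m with hP
    have hPa : ∀ φ, P φ = B φ - m • φ := fun φ => by
      simp [hP, Algebra.algebraMap_eq_smul_one]
    have hPpos : ∀ φ, 0 ≤ inner ℝ (P φ) φ := fun φ => by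
      rw [hPa, inner_sub_left, inner_smul_left, real_inner_self_eq_norm_sq]
      have := hlow φ
      simp only [conj_trivial]
      linarith
    have hPs : ∀ φ ψ, inner ℝ (P φ) ψ = (inner ℝ φ (P ψ) : ℝ) := fun φ ψ => by
      have : inner ℝ (B φ) ψ = (inner ℝ φ (B ψ) : ℝ) :=
        (ContinuousLinearMap.isSelfAdjoint_iff_isSymmetric.1 hB) φ ψ
      rw [hPa, hPa, inner_sub_left, inner_sub_right, this, inner_smul_left, inner_smul_right]
      rfl
    set p := ‖P‖ + 1 with hp
    have hp0 : 0 < p := by positivity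
    have hcs : ∀ φ, ‖P φ‖ ^ 2 ≤ p * inner ℝ (P φ) φ := by
      intro φ
      have h1 := hPpos (φ + (-p⁻¹) • P φ)
      have h2 : (inner ℝ (P (P φ)) (P φ) : ℝ) ≤ p * ‖P φ‖ ^ 2 := by
        calc _ ≤ ‖P (P φ)‖ * ‖P φ‖ := real_inner_le_norm _ _
          _ ≤ ‖P‖ * ‖P φ‖ * ‖P φ‖ := by gcongr; exact P.le_opNorm _
          _ ≤ p * ‖P φ‖ * ‖P φ‖ := by gcongr; linarith
          _ = _ := by ring
      rw [map_add, map_smul, inner_add_left, inner_add_right, inner_add_right, inner_smul_left,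
        inner_smul_left, inner_smul_right, inner_smul_right, hPs (P φ) φ,
        real_inner_self_eq_norm_sq] at h1
      simp only [conj_trivial] at h1
      have h3 : p⁻¹ * (p⁻¹ * inner ℝ (P (P φ)) (P φ)) ≤ p⁻¹ * ‖P φ‖ ^ 2 := by
        have : p⁻¹ * (p⁻¹ * inner ℝ (P (P φ)) (P φ)) ≤ p⁻¹ * (p⁻¹ * (p * ‖P φ‖ ^ 2)) := by
          gcongr
        rwa [inv_mul_cancel_left₀ hp0.ne'] at this
      have h4 : p⁻¹ * ‖P φ‖ ^ 2 ≤ inner ℝ (P φ) φ := by linarith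
      rwa [inv_mul_le_iff₀ hp0] at h4
    obtain ⟨V, hV⟩ := hu
    set q := ‖((V⁻¹ : (H →L[ℝ] H)ˣ) : H →L[ℝ] H)‖ + 1 with hq
    have hq0 : 0 < q := by positivity
    have hVn : ∀ φ, ‖φ‖ ≤ q * ‖P φ‖ := fun φ => by
      have e : ((V⁻¹ : (H →L[ℝ] H)ˣ) : H →L[ℝ] H) (P φ) = φ := by
        rw [← hV]
        exact DFunLike.congr_fun V.inv_mul φ
      calc ‖φ‖ = ‖((V⁻¹ : (H →L[ℝ] H)ˣ) : H →L[ℝ] H) (P φ)‖ := by rw [e]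
        _ ≤ _ := (ContinuousLinearMap.le_opNorm _ _)
        _ ≤ q * ‖P φ‖ := by gcongr; linarith
    have hfin : m + (q ^ 2 * p)⁻¹ ≤ m := by
      refine le_of_forall_norm_sq_le fun φ => ?_
      have h1 := pow_le_pow_left₀ (norm_nonneg _) (hVn φ) 2
      have h2 := hcs φ
      have h3 : (inner ℝ (P φ) φ : ℝ) = ‖S φ‖ ^ 2 - m * ‖φ‖ ^ 2 := by
        rw [hPa, inner_sub_left, inner_smul_left, real_inner_self_eq_norm_sq, h]
        rfl
      have h4 : (q ^ 2 * p)⁻¹ * ‖φ‖ ^ 2 ≤ inner ℝ (P φ) φ := by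
        rw [inv_mul_le_iff₀ (by positivity)]
        calc ‖φ‖ ^ 2 ≤ (q * ‖P φ‖) ^ 2 := h1
          _ = q ^ 2 * ‖P φ‖ ^ 2 := by ring
          _ ≤ q ^ 2 * (p * inner ℝ (P φ) φ) := by gcongr
          _ = _ := by ring
      linarith
    have : 0 < (q ^ 2 * p)⁻¹ := by positivity
    linarith
  · intro r hr
    by_contra! hlt
    refine hr ?_
    change IsUnit _
    rw [← IsUnit.neg_iff, neg_sub]
    refine ContinuousLinearMap.isUnit_of_forall_le_norm_inner_map _
      (c := ⟨m - r, (sub_pos.2 hlt).le⟩) (sub_pos.2 hlt) fun φ => ?_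
    have e : (B - algebraMap ℝ (H →L[ℝ] H) r) φ = B φ - r • φ := by
      simp [Algebra.algebraMap_eq_smul_one]
    rw [e, inner_sub_left, inner_smul_left, real_inner_self_eq_norm_sq]
    refine le_trans ?_ (le_abs_self _)
    have := hlow φ
    simp only [conj_trivial]
    change ‖φ‖ ^ 2 * (m - r) ≤ _
    linarith

end Factorization

/-- The function `t ↦ (t - 1/2) v` is a nonzero element of `L²₀`. -/
theorem nontrivial_L20 {n : ℕ} (hn : 0 < n) : Nontrivial (L20 n) := by
  set v : Vec n := EuclideanSpace.single ⟨0, hn⟩ 1 with hv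
  have hc : ContinuousOn (fun t : ℝ => (t - 1 / 2) • v) (Icc 0 1) := by fun_prop
  set φ : L2 n := contToLp (Vec n) 2 (restrictC hc) with hφ
  have hp : ∀ t ∈ Icc (0 : ℝ) 1, prim φ t = (t ^ 2 / 2 - t / 2) • v := fun t ht => by
    rw [prim, integral_congr_unitVolume (contToLp_restrictC hc 2) zero_mem_unitInterval ht,
      intervalIntegral.integral_smul_const, intervalIntegral.integral_sub
      intervalIntegral.intervalIntegrable_id intervalIntegrable_const]
    congr 1
    simp
    ring
  have h0 : φ ∈ L20 n := by
    change prim φ 1 = 0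
    rw [hp 1 one_mem_unitInterval]
    norm_num
  refine ⟨⟨φ, h0⟩, 0, fun h => ?_⟩
  have h1 := hp (1 / 2) ⟨by norm_num, by norm_num⟩
  have h2 : prim φ (1 / 2) = 0 :=
    congrFun (congrArg Subtype.val ((congrArg (primLin n) h).trans (map_zero _)))
      ⟨1 / 2, by norm_num, by norm_num⟩
  rw [h2] at h1
  have h3 := congrArg (fun w : Vec n => w ⟨0, hn⟩) h1
  norm_num [hv] at h3

/-! ### Superposition operators -/

section Superposition

set_option synthInstance.maxHeartbeats 400000

variable {K : Type*} [TopologicalSpace K] [CompactSpace K]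

section

variable {V W : Type*} [NormedAddCommGroup V] [NormedSpace ℝ V] [NormedAddCommGroup W]
  [NormedSpace ℝ W]

/-- Pointwise application of a continuous operator valued function to a continuous function. -/
def mulC (K V W : Type*) [TopologicalSpace K] [CompactSpace K] [NormedAddCommGroup V]
    [NormedSpace ℝ V] [NormedAddCommGroup W] [NormedSpace ℝ W] :
    C(K, V →L[ℝ] W) →L[ℝ] C(K, V) →L[ℝ] C(K, W) :=
  LinearMap.mkContinuous₂
    (LinearMap.mk₂ ℝ (fun (b : C(K, V →L[ℝ] W)) (a : C(K, V)) =>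
        (⟨fun t => b t (a t), b.continuous.clm_apply a.continuous⟩ : C(K, W)))
      (fun _ _ _ => ContinuousMap.ext fun _ => rfl)
      (fun _ _ _ => ContinuousMap.ext fun _ => rfl)
      (fun b a a' => ContinuousMap.ext fun t => (b t).map_add (a t) (a' t))
      (fun r b a => ContinuousMap.ext fun t => (b t).map_smul r (a t)))
    1 fun b a => by
      refine (ContinuousMap.norm_le _ (by positivity)).2 fun t => ?_
      rw [one_mul]
      exact ((b t).le_opNorm _).trans
        (mul_le_mul (b.norm_coe_le_norm t) (a.norm_coe_le_norm t) (norm_nonneg (a t))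
          (norm_nonneg b))

/-- A continuous map is uniformly continuous along the compact image of `a`. -/
theorem exists_delta_comp {F₁ F₂ : Type*} [NormedAddCommGroup F₁] [NormedAddCommGroup F₂]
    (g : C(F₁, F₂)) (a : C(K, F₁)) {ε : ℝ} (hε : 0 < ε) :
    ∃ δ > 0, ∀ b : C(K, F₁), ‖b - a‖ < δ → ∀ t, ‖g (b t) - g (a t)‖ < ε := by
  obtain ⟨δ, hδ, H⟩ := Metric.continuousAt_iff.1
    (ContinuousMap.continuous_postcomp (X := K) g).continuousAt ε hε
  refine ⟨δ, hδ, fun b hb t => ?_⟩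
  rw [← dist_eq_norm]
  exact (ContinuousMap.dist_apply_le_dist t).trans_lt (H (by rwa [dist_eq_norm]))

/-- The superposition operator of a `C¹` function is differentiable. The derivative of the function
is uniformly continuous near the range of `a` because superposition with it is continuous. -/
theorem hasFDerivAt_comp (G : C(V, W)) (G' : C(V, V →L[ℝ] W))
    (hG : ∀ y, HasFDerivAt G (G' y) y) (a : C(K, V)) :
    HasFDerivAt (fun b : C(K, V) => G.comp b) (mulC K V W (G'.comp a)) a := by
  rw [hasFDerivAt_iff_isLittleO_nhds_zero, Asymptotics.isLittleO_iff]
  intro ε hε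
  obtain ⟨δ, hδ, H⟩ := exists_delta_comp G' a hε
  filter_upwards [Metric.ball_mem_nhds (0 : C(K, V)) hδ] with h hh
  rw [mem_ball_zero_iff] at hh
  refine (ContinuousMap.norm_le _ (by positivity)).2 fun t => ?_
  change ‖G (a t + h t) - G (a t) - G' (a t) (h t)‖ ≤ _
  have key : ‖G (a t + h t) - G (a t) - G' (a t) (a t + h t - a t)‖ ≤
      ε * ‖a t + h t - a t‖ := by
    refine (convex_segment (a t) (a t + h t)).norm_image_sub_le_of_norm_hasFDerivWithin_le'
      (fun y _ => (hG y).hasFDerivWithinAt) (fun y hy => ?_) (left_mem_segment ℝ _ _)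
      (right_mem_segment ℝ _ _)
    rw [segment_eq_image'] at hy
    obtain ⟨θ, hθ, rfl⟩ := hy
    have h1 : ‖a + θ • h - a‖ < δ := by
      rw [add_sub_cancel_left, norm_smul, Real.norm_of_nonneg hθ.1]
      exact (mul_le_of_le_one_left (norm_nonneg _) hθ.2).trans_lt hh
    have h2 := H _ h1 t
    simpa using h2.le
  rw [add_sub_cancel_left] at key
  exact key.trans (by gcongr; exact h.norm_coe_le_norm t)

end

/-- The superposition operator of a `C^k` function is `C^k`: its derivative is the superposition
operator of the derivative, followed by a bounded operator. -/
theorem contDiff_comp {V : Type} [NormedAddCommGroup V] [NormedSpace ℝ V] (k : ℕ) :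
    ∀ {W : Type} [NormedAddCommGroup W] [NormedSpace ℝ W] (G : C(V, W)), ContDiff ℝ k G →
      ContDiff ℝ k (fun b : C(K, V) => G.comp b) := by
  induction k with
  | zero =>
    intro W _ _ G _
    exact contDiff_zero.2 (ContinuousMap.continuous_postcomp G)
  | succ k ih =>
    intro W _ _ G hG
    have hG' : ContDiff ℝ (k + 1) G := by exact_mod_cast hG
    obtain ⟨G', hG'1, hG'2⟩ := contDiff_succ_iff_hasFDerivAt.1 hG'
    have h := contDiff_succ_iff_hasFDerivAt.2 ⟨fun a => mulC K V W
      ((⟨G', hG'1.continuous⟩ : C(V, V →L[ℝ] W)).comp a),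
      (mulC K V W).contDiff.comp (ih ⟨G', hG'1.continuous⟩ hG'1), fun a =>
      hasFDerivAt_comp G ⟨G', hG'1.continuous⟩ hG'2 a⟩
    exact_mod_cast h

end Superposition

/-! ### Second derivatives along rays -/

section Rays

variable {H : Type*} [NormedAddCommGroup H] [InnerProductSpace ℝ H] [CompleteSpace H]

/-- A `C²` function on a Hilbert space whose derivatives along the rays from `0` are known to second
order has the corresponding gradient and Hessian at `0`. -/
theorem hasFDerivAt_gradient_of_rays {f : H → ℝ} (hf : ContDiff ℝ 2 f) {A : H →L[ℝ] H}
    (hA : ∀ h k, inner ℝ (A h) k = (inner ℝ h (A k) : ℝ))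
    (hray : ∀ h : H, ∃ g : ℝ → ℝ, (∀ s, HasDerivAt (fun s : ℝ => f (s • h)) (g s) s) ∧ g 0 = 0 ∧
      HasDerivAt g (inner ℝ (A h) h) 0) :
    gradient f 0 = 0 ∧ HasFDerivAt (gradient f) A 0 := by
  have hd : Differentiable ℝ f := hf.differentiable (by simp)
  have hdd : Differentiable ℝ (fderiv ℝ f) :=
    (hf.fderiv_right (m := 1) (by norm_num)).differentiable (by simp)
  have hl : ∀ (h : H) (s : ℝ), HasDerivAt (fun s : ℝ => s • h) h s := fun h s => by
    simpa using (hasDerivAt_id s).smul_const h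
  have hg : ∀ (h : H) (s : ℝ), HasDerivAt (fun s : ℝ => f (s • h)) (fderiv ℝ f (s • h) h) s :=
    fun h s => (hd (s • h)).hasFDerivAt.comp_hasDerivAt s (hl h s)
  have hgr : ∀ x, gradient f x = (InnerProductSpace.toDual ℝ H).symm (fderiv ℝ f x) := fun _ => rfl
  have hinner : ∀ x y, inner ℝ (gradient f x) y = fderiv ℝ f x y := fun x y => by
    rw [hgr, InnerProductSpace.toDual_symm_apply]
  set D2 := fderiv ℝ (fderiv ℝ f) 0 with hD2
  have hdiag : ∀ h, D2 h h = inner ℝ (A h) h := by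
    intro h
    obtain ⟨g, h1, -, h3⟩ := hray h
    have e : g = fun s => fderiv ℝ f (s • h) h := funext fun s => (h1 s).unique (hg h s)
    rw [e] at h3
    have h4 : HasDerivAt (fun s : ℝ => fderiv ℝ f (s • h)) (D2 h) 0 := by
      have := (hdd ((0 : ℝ) • h)).hasFDerivAt.comp_hasDerivAt 0 (hl h 0)
      rwa [zero_smul] at this
    have h5 := h4.clm_apply (hasDerivAt_const 0 h)
    rw [map_zero, add_zero] at h5
    exact h5.unique h3
  have hsymm : ∀ h k, D2 h k = D2 k h := fun h k =>
    (hf.contDiffAt.isSymmSndFDerivAt (by simp)) h k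
  have hpol : ∀ h k, D2 h k = inner ℝ (A h) k := by
    intro h k
    have h1 := hdiag (h + k)
    simp only [map_add, add_apply, inner_add_left, inner_add_right] at h1
    linarith [hdiag h, hdiag k, hsymm k h, hA k h, real_inner_comm (A h) k]
  refine ⟨?_, ?_⟩
  · refine ext_inner_right ℝ fun h => ?_
    obtain ⟨g, h1, h2, -⟩ := hray h
    rw [hinner, inner_zero_left, ← h2]
    have := (hg h 0).unique (h1 0)
    rwa [zero_smul] at this
  · set L : (H →L[ℝ] ℝ) →L[ℝ] H := LinearMap.mkContinuous
      { toFun := (InnerProductSpace.toDual ℝ H).symm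
        map_add' := map_add _
        map_smul' := fun r l => (InnerProductSpace.toDual ℝ H).symm.map_smulₛₗ r l } 1
      fun l => by simp
    have h1 : HasFDerivAt (gradient f) (L ∘L D2) 0 :=
      L.hasFDerivAt.comp (0 : H) (hdd 0).hasFDerivAt
    refine h1.congr_fderiv ?_
    ext1 h
    refine ext_inner_right ℝ fun k => ?_
    change inner ℝ ((InnerProductSpace.toDual ℝ H).symm (D2 h)) k = _
    rw [InnerProductSpace.toDual_symm_apply, hpol]

end Rays

section Cutoff

variable {V W : Type*} [NormedAddCommGroup V] [NormedSpace ℝ V] [FiniteDimensional ℝ V]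
  [NormedAddCommGroup W] [NormedSpace ℝ W]

/-- A smooth function on an open set agrees near a compact subset with a smooth function on the
whole space. -/
theorem exists_contDiff_eqOn_nhdsSet {Ω s : Set V} (hΩ : IsOpen Ω) (hs : IsCompact s) (hsΩ : s ⊆ Ω)
    {G : V → W} (hG : ContDiffOn ℝ ∞ G Ω) :
    ∃ G₁ : V → W, ContDiff ℝ ∞ G₁ ∧ ∀ᶠ y in 𝓝ˢ s, G₁ y = G y := by
  obtain ⟨χ, h0, h1, -⟩ := exists_contMDiffMap_zero_one_nhds_of_isClosed (n := (⊤ : ℕ∞)) 𝓘(ℝ, V)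
    hΩ.isClosed_compl hs.isClosed (disjoint_compl_left_iff_subset.2 hsΩ)
  have hχ : ContDiff ℝ ∞ χ := χ.contMDiff.contDiff
  refine ⟨fun y => χ y • G y, contDiff_iff_contDiffAt.2 fun y => ?_, ?_⟩
  · by_cases hy : y ∈ Ω
    · exact hχ.contDiffAt.smul (hG.contDiffAt (hΩ.mem_nhds hy))
    · have : (fun y => χ y • G y) =ᶠ[𝓝 y] fun _ => 0 := by
        filter_upwards [h0.filter_mono (nhds_le_nhdsSet hy)] with z hz
        rw [hz, zero_smul]
      exact contDiffAt_const.congr_of_eventuallyEq this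
  · filter_upwards [h1] with y hy
    rw [hy, one_smul]

end Cutoff

/-! ### The first and second variation of the energy in coordinates -/

section Variation

set_option linter.unusedSectionVars false

open Filter

set_option synthInstance.maxHeartbeats 400000

variable {E : Type*} [NormedAddCommGroup E] [InnerProductSpace ℝ E] [FiniteDimensional ℝ E]
  {Ω : Set (E)} {G : E → E →L[ℝ] E}
  {Γ : E → E →L[ℝ] E →L[ℝ] E} {x p : ℝ → E}
  {B R : ℝ → E →L[ℝ] E}

/-- The derivative of the vector field `B(t) h(t)` in coordinates, for a parallel frame `B` along
a curve `x` with velocity `p`. -/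
def frameFieldDeriv (Γ : E → E →L[ℝ] E →L[ℝ] E) (x p : ℝ → E)
    (B : ℝ → E →L[ℝ] E) (h h' : ℝ → E) (t : ℝ) : E :=
  -Γ (x t) (p t) (B t (h t)) + B t (h' t)

theorem frameFieldDeriv_add_conn (h h' : ℝ → E) (t : ℝ) :
    frameFieldDeriv Γ x p B h h' t + Γ (x t) (p t) (B t (h t)) = B t (h' t) := by
  simp [frameFieldDeriv]

theorem AbsolutelyContinuousOnInterval.clm_apply {V W : Type*} [NormedAddCommGroup V]
    [NormedSpace ℝ V] [NormedAddCommGroup W]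
    [NormedSpace ℝ W] {f : ℝ → V →L[ℝ] W} {g : ℝ → V} {a b : ℝ}
    (hf : AbsolutelyContinuousOnInterval f a b) (hg : AbsolutelyContinuousOnInterval g a b) :
    AbsolutelyContinuousOnInterval (fun t => f t (g t)) a b :=
  PathHessian.AbsolutelyContinuousOnInterval.clm_apply₂ (ContinuousLinearMap.id ℝ (V →L[ℝ] W)) hf hg

namespace IsFrameAlong

variable (F : IsFrameAlong Ω G Γ x p B R)
include F

theorem hasDerivWithinAt_frame {t : ℝ} (ht : t ∈ Icc (0 : ℝ) 1) :
    HasDerivWithinAt B (-(Γ (x t) (p t) ∘L B t)) (Icc 0 1) t :=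
  hasDerivWithinAt_clm_of_apply fun v => F.parallel t ht v

theorem continuousOn_frameDeriv :
    ContinuousOn (fun t => -(Γ (x t) (p t) ∘L B t)) (Icc 0 1) :=
  ((F.continuousOn_Γ.clm_apply F.continuousOn_p).clm_comp F.continuousOn_B).neg

theorem absolutelyContinuousOnInterval_velocity : AbsolutelyContinuousOnInterval p 0 1 :=
  absolutelyContinuousOnInterval_of_hasDerivWithinAt zero_le_one F.geodesic
    ((F.continuousOn_Γ.clm_apply F.continuousOn_p).clm_apply F.continuousOn_p).neg

theorem absolutelyContinuousOnInterval_comp {W : Type*} [NormedAddCommGroup W] [NormedSpace ℝ W]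
    {g : E → W} (hg : ContDiffOn ℝ ∞ g Ω) :
    AbsolutelyContinuousOnInterval (fun t => g (x t)) 0 1 :=
  absolutelyContinuousOnInterval_of_hasDerivWithinAt zero_le_one
    (fun t ht => ((hg.contDiffAt (F.leviCivita.isOpen.mem_nhds (F.mem t ht))).differentiableAt
      (by simp)).hasFDerivAt.comp_hasDerivWithinAt t (F.deriv t ht))
    (((hg.continuousOn_fderiv_of_isOpen F.leviCivita.isOpen
      (by simp)).comp F.continuousOn_x F.mem).clm_apply F.continuousOn_p)

theorem absolutelyContinuousOnInterval_metric :
    AbsolutelyContinuousOnInterval (fun t => G (x t)) 0 1 :=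
  F.absolutelyContinuousOnInterval_comp F.leviCivita.contDiffOn_metric

theorem hasDerivWithinAt_conn {t : ℝ} (ht : t ∈ Icc (0 : ℝ) 1) :
    HasDerivWithinAt (fun t => Γ (x t)) (fderiv ℝ Γ (x t) (p t)) (Icc 0 1) t := by
  have h0 := (F.leviCivita.differentiableAt_conn (F.mem t ht)).hasFDerivAt
  exact HasFDerivAt.comp_hasDerivWithinAt (l := Γ) t h0 (F.deriv t ht)

theorem absolutelyContinuousOnInterval_conn :
    AbsolutelyContinuousOnInterval (fun t => Γ (x t)) 0 1 :=
  F.absolutelyContinuousOnInterval_comp (W := E →L[ℝ] E →L[ℝ] E) (g := Γ)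
    F.leviCivita.contDiffOn_conn

theorem absolutelyContinuousOnInterval_conn_apply {a b : ℝ → E}
    (ha : AbsolutelyContinuousOnInterval a 0 1) (hb : AbsolutelyContinuousOnInterval b 0 1) :
    AbsolutelyContinuousOnInterval (fun t => Γ (x t) (a t) (b t)) 0 1 := by
  have h1 : AbsolutelyContinuousOnInterval (fun t => Γ (x t) (a t)) 0 1 :=
    PathHessian.AbsolutelyContinuousOnInterval.clm_apply F.absolutelyContinuousOnInterval_conn ha
  exact PathHessian.AbsolutelyContinuousOnInterval.clm_apply h1 hb

theorem absolutelyContinuousOnInterval_field {h : ℝ → E}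
    (hac : AbsolutelyContinuousOnInterval h 0 1) :
    AbsolutelyContinuousOnInterval (fun t => B t (h t)) 0 1 :=
  PathHessian.AbsolutelyContinuousOnInterval.clm_apply
    (absolutelyContinuousOnInterval_of_hasDerivWithinAt zero_le_one
      (fun _ ht => F.hasDerivWithinAt_frame ht) F.continuousOn_frameDeriv)
    hac

theorem ae_hasDerivAt_field {h h' : ℝ → E}
    (hd : ∀ᵐ t, t ∈ Ioo (0 : ℝ) 1 → HasDerivAt h (h' t) t) : ∀ᵐ t, t ∈ Ioo (0 : ℝ) 1 →
    HasDerivAt (fun t => B t (h t)) (frameFieldDeriv Γ x p B h h' t) t := by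
  filter_upwards [hd] with t ht htI
  exact ((F.hasDerivWithinAt_frame (Ioo_subset_Icc_self htI)).hasDerivAt
    (Icc_mem_nhds htI.1 htI.2)).clm_apply (ht htI)

/-- The first variation of the energy at a geodesic vanishes: its density is the derivative of
`⟨p, H⟩`. -/
theorem first_variation {h h' : ℝ → E} (hh : AbsolutelyContinuousOnInterval h 0 1)
    (hd : ∀ᵐ t, t ∈ Ioo (0 : ℝ) 1 → HasDerivAt h (h' t) t) (h0 : h 0 = 0) (h1 : h 1 = 0) :
    ∫ t in (0 : ℝ)..1, ((1 / 2) * inner ℝ (fderiv ℝ G (x t) (B t (h t)) (p t)) (p t)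
      + inner ℝ (G (x t) (p t)) (frameFieldDeriv Γ x p B h h' t)) = 0 := by
  have hac : AbsolutelyContinuousOnInterval
      (fun t => innerSL ℝ (G (x t) (p t)) (B t (h t))) 0 1 :=
    PathHessian.AbsolutelyContinuousOnInterval.clm_apply₂ (innerSL ℝ)
      (PathHessian.AbsolutelyContinuousOnInterval.clm_apply F.absolutelyContinuousOnInterval_metric
        F.absolutelyContinuousOnInterval_velocity)
      (F.absolutelyContinuousOnInterval_field hh)
  have hI := (PathHessian.AbsolutelyContinuousOnInterval.integral_eq_sub
    (q' := fun t =>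
      (1 / 2) * inner ℝ (fderiv ℝ G (x t) (B t (h t)) (p t)) (p t)
      + inner ℝ (G (x t) (p t)) (frameFieldDeriv Γ x p B h h' t)) zero_le_one hac (by
      filter_upwards [F.ae_hasDerivAt_field hd] with t h2 ht
      have htI := Ioo_subset_Icc_self ht
      have hy := F.mem t htI
      have h3 := (F.leviCivita.hasDerivWithinAt_inner hy (F.deriv t htI) (F.geodesic t htI)
        (h2 ht).hasDerivWithinAt).hasDerivAt (Icc_mem_nhds ht.1 ht.2)
      refine h3.congr_deriv ?_
      rw [frameFieldDeriv_add_conn, neg_add_cancel, map_zero, inner_zero_left, zero_add,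
        F.leviCivita.compat _ hy, ← frameFieldDeriv_add_conn, inner_add_right,
        F.leviCivita.torsionFree _ hy (p t), F.leviCivita.symm _ hy (p t) (Γ (x t) _ (p t))]
      ring)).2
  rw [hI]
  simp only [h0, h1, map_zero, sub_zero]

/-- The second variation of the energy at a geodesic. -/
theorem second_variation {h h' : ℝ → E} (hh : AbsolutelyContinuousOnInterval h 0 1)
    (hd : ∀ᵐ t, t ∈ Ioo (0 : ℝ) 1 → HasDerivAt h (h' t) t) (h0 : h 0 = 0) (h1 : h 1 = 0)
    (hsq : IntervalIntegrable (fun t => ‖h' t‖ ^ 2) volume 0 1) :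
    ∫ t in (0 : ℝ)..1, ((1 / 2) * inner ℝ (fderiv ℝ (fderiv ℝ G) (x t)
        (B t (h t)) (B t (h t)) (p t)) (p t)
      + 2 * inner ℝ (fderiv ℝ G (x t) (B t (h t)) (p t))
        (frameFieldDeriv Γ x p B h h' t)
      + inner ℝ (G (x t) (frameFieldDeriv Γ x p B h h' t))
        (frameFieldDeriv Γ x p B h h' t)) =
    (∫ t in (0 : ℝ)..1, ‖h' t‖ ^ 2) - ∫ t in (0 : ℝ)..1, inner ℝ (R t (h t)) (h t) := by
  set H : ℝ → E := fun t => B t (h t) with hH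
  set H' : ℝ → E := frameFieldDeriv Γ x p B h h' with hH'
  set q' : ℝ → ℝ := fun t =>
    inner ℝ (G (x t) ((fderiv ℝ Γ (x t) (p t) (H t) (H t) +
      (Γ (x t) (H' t) (H t) + Γ (x t) (H t) (H' t))) + Γ (x t) (p t) (Γ (x t) (H t) (H t)))) (p t)
        + inner ℝ (G (x t) (Γ (x t) (H t) (H t))) (-Γ (x t) (p t) (p t) + Γ (x t) (p t) (p t))
    with hq'
  have hac : AbsolutelyContinuousOnInterval
      (fun t => innerSL ℝ (G (x t) (Γ (x t) (H t) (H t))) (p t)) 0 1 :=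
    PathHessian.AbsolutelyContinuousOnInterval.clm_apply₂ (innerSL ℝ)
      (PathHessian.AbsolutelyContinuousOnInterval.clm_apply F.absolutelyContinuousOnInterval_metric
        (F.absolutelyContinuousOnInterval_conn_apply (F.absolutelyContinuousOnInterval_field hh)
          (F.absolutelyContinuousOnInterval_field hh)))
      F.absolutelyContinuousOnInterval_velocity
  have hI := PathHessian.AbsolutelyContinuousOnInterval.integral_eq_sub (q' := q') zero_le_one hac (by
      filter_upwards [F.ae_hasDerivAt_field hd] with t h2 ht
      have htI := Ioo_subset_Icc_self ht
      have hy := F.mem t htI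
      have h3 : HasDerivWithinAt (fun t => Γ (x t) (H t) (H t))
          (fderiv ℝ Γ (x t) (p t) (H t) (H t) +
            (Γ (x t) (H' t) (H t) + Γ (x t) (H t) (H' t))) (Icc 0 1) t := by
        refine (((F.hasDerivWithinAt_conn htI).clm_apply (h2 ht).hasDerivWithinAt).clm_apply
          (h2 ht).hasDerivWithinAt).congr_deriv ?_
        simp only [add_apply]
        abel
      exact (F.leviCivita.hasDerivWithinAt_inner hy (F.deriv t htI) h3
        (F.geodesic t htI)).hasDerivAt (Icc_mem_nhds ht.1 ht.2))
  have hq0 : ∫ t in (0 : ℝ)..1, q' t = 0 := by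
    rw [hI.2]
    simp only [hH, h0, h1, map_zero, zero_apply, sub_zero]
  have hc : ContinuousOn h (Icc 0 1) := by
    have := hh.continuousOn
    rwa [uIcc_of_le zero_le_one] at this
  have hR : IntervalIntegrable
      (fun t => (inner ℝ (R t (h t)) (h t) : ℝ)) volume 0 1 := by
    refine ContinuousOn.intervalIntegrable ?_
    rw [uIcc_of_le zero_le_one]
    exact (F.continuousOn_R.clm_apply hc).inner hc
  rw [← intervalIntegral.integral_sub hsq hR]
  refine Eq.trans ?_ ((intervalIntegral.integral_add (hsq.sub hR) hI.1).trans
    (by rw [hq0, add_zero]))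
  refine intervalIntegral.integral_congr fun t ht => ?_
  rw [uIcc_of_le zero_le_one] at ht
  have hy := F.mem t ht
  have e := F.leviCivita.second_variation_density hy (p t) (H t) (H' t)
  have e1 : H' t + Γ (x t) (p t) (H t) = B t (h' t) := frameFieldDeriv_add_conn _ _ t
  rw [e1, F.isometry t ht, real_inner_self_eq_norm_sq, ← F.inner_R ht] at e
  exact e

end IsFrameAlong

end Variation

/-! ### The energy as a smooth function of the derivative of the path -/

section Rays

set_option synthInstance.maxHeartbeats 400000

theorem hasDerivAt_line {V : Type*} [NormedAddCommGroup V] [NormedSpace ℝ V] (w W : V) (s : ℝ) :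
    HasDerivAt (fun s : ℝ => w + s • W) W s := by
  simpa using ((hasDerivAt_id s).smul_const W).const_add w

variable {K : Type*} [TopologicalSpace K] [CompactSpace K]
variable {V W : Type*} [NormedAddCommGroup V] [NormedSpace ℝ V] [NormedAddCommGroup W]
  [NormedSpace ℝ W]

theorem hasDerivAt_comp_ray (g : C(V, W)) (g' : C(V, V →L[ℝ] W))
    (hg : ∀ y, HasFDerivAt g (g' y) y) (a h : C(K, V)) (s : ℝ) :
    HasDerivAt (fun s : ℝ => g.comp (a + s • h)) (mulC K V W (g'.comp (a + s • h)) h) s :=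
  HasFDerivAt.comp_hasDerivAt (l := fun b : C(K, V) => g.comp b) s
    (hasFDerivAt_comp g g' hg (a + s • h)) (hasDerivAt_line a h s)

/-- The first two derivatives of a superposition operator along a ray. -/
theorem exists_ray_derivs {g : V → W} (hg : ContDiff ℝ 2 g) (a h : C(K, V)) :
    ∃ (a₁ : ℝ → C(K, W)) (a₂ : C(K, W)),
      (∀ s, HasDerivAt (fun s : ℝ => (⟨g, hg.continuous⟩ : C(V, W)).comp (a + s • h)) (a₁ s) s) ∧
      HasDerivAt a₁ a₂ 0 ∧ (∀ t, a₁ 0 t = fderiv ℝ g (a t) (h t)) ∧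
      ∀ t, a₂ t = fderiv ℝ (fderiv ℝ g) (a t) (h t) (h t) := by
  have hg1 : ContDiff ℝ 1 (fderiv ℝ g) := hg.fderiv_right (by norm_num)
  set G : C(V, W) := ⟨g, hg.continuous⟩
  set G' : C(V, V →L[ℝ] W) := ⟨fderiv ℝ g, hg1.continuous⟩
  set G'' : C(V, V →L[ℝ] V →L[ℝ] W) :=
    ⟨fderiv ℝ (fderiv ℝ g), hg1.continuous_fderiv (by norm_num)⟩
  have h1 : ∀ y, HasFDerivAt G (G' y) y := fun y =>
    (hg.differentiable (by norm_num) y).hasFDerivAt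
  have h2 : ∀ y, HasFDerivAt G' (G'' y) y := fun y =>
    (hg1.differentiable (by norm_num) y).hasFDerivAt
  have hr := hasDerivAt_comp_ray G' G'' h2 a h 0
  have hr' := ((mulC K V W).flip h).hasFDerivAt.comp_hasDerivAt (0 : ℝ) hr
  refine ⟨fun s => mulC K V W (G'.comp (a + s • h)) h, _, hasDerivAt_comp_ray G G' h1 a h, hr',
    fun t => ?_, fun t => ?_⟩
  · change fderiv ℝ g (a t + (0 : ℝ) • h t) (h t) = _
    rw [zero_smul, add_zero]
  · change fderiv ℝ (fderiv ℝ g) (a t + (0 : ℝ) • h t) (h t) (h t) = _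
    rw [zero_smul, add_zero]

variable {H : Type*} [NormedAddCommGroup H] [InnerProductSpace ℝ H]

theorem hasDerivAt_inner_mul (M : W →L[ℝ] H →L[ℝ] H) {a : ℝ → W} {a' : W} {v w : ℝ → H} {v' w' : H}
    {s : ℝ} (ha : HasDerivAt a a' s) (hv : HasDerivAt v v' s) (hw : HasDerivAt w w' s) :
    HasDerivAt (fun s => (inner ℝ (M (a s) (v s)) (w s) : ℝ))
      (inner ℝ (M a' (v s)) (w s) + inner ℝ (M (a s) v') (w s) + inner ℝ (M (a s) (v s)) w') s := by
  have h1 : HasDerivAt (fun s => M (a s)) (M a') s := M.hasFDerivAt.comp_hasDerivAt s ha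
  refine ((h1.clm_apply hv).inner ℝ hw).congr_deriv ?_
  rw [inner_add_left]
  ring

/-- The first two derivatives of a quadratic expression along a ray. -/
theorem exists_quadratic_ray (M : W →L[ℝ] H →L[ℝ] H) {a a₁ : ℝ → W} {a₂ : W}
    (ha : ∀ s, HasDerivAt a (a₁ s) s) (ha₁ : HasDerivAt a₁ a₂ 0) (v w : H) :
    ∃ g : ℝ → ℝ,
      (∀ s, HasDerivAt (fun s => (1 / 2) * inner ℝ (M (a s) (v + s • w)) (v + s • w)) (g s) s) ∧
      g 0 = (1 / 2) * inner ℝ (M (a₁ 0) v) v + (1 / 2) * inner ℝ (M (a 0) w) v +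
        (1 / 2) * inner ℝ (M (a 0) v) w ∧
      HasDerivAt g ((1 / 2) * inner ℝ (M a₂ v) v + inner ℝ (M (a₁ 0) w) v +
        inner ℝ (M (a₁ 0) v) w + inner ℝ (M (a 0) w) w) 0 := by
  have hl := hasDerivAt_line v w
  refine ⟨_, fun s => (hasDerivAt_inner_mul M (ha s) (hl s) (hl s)).const_mul (1 / 2 : ℝ), ?_, ?_⟩
  · simp only [zero_smul, add_zero]
    ring
  · refine ((((hasDerivAt_inner_mul M ha₁ (hl 0) (hl 0)).add
      (hasDerivAt_inner_mul M (ha 0) (hasDerivAt_const 0 w) (hl 0))).add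
      (hasDerivAt_inner_mul M (ha 0) (hl 0) (hasDerivAt_const 0 w))).const_mul
      (1 / 2 : ℝ)).congr_deriv ?_
    simp only [zero_smul, add_zero, map_zero, inner_zero_left, inner_zero_right]
    ring

theorem contDiff_inner_mul {V : Type*} [NormedAddCommGroup V] [NormedSpace ℝ V] {k : ℕ∞ω}
    (M : W →L[ℝ] H →L[ℝ] H) {a : V → W} {w : V → H} (ha : ContDiff ℝ k a) (hw : ContDiff ℝ k w) :
    ContDiff ℝ k (fun v => (1 / 2) * (inner ℝ (M (a v) (w v)) (w v) : ℝ)) :=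
  contDiff_const.mul (((M.contDiff.comp ha).clm_apply hw).inner ℝ hw)

end Rays

section CoordinateEnergy

open Filter

set_option synthInstance.maxHeartbeats 400000

variable {n : ℕ} {Ω : Set (Vec n)} {G : Vec n → Vec n →L[ℝ] Vec n}
  {Γ : Vec n → Vec n →L[ℝ] Vec n →L[ℝ] Vec n} {x p : ℝ → Vec n}
  {B R : ℝ → Vec n →L[ℝ] Vec n}

theorem mulL2_ae {a : C(Icc (0 : ℝ) 1, Vec n →L[ℝ] Vec n)} {b : ℝ → Vec n →L[ℝ] Vec n}
    (hab : ∀ t : Icc (0 : ℝ) 1, a t = b t) {φ : L2 n} {f : ℝ → Vec n} (hφ : φ =ᵐ[unitVolume] f) :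
    mulL2 n a φ =ᵐ[unitVolume] fun t => b t (f t) := by
  filter_upwards [mulL2_coe a φ, hφ, ae_restrict_mem measurableSet_Icc] with t h1 h2 ht
  rw [h1, h2, IccExtend_of_mem _ _ ht, hab]

namespace IsFrameAlong

variable (F : IsFrameAlong Ω G Γ x p B R)
include F

/-- The displacement `B(t) ∫₀ᵗ φ`, as a continuous function that depends linearly on `φ`. -/
def disp : L2 n →L[ℝ] C(Icc (0 : ℝ) 1, Vec n) :=
  mulC (Icc (0 : ℝ) 1) (Vec n) (Vec n) (restrictC F.continuousOn_B) ∘L primC n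

/-- The derivative of the displacement `B(t) ∫₀ᵗ φ`, as an element of `L²`. -/
def dispDeriv : L2 n →L[ℝ] L2 n :=
  mulVolterra F.continuousOn_frameDeriv + mulL2 n (restrictC F.continuousOn_B)

theorem dispDeriv_coe (φ : L2 n) :
    F.dispDeriv φ =ᵐ[unitVolume] frameFieldDeriv Γ x p B (prim φ) φ := by
  filter_upwards [Lp.coeFn_add (mulVolterra F.continuousOn_frameDeriv φ)
    (mulL2 n (restrictC F.continuousOn_B) φ), mulVolterra_coe F.continuousOn_frameDeriv φ,
    mulL2_restrictC F.continuousOn_B φ] with t h1 h2 h3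
  change (mulVolterra F.continuousOn_frameDeriv φ + mulL2 n (restrictC F.continuousOn_B) φ : L2 n) t
    = _
  rw [h1, Pi.add_apply, h2, h3]
  rfl

/-- The energy of the path `x + B ∫₀^· φ` in coordinates, for a metric `G₁`. -/
def coordEnergy (G₁ : C(Vec n, Vec n →L[ℝ] Vec n)) (φ : L2 n) : ℝ :=
  (1 / 2) * inner ℝ (mulL2 n (G₁.comp (restrictC F.continuousOn_x + F.disp φ))
      (contToLp (Vec n) 2 (restrictC F.continuousOn_p) + F.dispDeriv φ))
    (contToLp (Vec n) 2 (restrictC F.continuousOn_p) + F.dispDeriv φ)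

theorem contDiff_coordEnergy (G₁ : C(Vec n, Vec n →L[ℝ] Vec n)) (hG₁ : ContDiff ℝ 2 G₁) :
    ContDiff ℝ 2 (F.coordEnergy G₁) := by
  have h0 := contDiff_comp (K := Icc (0 : ℝ) 1) 2 G₁ hG₁
  rw [Nat.cast_ofNat] at h0
  have h1 : ContDiff ℝ 2 (fun φ : L2 n => restrictC F.continuousOn_x + F.disp φ) :=
    contDiff_const.add F.disp.contDiff
  have h2 : ContDiff ℝ 2
      (fun φ : L2 n => contToLp (Vec n) 2 (restrictC F.continuousOn_p) + F.dispDeriv φ) :=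
    contDiff_const.add F.dispDeriv.contDiff
  have h3 := contDiff_inner_mul (mulL2 n) (h0.comp h1) h2
  have e : F.coordEnergy G₁ = fun φ =>
      (1 / 2) * inner ℝ (mulL2 n (G₁.comp (restrictC F.continuousOn_x + F.disp φ))
        (contToLp (Vec n) 2 (restrictC F.continuousOn_p) + F.dispDeriv φ))
      (contToLp (Vec n) 2 (restrictC F.continuousOn_p) + F.dispDeriv φ) := rfl
  rw [e]
  simpa only [Function.comp_apply] using h3

/-- The first derivative of the coordinate energy along the ray `s ↦ s φ`, and the second one at
`s = 0`, in terms of the derivatives of the metric along the curve. -/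
theorem coordEnergy_ray (G₁ : C(Vec n, Vec n →L[ℝ] Vec n)) (hG₁ : ContDiff ℝ 2 G₁) (φ : L2 n) :
    ∃ (a₀ a₁ a₂ : C(Icc (0 : ℝ) 1, Vec n →L[ℝ] Vec n)) (g : ℝ → ℝ),
      (∀ t, a₀ t = G₁ (x t)) ∧ (∀ t, a₁ t = fderiv ℝ G₁ (x t) (B t (prim φ t))) ∧
      (∀ t, a₂ t = fderiv ℝ (fderiv ℝ G₁) (x t) (B t (prim φ t)) (B t (prim φ t))) ∧
      (∀ s, HasDerivAt (fun s : ℝ => F.coordEnergy G₁ (s • φ)) (g s) s) ∧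
      g 0 = (1 / 2) * inner ℝ (mulL2 n a₁ (contToLp (Vec n) 2 (restrictC F.continuousOn_p)))
          (contToLp (Vec n) 2 (restrictC F.continuousOn_p)) +
        (1 / 2) * inner ℝ (mulL2 n a₀ (F.dispDeriv φ))
          (contToLp (Vec n) 2 (restrictC F.continuousOn_p)) +
        (1 / 2) * inner ℝ (mulL2 n a₀ (contToLp (Vec n) 2 (restrictC F.continuousOn_p)))
          (F.dispDeriv φ) ∧
      HasDerivAt g ((1 / 2) * inner ℝ (mulL2 n a₂
          (contToLp (Vec n) 2 (restrictC F.continuousOn_p)))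
          (contToLp (Vec n) 2 (restrictC F.continuousOn_p)) +
        inner ℝ (mulL2 n a₁ (F.dispDeriv φ))
          (contToLp (Vec n) 2 (restrictC F.continuousOn_p)) +
        inner ℝ (mulL2 n a₁ (contToLp (Vec n) 2 (restrictC F.continuousOn_p)))
          (F.dispDeriv φ) +
        inner ℝ (mulL2 n a₀ (F.dispDeriv φ)) (F.dispDeriv φ)) 0 := by
  obtain ⟨a₁, a₂, h1, h2, h3, h4⟩ := exists_ray_derivs hG₁ (restrictC F.continuousOn_x) (F.disp φ)
  obtain ⟨g, g1, g2, g3⟩ := exists_quadratic_ray (mulL2 n) h1 h2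
    (contToLp (Vec n) 2 (restrictC F.continuousOn_p)) (F.dispDeriv φ)
  refine ⟨_, a₁ 0, a₂, g, fun t => ?_, h3, h4, fun s => ?_, g2, g3⟩
  · change G₁ (x t + (0 : ℝ) • B t (prim φ t)) = _
    rw [zero_smul, add_zero]
  · have e : (fun s : ℝ => F.coordEnergy G₁ (s • φ)) = fun s : ℝ => (1 / 2) *
        inner ℝ (mulL2 n (G₁.comp (restrictC F.continuousOn_x + s • F.disp φ))
          (contToLp (Vec n) 2 (restrictC F.continuousOn_p) + s • F.dispDeriv φ))
        (contToLp (Vec n) 2 (restrictC F.continuousOn_p) + s • F.dispDeriv φ) := by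
      funext s
      rw [coordEnergy, map_smul, map_smul]
    rw [e]
    exact g1 s

theorem coordEnergy_eq_integral (G₁ : C(Vec n, Vec n →L[ℝ] Vec n)) (φ : L2 n) :
    F.coordEnergy G₁ φ = (1 / 2) * ∫ t in (0 : ℝ)..1,
      inner ℝ (G₁ (x t + B t (prim φ t)) (p t + frameFieldDeriv Γ x p B (prim φ) φ t))
        (p t + frameFieldDeriv Γ x p B (prim φ) φ t) := by
  rw [coordEnergy]
  congr 1
  have h1 : (contToLp (Vec n) 2 (restrictC F.continuousOn_p) + F.dispDeriv φ : L2 n) =ᵐ[unitVolume]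
      fun t => p t + frameFieldDeriv Γ x p B (prim φ) φ t := by
    filter_upwards [Lp.coeFn_add (contToLp (Vec n) 2 (restrictC F.continuousOn_p)) (F.dispDeriv φ),
      contToLp_restrictC F.continuousOn_p 2, F.dispDeriv_coe φ] with t h1 h2 h3
    rw [h1, Pi.add_apply, h2, h3]
  refine inner_eq_integral_of_ae ?_ h1
  filter_upwards [mulL2_coe (G₁.comp (restrictC F.continuousOn_x + F.disp φ)) _, h1,
    ae_restrict_mem measurableSet_Icc] with t h2 h3 ht
  rw [h2, h3, IccExtend_of_mem _ _ ht]
  rfl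

/-- Near `φ = 0` the path `x + B ∫₀^· φ` stays in a given neighbourhood of the curve `x`. -/
theorem eventually_mem {U : Set (Vec n)} (hU : IsOpen U) (hx : ∀ t ∈ Icc (0 : ℝ) 1, x t ∈ U) :
    ∀ᶠ φ : L2 n in 𝓝 0, ∀ t ∈ Icc (0 : ℝ) 1, x t + B t (prim φ t) ∈ U := by
  have ho : IsOpen {a : C(Icc (0 : ℝ) 1, Vec n) | MapsTo a univ U} :=
    ContinuousMap.isOpen_setOfPred_mapsTo isCompact_univ hU
  have hc : Continuous (fun φ : L2 n => restrictC F.continuousOn_x + F.disp φ) := by fun_prop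
  have h0 : (restrictC F.continuousOn_x + F.disp 0) ∈
      {a : C(Icc (0 : ℝ) 1, Vec n) | MapsTo a univ U} := by
    rw [map_zero, add_zero]
    exact fun t _ => hx t t.2
  filter_upwards [hc.continuousAt.preimage_mem_nhds (ho.mem_nhds h0)] with φ hφ t ht
  exact hφ (mem_univ (⟨t, ht⟩ : Icc (0 : ℝ) 1))

/-- In coordinates, the energy of the path `x + B ∫₀^· φ` agrees near `φ = 0` with a `C²` function
on all of `L²`, and along the rays from `0` its first derivative vanishes and its second derivative
is the quadratic form of `1 + T`. -/
theorem exists_coordinate_energy :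
    ∃ 𝓔 : L2 n → ℝ, ContDiff ℝ 2 𝓔 ∧
      (∀ᶠ φ : L2 n in 𝓝 0, (∀ t ∈ Icc (0 : ℝ) 1, x t + B t (prim φ t) ∈ Ω) ∧
        𝓔 φ = (1 / 2) * ∫ t in (0 : ℝ)..1, inner ℝ (G (x t + B t (prim φ t))
          (p t + frameFieldDeriv Γ x p B (prim φ) φ t))
          (p t + frameFieldDeriv Γ x p B (prim φ) φ t)) ∧
      ∀ φ : L20 n, ∃ g : ℝ → ℝ, (∀ s, HasDerivAt (fun s : ℝ => 𝓔 (s • (φ : L2 n))) (g s) s) ∧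
        g 0 = 0 ∧
        HasDerivAt g (inner ℝ ((1 + operatorT F.continuousOn_R) φ) φ) 0 := by
  -- the metric is replaced by a smooth one on the whole space, equal to it near the curve
  obtain ⟨G₁, hG₁, hGe⟩ := exists_contDiff_eqOn_nhdsSet F.leviCivita.isOpen
    (isCompact_Icc.image_of_continuousOn F.continuousOn_x) (image_subset_iff.2 F.mem)
    F.leviCivita.contDiffOn_metric
  have hG₁2 : ContDiff ℝ 2 G₁ := contDiff_infty.1 hG₁ 2
  have hGx : ∀ t ∈ Icc (0 : ℝ) 1, G₁ =ᶠ[𝓝 (x t)] G := fun t ht =>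
    hGe.filter_mono (nhds_le_nhdsSet (mem_image_of_mem x ht))
  refine ⟨F.coordEnergy ⟨G₁, hG₁.continuous⟩, F.contDiff_coordEnergy _ hG₁2, ?_, fun φ => ?_⟩
  · obtain ⟨O, hO, hsO, hOG⟩ := eventually_nhdsSet_iff_exists.1
      (hGe.and (F.leviCivita.isOpen.mem_nhdsSet.2 (image_subset_iff.2 F.mem)))
    filter_upwards [F.eventually_mem hO fun t ht => hsO (mem_image_of_mem x ht)] with φ hφ
    refine ⟨fun t ht => (hOG _ (hφ t ht)).2, ?_⟩
    rw [F.coordEnergy_eq_integral]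
    congr 1
    refine intervalIntegral.integral_congr fun t ht => ?_
    rw [uIcc_of_le zero_le_one] at ht
    change inner ℝ (G₁ _ _) _ = _
    rw [(hOG _ (hφ t ht)).1]
  · obtain ⟨a₀, a₁, a₂, g, h0, h1, h2, g1, g2, g3⟩ :=
      F.coordEnergy_ray ⟨G₁, hG₁.continuous⟩ hG₁2 (φ : L2 n)
    have hw := contToLp_restrictC F.continuousOn_p 2
    set w := contToLp (Vec n) 2 (restrictC F.continuousOn_p)
    have hW := F.dispDeriv_coe (φ : L2 n)
    set W := F.dispDeriv (φ : L2 n)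
    have h0' : ∀ t : Icc (0 : ℝ) 1, a₀ t = G (x t) := fun t =>
      (h0 t).trans (hGx t t.2).eq_of_nhds
    have h1' : ∀ t : Icc (0 : ℝ) 1, a₁ t = fderiv ℝ G (x t) (B t (prim (φ : L2 n) t)) := by
      intro t
      have e := (hGx t t.2).fderiv_eq (𝕜 := ℝ)
      rw [h1 t, ← e]
      rfl
    have h2' : ∀ t : Icc (0 : ℝ) 1, a₂ t = fderiv ℝ (fderiv ℝ G) (x t)
        (B t (prim (φ : L2 n) t)) (B t (prim (φ : L2 n) t)) := by
      intro t
      have e := ((hGx t t.2).fderiv (𝕜 := ℝ)).fderiv_eq (𝕜 := ℝ)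
      rw [h2 t, ← e]
      rfl
    have m0w := mulL2_ae (b := fun t => G (x t)) h0' hw
    have m0W := mulL2_ae (b := fun t => G (x t)) h0' hW
    have m1w := mulL2_ae (b := fun t => fderiv ℝ G (x t) (B t (prim (φ : L2 n) t))) h1' hw
    have m1W := mulL2_ae (b := fun t => fderiv ℝ G (x t) (B t (prim (φ : L2 n) t))) h1' hW
    have m2w := mulL2_ae (b := fun t => fderiv ℝ (fderiv ℝ G) (x t)
        (B t (prim (φ : L2 n) t)) (B t (prim (φ : L2 n) t))) h2' hw
    have ii := fun u v : L2 n => intervalIntegrable_inner u v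
    have hp := absolutelyContinuousOnInterval_prim (φ : L2 n) one_mem_unitInterval
    have hd := ae_hasDerivAt_prim (φ : L2 n)
    refine ⟨g, g1, ?_, ?_⟩
    · refine Eq.trans ?_ (F.first_variation hp hd (prim_zero _) (L20.prim_one φ))
      rw [g2, inner_eq_integral, inner_eq_integral, inner_eq_integral,
        ← intervalIntegral.integral_const_mul,
        ← intervalIntegral.integral_const_mul, ← intervalIntegral.integral_const_mul,
        ← intervalIntegral.integral_add ((ii _ _).const_mul _) ((ii _ _).const_mul _),
        ← intervalIntegral.integral_add (((ii _ _).const_mul _).add ((ii _ _).const_mul _))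
          ((ii _ _).const_mul _)]
      refine integral_congr_unitVolume ?_ zero_mem_unitInterval one_mem_unitInterval
      filter_upwards [hw, hW, m0w, m0W, m1w, ae_restrict_mem measurableSet_Icc]
        with t k1 k2 k3 k4 k5 ht
      rw [k1, k2, k3, k4, k5, F.leviCivita.symm _ (F.mem t ht) (frameFieldDeriv Γ x p B _ _ t)]
      ring
    · refine g3.congr_deriv ?_
      have hq : (inner ℝ ((1 + operatorT F.continuousOn_R) φ) φ : ℝ) = ∫ t in (0 : ℝ)..1,
          ((1 / 2) * inner ℝ (fderiv ℝ (fderiv ℝ G) (x t) (B t (prim (φ : L2 n) t))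
            (B t (prim (φ : L2 n) t)) (p t)) (p t)
          + 2 * inner ℝ (fderiv ℝ G (x t) (B t (prim (φ : L2 n) t)) (p t))
            (frameFieldDeriv Γ x p B (prim (φ : L2 n)) (φ : L2 n) t)
          + inner ℝ (G (x t) (frameFieldDeriv Γ x p B (prim (φ : L2 n)) (φ : L2 n) t))
            (frameFieldDeriv Γ x p B (prim (φ : L2 n)) (φ : L2 n) t)) := by
        rw [F.second_variation hp hd (prim_zero _) (L20.prim_one φ) (intervalIntegrable_norm_sq _),
          ← norm_sq_eq_integral, add_apply, inner_add_left, inner_operatorT_eq_integral,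
          ← sub_eq_add_neg]
        change inner ℝ (φ : L2 n) (φ : L2 n) - _ = _
        rw [real_inner_self_eq_norm_sq]
      rw [hq, inner_eq_integral, inner_eq_integral, inner_eq_integral, inner_eq_integral,
        ← intervalIntegral.integral_const_mul,
        ← intervalIntegral.integral_add ((ii _ _).const_mul _) (ii _ _),
        ← intervalIntegral.integral_add (((ii _ _).const_mul _).add (ii _ _)) (ii _ _),
        ← intervalIntegral.integral_add ((((ii _ _).const_mul _).add (ii _ _)).add (ii _ _))
          (ii _ _)]
      refine integral_congr_unitVolume ?_ zero_mem_unitInterval one_mem_unitInterval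
      filter_upwards [hw, hW, m0W, m1w, m1W, m2w, ae_restrict_mem measurableSet_Icc]
        with t k1 k2 k3 k4 k5 k6 ht
      have hsym : (inner ℝ (fderiv ℝ G (x t) (B t (prim (φ : L2 n) t))
            (frameFieldDeriv Γ x p B (prim (φ : L2 n)) (φ : L2 n) t)) (p t) : ℝ) =
          inner ℝ (fderiv ℝ G (x t) (B t (prim (φ : L2 n) t)) (p t))
            (frameFieldDeriv Γ x p B (prim (φ : L2 n)) (φ : L2 n) t) := by
        rw [F.leviCivita.compat _ (F.mem t ht), F.leviCivita.compat _ (F.mem t ht), add_comm]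
      rw [k1, k2, k3, k4, k5, k6, hsym]
      ring

end IsFrameAlong

end CoordinateEnergy

/-! ### The Hessian of the energy -/

section Hessian

set_option linter.unusedSectionVars false

open Filter

set_option synthInstance.maxHeartbeats 400000

variable {n : ℕ} {M : Type*} [MetricSpace M] [ChartedSpace (Vec n) M] [IsManifold (𝓡 n) ∞ M]
  [RiemannianBundle (fun x : M => TangentSpace (𝓡 n) x)]
  [IsContMDiffRiemannianBundle (𝓡 n) ∞ (Vec n) (fun x : M => TangentSpace (𝓡 n) x)]
  {e : OpenPartialHomeomorph M (Vec n)} {c : ℝ → M}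
  {u : ∀ t, Vec n ≃ₗᵢ[ℝ] TangentSpace (𝓡 n) (c t)}

theorem isSelfAdjoint_one_add {H : Type*} [NormedAddCommGroup H] [InnerProductSpace ℝ H]
    [CompleteSpace H] {T : H →L[ℝ] H} (hT : IsSelfAdjoint T) : IsSelfAdjoint (1 + T) :=
  (IsSelfAdjoint.one _).add hT

theorem norm_velocity_sq (he : e ∈ IsManifold.maximalAtlas (𝓡 n) ∞ M) {γ : ℝ → M} {t : ℝ}
    (ht : t ∈ Icc (0 : ℝ) 1) (hγ : ContinuousWithinAt γ (Icc 0 1) t) (hte : γ t ∈ e.source)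
    {v : Vec n} (hd : HasDerivWithinAt (e ∘ γ) v (Icc 0 1) t) :
    ‖velocity (n := n) γ t‖ ^ 2 = inner ℝ (metricOp e (e (γ t)) v) v := by
  rw [← real_inner_self_eq_norm_sq, ← inner_metricOp_chartDiff he hte,
    chartDiff_velocity he ht hγ hte hd.differentiableWithinAt,
    hd.derivWithin (uniqueDiffWithinAt_unitInterval ht)]

theorem H0.eval_eq_prim (h : H0 n) {t : ℝ} (ht : t ∈ Icc (0 : ℝ) 1) :
    h.eval t = prim (((U n).symm h : L20 n) : L2 n) t := by
  conv_lhs => rw [← (U n).apply_symm_apply h]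
  exact U_eval _ ht

/-- The energy of a path in a chart of the path space, if this path stays in the domain of the
chart of the manifold. -/
theorem energy_pathChart (hc : IsGeodesic (n := n) c) (hu : IsParallelFrame c u)
    (he : e ∈ IsManifold.maximalAtlas (𝓡 n) ∞ M) (hce : MapsTo c (Icc 0 1) e.source) (h : H0 n)
    (hmem : ∀ t ∈ Icc (0 : ℝ) 1, (e ∘ c) t +
      frameOp e c u t (prim (((U n).symm h : L20 n) : L2 n) t) ∈ e.target) :
    energy (n := n) (pathChart c u e h) = (1 / 2) * ∫ t in (0 : ℝ)..1,
      inner ℝ (metricOp e ((e ∘ c) t + frameOp e c u t (prim (((U n).symm h : L20 n) : L2 n) t))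
        (derivWithin (e ∘ c) (Icc 0 1) t + frameFieldDeriv (christoffelCLM e) (e ∘ c)
          (derivWithin (e ∘ c) (Icc 0 1)) (frameOp e c u) (prim (((U n).symm h : L20 n) : L2 n))
          (((U n).symm h : L20 n) : L2 n) t))
        (derivWithin (e ∘ c) (Icc 0 1) t + frameFieldDeriv (christoffelCLM e) (e ∘ c)
          (derivWithin (e ∘ c) (Icc 0 1)) (frameOp e c u) (prim (((U n).symm h : L20 n) : L2 n))
          (((U n).symm h : L20 n) : L2 n) t) := by
  have F := isFrameAlong_chart hc hu he hce
  set φ : L2 n := (((U n).symm h : L20 n) : L2 n) with hφ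
  set B := frameOp e c u with hB
  have hγ : ∀ t ∈ Icc (0 : ℝ) 1, pathChart c u e h t = e.symm ((e ∘ c) t + B t (prim φ t)) :=
    fun t ht => by rw [pathChart, H0.eval_eq_prim h ht]; rfl
  have hcoord : ∀ t ∈ Icc (0 : ℝ) 1,
      e (pathChart c u e h t) = (e ∘ c) t + B t (prim φ t) := fun t ht => by
    rw [hγ t ht, e.right_inv (hmem t ht)]
  have hcont : ContinuousOn (pathChart c u e h) (Icc 0 1) := by
    refine ContinuousOn.congr ?_ hγ
    exact e.continuousOn_symm.comp
      (F.continuousOn_x.add (F.continuousOn_B.clm_apply (continuousOn_prim φ))) hmem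
  rw [energy]
  congr 1
  refine intervalIntegral.integral_congr_ae ?_
  have h1 : ∀ᵐ t : ℝ, t ≠ 1 := by simp [ae_iff, measure_singleton]
  filter_upwards [F.ae_hasDerivAt_field (ae_hasDerivAt_prim φ), h1] with t ht ht1 htI
  rw [uIoc_of_le zero_le_one] at htI
  have htI' : t ∈ Ioo (0 : ℝ) 1 := ⟨htI.1, lt_of_le_of_ne htI.2 ht1⟩
  have htc := Ioo_subset_Icc_self htI'
  have hd : HasDerivWithinAt (e ∘ pathChart c u e h) (derivWithin (e ∘ c) (Icc 0 1) t +
      frameFieldDeriv (christoffelCLM e) (e ∘ c) (derivWithin (e ∘ c) (Icc 0 1)) B (prim φ) φ t)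
      (Icc 0 1) t :=
    ((F.deriv t htc).add (ht htI').hasDerivWithinAt).congr hcoord (hcoord t htc)
  have hs : pathChart c u e h t ∈ e.source := by
    rw [hγ t htc]; exact e.map_target (hmem t htc)
  rw [norm_velocity_sq he htc (hcont t htc) hs hd, hcoord t htc]

/-- In every chart around the geodesic, the derivatives of the energy along rays of `H₀` at `0` are
those of the form `⟨(1 + T) φ, φ⟩`; smoothness and polarization turn them into the gradient and the
Hessian. -/
theorem isEnergyHessian (hc : IsGeodesic (n := n) c) (hu : IsParallelFrame c u)
    (hex : ∃ e ∈ IsManifold.maximalAtlas (𝓡 n) ∞ M, MapsTo c (Icc 0 1) e.source)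
    (hR : ContinuousOn (curvatureOp c u) (Icc 0 1)) :
    IsEnergyHessian c u
      (((U n).toContinuousLinearEquiv : L20 n →L[ℝ] H0 n) ∘L (1 + operatorT hR) ∘L
        ((U n).symm.toContinuousLinearEquiv : H0 n →L[ℝ] L20 n)) := by
  refine ⟨hex, fun e he hce => ?_⟩
  have F := isFrameAlong_chart hc hu he hce
  obtain ⟨𝓔, h𝓔, hloc, hray⟩ := F.exists_coordinate_energy
  set L : H0 n →L[ℝ] L2 n := (L20 n).subtypeL ∘L
    ((U n).symm.toContinuousLinearEquiv : H0 n →L[ℝ] L20 n) with hL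
  have hLa : ∀ h, L h = (((U n).symm h : L20 n) : L2 n) := fun h => rfl
  have hloc' : (fun k => energy (n := n) (pathChart c u e k)) =ᶠ[𝓝 0] fun h => 𝓔 (L h) := by
    have ht : Tendsto L (𝓝 0) (𝓝 0) := by
      have := L.continuous.tendsto 0
      rwa [map_zero] at this
    filter_upwards [ht.eventually hloc] with h hh
    rw [energy_pathChart hc hu he hce h hh.1, hh.2]
    rfl
  have h2 : ContDiff ℝ 2 (fun h => 𝓔 (L h)) := h𝓔.comp L.contDiff
  have hsa : IsSelfAdjoint (1 + operatorT hR) :=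
    isSelfAdjoint_one_add (isSelfAdjoint_operatorT hR fun t ht => F.R_symm ht)
  have hsym : ∀ φ ψ, inner ℝ ((1 + operatorT hR) φ) ψ =
      (inner ℝ φ ((1 + operatorT hR) ψ) : ℝ) :=
    ContinuousLinearMap.isSelfAdjoint_iff_isSymmetric.1 hsa
  have hU : ∀ (φ : L20 n) (k : H0 n), (inner ℝ (U n φ) k : ℝ) = inner ℝ φ ((U n).symm k) :=
    fun φ k => by
      conv_lhs => rw [← (U n).apply_symm_apply k]
      exact (U n).inner_map_map _ _
  obtain ⟨hg0, hg1⟩ := hasFDerivAt_gradient_of_rays h2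
    (A := ((U n).toContinuousLinearEquiv : L20 n →L[ℝ] H0 n) ∘L (1 + operatorT hR) ∘L
        ((U n).symm.toContinuousLinearEquiv : H0 n →L[ℝ] L20 n)) (fun h k => by
      change (inner ℝ (U n ((1 + operatorT hR) ((U n).symm h))) k : ℝ) =
        inner ℝ h (U n ((1 + operatorT hR) ((U n).symm k)))
      rw [real_inner_comm _ h, hU, hU, hsym, real_inner_comm]) fun h => by
      obtain ⟨g, k1, k2, k3⟩ := hray ((U n).symm h)
      refine ⟨g, fun s => ?_, k2, ?_⟩
      · simpa only [map_smul, hLa, Submodule.coe_smul] using k1 s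
      · refine k3.congr_deriv ?_
        exact (hU _ _).symm
  have hgr : (gradient fun k => energy (n := n) (pathChart c u e k)) =ᶠ[𝓝 0]
      gradient fun h => 𝓔 (L h) := by
    filter_upwards [hloc'.fderiv (𝕜 := ℝ)] with h hh
    rw [gradient, hh, gradient]
  refine ⟨?_, ?_, ?_⟩
  · filter_upwards [hloc'.eventuallyEq_nhds] with h hh
    exact (h2.differentiable (by simp) h).congr_of_eventuallyEq hh
  · rw [hgr.eq_of_nhds, hg0]
  · exact hg1.congr_of_eventuallyEq hgr

end Hessian

end PathHessian

end

theorem proposition4p3 {n : ℕ} (hn : 0 < n)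
    {M : Type*} [MetricSpace M] [CompleteSpace M] [ChartedSpace (Vec n) M]
    [IsManifold (𝓡 n) ∞ M]
    [RiemannianBundle (fun x : M => TangentSpace (𝓡 n) x)]
    [IsContMDiffRiemannianBundle (𝓡 n) ∞ (Vec n) (fun x : M => TangentSpace (𝓡 n) x)]
    [IsRiemannianManifold (𝓡 n) M]
    (x₀ y₀ : M) (hinj : edist x₀ y₀ < injectivityRadius (n := n) y₀)
    (c : ℝ → M) (hc : IsMinimalGeodesic (n := n) c x₀ y₀)
    (u : ∀ t, Vec n ≃ₗᵢ[ℝ] TangentSpace (𝓡 n) (c t)) (hu : IsParallelFrame c u)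
    (f f' : ℝ → Vec n →L[ℝ] Vec n) (hf : IsJacobiSolution (curvatureAlong c u) f f') :
    (∀ t ∈ Ico (0 : ℝ) 1, IsUnit (f t)) ∧
    ∃ (T : L20 n →L[ℝ] L20 n) (S : L20 n ≃L[ℝ] L2 n),
      IsOperatorT (curvatureAlong c u) T ∧
      IsOperatorS f f' (S : L20 n →L[ℝ] L2 n) ∧
      IsSelfAdjoint T ∧
      (∀ φ : L20 n, ‖S φ‖ ^ 2 = inner ℝ ((1 + T) φ) φ) ∧
      IsEnergyHessian c u
        (((U n).toContinuousLinearEquiv : L20 n →L[ℝ] H0 n) ∘L (1 + T) ∘L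
          ((U n).symm.toContinuousLinearEquiv : H0 n →L[ℝ] L20 n)) ∧
      1 + T = ContinuousLinearMap.adjoint (S : L20 n →L[ℝ] L2 n) ∘L (S : L20 n →L[ℝ] L2 n) ∧
      ContinuousLinearMap.adjoint (S.symm : L2 n →L[ℝ] L20 n) ∘L (1 + T) =
        (S : L20 n →L[ℝ] L2 n) ∧
      IsUnit (1 + T) ∧
      Ring.inverse (1 + T) = (S.symm : L2 n →L[ℝ] L20 n) ∘L
        ContinuousLinearMap.adjoint (S.symm : L2 n →L[ℝ] L20 n) ∧
      0 < ‖ContinuousLinearMap.adjoint (S.symm : L2 n →L[ℝ] L20 n)‖ ∧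
      IsGLB (spectrum ℝ (1 + T))
        (1 / ‖ContinuousLinearMap.adjoint (S.symm : L2 n →L[ℝ] L20 n)‖ ^ 2) ∧
      IsGLB {r : ℝ | ∃ φ : L20 n, ‖φ‖ = 1 ∧ r = ‖S φ‖ ^ 2}
        (1 / ‖ContinuousLinearMap.adjoint (S.symm : L2 n →L[ℝ] L20 n)‖ ^ 2) := by
  obtain ⟨A, D, J⟩ := exists_isJacobiFactorization hinj hc hu hf
  obtain ⟨e, he, hce, -⟩ := exists_chart_of_lt_injectivityRadius u hinj hc
  have := nontrivial_L20 hn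
  have hT := isSelfAdjoint_operatorT J.continuousOn_R J.symm
  have hB := isSelfAdjoint_one_add hT
  have hS : ∀ φ : L20 n, ‖J.equivS φ‖ ^ 2 = inner ℝ ((1 + operatorT J.continuousOn_R) φ) φ :=
    J.norm_sq_linS
  have hfac := eq_adjoint_comp hB hS
  have hinv := isUnit_and_inverse_eq hfac
  have hnorm : ‖ContinuousLinearMap.adjoint (J.equivS.symm : L2 n →L[ℝ] L20 n)‖ =
      ‖(J.equivS.symm : L2 n →L[ℝ] L20 n)‖ :=
    (ContinuousLinearMap.adjoint (𝕜 := ℝ)).norm_map _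
  refine ⟨fun t ht => J.isUnit ht, operatorT J.continuousOn_R, J.equivS,
    isOperatorT_operatorT J.continuousOn_R, J.linS_coe, hT, hS,
    isEnergyHessian hc.1 hu ⟨e, he, hce⟩ J.continuousOn_R, hfac, adjoint_symm_comp_eq hfac,
    hinv.1, hinv.2, ?_, ?_, ?_⟩
  · rw [hnorm]
    exact norm_symm_pos
  · rw [hnorm]
    exact isGLB_spectrum hB hS
  · rw [hnorm]
    exact isGLB_norm_sq
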